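/- \textbf{Setting.} Let $P$ be the joint law of $(x,y,\delta)$, where $x$ (in a measurable space) is always observed, $y=(Y_1,\dots,Y_p)\in\mathbb R^p$ is subject to missingness, and $\delta\in\{1,\dots,T\}$ is the missing pattern. Under pattern $t$ only the components $y_{obs(t)}$ of $y$ are observed; different patterns have different sets $obs(t)$, and pattern $1$ is the complete one, $y_{obs(1)}=y$. Let $(x_i,y_i,\delta_i)$, $i=1,2,\dots$, be independent with law $P$; in the sample $i=1,\dots,N$ put $S_t=\{i\le N:\delta_i=t\}$, $N_t=|S_t|$, $\delta_{i,t}=1\{\delta_i=t\}$. For $t=2,\dots,T$ let $b^{(t)}=(b^{(t)}_1,\dots,b^{(t)}_{L(t)})$ be measurable functions of $(x,y_{obs(t)})$, put $z_t=(1,b^{(t)})$, $z_{i,t}=(1,b^{(t)}_i)$, and $r_t(z_t;\phi)=\exp(\phi^{\rm T}z_t)$ for $\phi\in\mathbb R^{L(t)+1}$. Let $U(\theta;x,y)\in\mathbb R^q$, $\theta\in\Theta\subset\mathbb R^q$, be an estimating function, and let $\theta_0\in\Theta$. \textbf{Model.} For $t=2,\dots,T$: (i) (log-linear smoothed density ratio)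 the law of $z_t$ given $\delta=t$ has density $r_t(\cdot\,;\lambda_t)$ with respect to the law of $z_t$ given $\delta=1$; (ii) (missing at random given $b^{(t)}$) for every $\theta\in\Theta$ there is a measurable function $h$ with $E\{U(\theta;x,y)\mid b^{(t)},\delta=t\}=h(z_t)$ a.s. given $\delta=t$ and $E\{U(\theta;x,y)\mid b^{(t)},\delta=1\}=h(z_t)$ a.s. given $\delta=1$. \textbf{Regularity conditions.} $P(\delta=t)>0$ for $t=1,\dots,T$. $\Theta$ is compact, $\theta_0$ is an interior point of $\Theta$ and the only solution in $\Theta$ of $E\,U(\theta;x,y)=0$. $U(\theta;\cdot)$ is measurable for each $\theta\in\Theta$; $U(\cdot\,;x,y)$ is continuous on $\Theta$ and continuously differentiable in the interior of $\Theta$. The matrix $\tau=E\{\partial U(\theta_0;x,y)/\partial\theta^{\rm T}\}$ is nonsingular. For $t\ge2$, if $a^{\rm T}z_t=0$ almost surely given $\delta=1$, then $a=0$. There are $\rho>0$ and a measurable function $G(x,y)$ with $\|U(\theta;x,y)\|\le G(x,y)$ for $\theta\in\Theta$ and $\|\partial U(\theta;x,y)/\partial\theta^{\rm T}\|\le G(x,y)$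 for $\|\theta-\theta_0\|<\rho$, such that $E\,G<\infty$ and $E[\exp(\lambda_t^{\rm T}z_t+\rho\|z_t\|)(1+G)\mid\delta=1]<\infty$ for $t\ge2$. Finally $E\|U(\theta_0;x,y)\|^2<\infty$ and, for $t\ge2$, $E[r_t(z_t;\lambda_t)^2\{\|U(\theta_0;x,y)\|^2+\|z_t\|^2\}\mid\delta=1]<\infty$. \textbf{Theorem.} For $t=2,\dots,T$, with probability tending to one the equation $$\sum_{i=1}^N\delta_{i,1}\,r_t(z_{i,t};\lambda_t)\{U(\theta_0;x_i,y_i)-\beta_tz_{i,t}\}z_{i,t}^{\rm T}=0$$ has a unique solution $\beta_t\in\mathbb R^{q\times(L(t)+1)}$, and its solutions converge in probability to a constant matrix $\tilde\beta_t$. Let $\hat\phi^{(t)}$, $t=2,\dots,T$, and $\hat\theta_{\rm SPS}\in\Theta$ satisfy, with probability tending to one, the calibration equations $$N_1^{-1}\sum_{i\in S_1}r_t(z_{i,t};\hat\phi^{(t)})\,z_{i,t}=N_t^{-1}\sum_{i\in S_t}z_{i,t},\qquad t=2,\dots,T,$$ and the estimating equation $$N^{-1}\sum_{i\in S_1}\hat\omega_i\,U(\hat\theta_{\rm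 SPS};x_i,y_i)=0,\qquad \hat\omega_i=1+\sum_{t=2}^T\frac{N_t}{N_1}r_t(z_{i,t};\hat\phi^{(t)}).$$ Then, as $N\to\infty$, $$\sqrt N(\hat\theta_{\rm SPS}-\theta_0)=\frac1{\sqrt N}\sum_{i=1}^Nd_i+o_p(1),$$ where, with $U_i=U(\theta_0;x_i,y_i)$, $$d_i=-\tau^{-1}\Big[\delta_{i,1}U_i+\sum_{t=2}^T\delta_{i,t}\tilde\beta_tz_{i,t}+\delta_{i,1}\sum_{t=2}^T\frac{N_t}{N_1}r_t(z_{i,t};\lambda_t)\{U_i-\tilde\beta_tz_{i,t}\}\Big].$$ -/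

import Mathlib

open MeasureTheory ProbabilityTheory Filter Topology

noncomputable section

/-- `E n` is `ℝⁿ` with the Euclidean norm. -/
abbrev E (n : ℕ) : Type := EuclideanSpace ℝ (Fin n)

/-- The full data `(x, y)` of one unit: `x` is always observed and takes values in an arbitrary
measurable space, `y = (Y₁, …, Y_p)` is subject to missingness. -/
abbrev FullData (X : Type*) (p : ℕ) : Type _ := X × (Fin p → ℝ)

/-- The full data of one unit together with the index `δ` of its missing pattern.  There are
`T = K + 1` patterns; the index `0` is the pattern "completely observed" (pattern `1` in the usual
counting), and the indices `t.succ`, `t : Fin K`, are the remaining patterns `2, …, T`. -/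
abbrev Datum (X : Type*) (p K : ℕ) : Type _ := FullData X p × Fin (K + 1)

/-- What the statistician chooses or knows: the missing patterns, the calibration functions of each
incomplete pattern, and the estimating function `U(θ; x, y)` with values in `ℝ^q`. -/
structure Design (X : Type*) (p K q : ℕ) where
  /-- the set of components of `y` that are observed under each pattern -/
  obs : Fin (K + 1) → Finset (Fin p)
  obs_zero : obs 0 = Finset.univ
  obs_injective : Function.Injective obs
  /-- the number of calibration functions of pattern `t` -/
  L : Fin K → ℕ
  /-- the calibration functions `b⁽ᵗ⁾`; they see `x` and the observed part of `y` only -/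
  b : (t : Fin K) → X × (obs t.succ → ℝ) → (Fin (L t) → ℝ)
  /-- the estimating function -/
  U : E q → FullData X p → E q

namespace Design

variable {X : Type*} {p K q : ℕ} (S : Design X p K q)

/-- `z_t = (1, b⁽ᵗ⁾(x, y_{obs(t)}))`. -/
def z (t : Fin K) (w : FullData X p) : E (S.L t + 1) :=
  WithLp.toLp 2 (Fin.cons 1 (S.b t (w.1, (S.obs t.succ).restrict w.2)))

/-- The log-linear function `r_t(z_t; φ) = exp (φ₀ + ∑ j, φ_j b_j⁽ᵗ⁾)`. -/
def r (t : Fin K) (φ : E (S.L t + 1)) (w : FullData X p) : ℝ :=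
  Real.exp (inner ℝ φ (S.z t w))

/-! ### Population -/

/-- The conditional law of a unit given that its missing pattern is `s`. -/
def patternLaw [MeasurableSpace X] (P : Measure (Datum X p K)) (s : Fin (K + 1)) :
    Measure (Datum X p K) :=
  ProbabilityTheory.cond P {d | d.2 = s}

/-- The log-linear (smoothed) density ratio model with parameters `lam t`: the density of the
calibration vector in pattern `t` divided by its density in the complete pattern is
`exp (lam₀ + ∑ j, lam_j b_j⁽ᵗ⁾)`.  If the full data have densities `f_t` and `f_1` in the two
patterns, this density ratio is the smoothed ratio `𝔼 (f_t / f_1 ∣ b⁽ᵗ⁾, δ = 1)`. -/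
def DensityRatioModel [MeasurableSpace X] (P : Measure (Datum X p K))
    (lam : (t : Fin K) → E (S.L t + 1)) : Prop :=
  ∀ t : Fin K,
    (patternLaw P t.succ).map (fun d => S.z t d.1) =
      ((patternLaw P 0).map (fun d => S.z t d.1)).withDensity
        (fun v => ENNReal.ofReal (Real.exp (inner ℝ (lam t) v)))

/-- Missing at random given the calibration functions: the regression of `U(θ; x, y)` on `b⁽ᵗ⁾` is
the same function `h` in pattern `t` and in the complete pattern. -/
def ReducedMAR [MeasurableSpace X] (P : Measure (Datum X p K)) (Θ : Set (E q)) : Prop :=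
  ∀ t : Fin K, ∀ θ ∈ Θ, ∃ h : E (S.L t + 1) → E q, Measurable h ∧
    ∀ s ∈ ({0, t.succ} : Set (Fin (K + 1))),
      condExp (MeasurableSpace.comap (fun d : Datum X p K => S.z t d.1) inferInstance)
        (patternLaw P s) (fun d => S.U θ d.1)
        =ᵐ[patternLaw P s] fun d => h (S.z t d.1)

/-- The gradient matrix `𝔼 {∂U(θ; x, y)/∂θ}`, as a linear map. -/
def gradient [MeasurableSpace X] (P : Measure (Datum X p K)) (θ : E q) : E q →L[ℝ] E q :=
  ∫ d, fderiv ℝ (fun θ' => S.U θ' d.1) θ ∂P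

/-- Regularity conditions. -/
structure Regular [MeasurableSpace X] (P : Measure (Datum X p K)) (Θ : Set (E q)) (θ₀ : E q)
    (lam : (t : Fin K) → E (S.L t + 1)) : Prop where
  /-- all the patterns occur -/
  pattern_pos : ∀ s : Fin (K + 1), P {d | d.2 = s} ≠ 0
  measurable_b : ∀ t, Measurable (S.b t)
  measurable_U : ∀ θ ∈ Θ, Measurable (S.U θ)
  /-- `θ₀` is an interior point of the compact parameter set `Θ` … -/
  isCompact : IsCompact Θ
  mem_interior : θ₀ ∈ interior Θ
  /-- … and the unique solution in `Θ` of `𝔼 U(θ; x, y) = 0` -/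
  identified : ∀ θ ∈ Θ, (∫ d, S.U θ d.1 ∂P = 0 ↔ θ = θ₀)
  /-- smoothness of the estimating function in `θ` -/
  continuousOn_U : ∀ w, ContinuousOn (fun θ => S.U θ w) Θ
  contDiffOn_U : ∀ w, ContDiffOn ℝ 1 (fun θ => S.U θ w) (interior Θ)
  nonsingular : (S.gradient P θ₀).IsInvertible
  /-- the functions `1, b₁⁽ᵗ⁾, …, b_L⁽ᵗ⁾` are linearly independent on the complete pattern -/
  linearIndependent : ∀ t, ∀ a : E (S.L t + 1),
    (∀ᵐ d ∂(patternLaw P 0), inner ℝ a (S.z t d.1) = 0) → a = 0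
  /-- `U` on `Θ` and `∂U/∂θ` near `θ₀` have an envelope `G` that is integrable, also against the
  supremum `exp (lam · z + ρ ‖z‖)` of the density ratios with parameter within `ρ` of `lam` -/
  dominated : ∃ ρ : ℝ, 0 < ρ ∧ ∃ G : FullData X p → ℝ, Measurable G ∧
    (∀ w, ∀ θ ∈ Θ, ‖S.U θ w‖ ≤ G w) ∧
    (∀ w, ∀ θ ∈ Metric.ball θ₀ ρ, ‖fderiv ℝ (fun θ' => S.U θ' w) θ‖ ≤ G w) ∧
    Integrable (fun d => G d.1) P ∧
    ∀ t, Integrable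
      (fun d => Real.exp (inner ℝ (lam t) (S.z t d.1) + ρ * ‖S.z t d.1‖) * (1 + G d.1))
      (patternLaw P 0)
  /-- second moments -/
  memLp_U : MemLp (fun d => S.U θ₀ d.1) 2 P
  memLp_r_U : ∀ t, MemLp (fun d => S.r t (lam t) d.1 • S.U θ₀ d.1) 2 (patternLaw P 0)
  memLp_r_z : ∀ t, MemLp (fun d => S.r t (lam t) d.1 • S.z t d.1) 2 (patternLaw P 0)

/-! ### Sample; the sample of size `N` consists of the units `d 0, …, d (N - 1)` -/

variable (d : ℕ → Datum X p K) (N : ℕ)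

/-- The set `S_s` of the units of the sample that have missing pattern `s`. -/
def sampleSet (s : Fin (K + 1)) : Finset ℕ := {i ∈ Finset.range N | (d i).2 = s}

/-- The number `N_s` of these units. -/
def count (s : Fin (K + 1)) : ℝ := ((sampleSet d N s).card : ℝ)

/-- `φ` solves the calibration equation of pattern `t`,
`N₁⁻¹ ∑_{i ∈ S₁} r_t(z_{i,t}; φ) z_{i,t} = N_t⁻¹ ∑_{i ∈ S_t} z_{i,t}`. -/
def IsCalibrated (t : Fin K) (φ : E (S.L t + 1)) : Prop :=
  (count d N 0)⁻¹ • ∑ i ∈ sampleSet d N 0, S.r t φ (d i).1 • S.z t (d i).1 =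
    (count d N t.succ)⁻¹ • ∑ i ∈ sampleSet d N t.succ, S.z t (d i).1

/-- The weight `ω_i = 1 + ∑_{t ≥ 2} (N_t / N₁) r_t(z_{i,t}; φ⁽ᵗ⁾)` of the unit `i ∈ S₁` (the term of
the complete pattern, with density ratio `1`, is the summand `1`). -/
def weight (φ : (t : Fin K) → E (S.L t + 1)) (i : ℕ) : ℝ :=
  1 + ∑ t : Fin K, count d N t.succ / count d N 0 * S.r t (φ t) (d i).1

/-- The smoothed propensity score estimating function
`N⁻¹ ∑_{i ∈ S₁} ω_i U(θ; x_i, y_i)`. -/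
def USPS (φ : (t : Fin K) → E (S.L t + 1)) (θ : E q) : E q :=
  (N : ℝ)⁻¹ • ∑ i ∈ sampleSet d N 0, S.weight d N φ i • S.U θ (d i).1

/-- `β` solves the weighted normal equations
`∑_{i ∈ S₁} r_t(z_{i,t}; lam) {U(θ₀; x_i, y_i) - β z_{i,t}} z_{i,t}ᵀ = 0`, written column by column;
the `q × (L + 1)` matrix `β` is a linear map. -/
def IsRegressionCoeff (θ₀ : E q) (t : Fin K) (lam : E (S.L t + 1))
    (β : E (S.L t + 1) →L[ℝ] E q) : Prop :=
  ∀ j : Fin (S.L t + 1),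
    ∑ i ∈ sampleSet d N 0,
      (S.r t lam (d i).1 * S.z t (d i).1 j) • (S.U θ₀ (d i).1 - β (S.z t (d i).1)) = 0

/-- The influence function `d(x_i, y_i, δ_i; lam)` of unit `i`. -/
def influence [MeasurableSpace X] (P : Measure (Datum X p K)) (θ₀ : E q)
    (lam : (t : Fin K) → E (S.L t + 1)) (β : (t : Fin K) → E (S.L t + 1) →L[ℝ] E q) (i : ℕ) : E q :=
  -(S.gradient P θ₀).inverse
    ((if (d i).2 = 0 then S.U θ₀ (d i).1 else 0)
      + (∑ t : Fin K, if (d i).2 = t.succ then β t (S.z t (d i).1) else 0)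
      + (if (d i).2 = 0 then
          ∑ t : Fin K, (count d N t.succ / count d N 0 * S.r t (lam t) (d i).1) •
            (S.U θ₀ (d i).1 - β t (S.z t (d i).1))
        else 0))

end Design

/-- `A N` holds with probability tending to one as `N → ∞` (`μ` acts as an outer measure, so
`A N` need not be measurable). -/
def WithProbTendingToOne {Ω : Type*} [MeasurableSpace Ω] (μ : Measure Ω) (A : ℕ → Ω → Prop) : Prop :=
  Tendsto (fun N => μ {ω | ¬ A N ω}) atTop (𝓝 0)

end

/-! Write `κ_t` for `P(δ = t) / P(δ = 1)`. The density ratio model moves functions of `z_t` from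
pattern `t` to the complete pattern. The common regression function extends this to `U`: for every
`θ ∈ Θ`, `E{δ_t U(θ)} = κ_t E{δ_1 r_t(λ_t) U(θ)}` (`Envelope.integral_onPattern_U`). Summing over
patterns, the population version of the estimating function is `E U(θ)`. Differentiating at `θ₀`
gives the slope `τ`. A uniform law of large numbers, compactness of `Θ` and uniqueness of the root
then give consistency of the estimator.

The calibration equation is the gradient equation of a convex function of `φ`. Monotonicity of `exp`
therefore bounds `φ̂ - λ_t` by a multiple of the calibration score at `λ_t`, for any solution,
without prior localization (`Envelope.norm_calibrated_sub_le`). That score is `O_p(N^{-1/2})`.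

The influence function comes from an exact exchange. For every matrix `β`, calibration equates the
weighted sum of `β z_t` over the complete units, scaled by `N_t / N₁`, with the sum of `β z_t` over
pattern `t`. At `θ₀` the estimated `φ̂` thus acts only through `(r_t(φ̂) - r_t(λ_t)) (U - β z_t)`.
With `β` the population regression coefficient, the normal equations `E{δ_1 r_t (U - β z_t) z_tᵀ} =
0` annihilate the first order term, and the remainder is `o_p(‖φ̂ - λ_t‖) = o_p(N^{-1/2})`
(`Envelope.exists_norm_empMean_resid_le`). Because `z_t` contains the constant `1`, the weighted
residuals are also centred, so the random factors `N_t / N₁` do not spoil the rate of the linear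
part. Inverting `τ` finishes the proof.

Probability limits are handled as limits along a filter on `ℕ × Ω`. Events and estimators then need
not be measurable, and "with probability tending to one" becomes "eventually". -/

noncomputable section

/-! ### Convergence in probability as convergence along a filter -/

section ProbFilter

variable {Ω : Type*} [MeasurableSpace Ω]

/-- The events of `ℕ × Ω` whose sections have probability tending to one. -/
def probFilter (μ : Measure Ω) : Filter (ℕ × Ω) where
  sets := {A | Tendsto (fun N => μ {ω | (N, ω) ∉ A}) atTop (𝓝 0)}
  univ_sets := by simp
  sets_of_superset {A B} hA hAB :=
    tendsto_of_tendsto_of_tendsto_of_le_of_le tendsto_const_nhds hA (fun _ => zero_le)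
      (fun _ => measure_mono fun _ h h' => h (hAB h'))
  inter_sets {A B} hA hB := by
    have h := Tendsto.add (show Tendsto _ _ _ from hA) (show Tendsto _ _ _ from hB)
    rw [add_zero] at h
    refine tendsto_of_tendsto_of_tendsto_of_le_of_le tendsto_const_nhds h (fun _ => zero_le)
      (fun N => (measure_mono ?_).trans (measure_union_le _ _))
    intro ω hω
    by_cases h1 : (N, ω) ∈ A
    · exact Or.inr fun h2 => hω ⟨h1, h2⟩
    · exact Or.inl h1

theorem eventually_probFilter {μ : Measure Ω} {p : ℕ × Ω → Prop} :
    (∀ᶠ x in probFilter μ, p x) ↔ WithProbTendingToOne μ (fun N ω => p (N, ω)) :=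
  Iff.rfl

theorem tendsto_fst_probFilter (μ : Measure Ω) :
    Tendsto Prod.fst (probFilter μ) (atTop : Filter ℕ) := by
  refine tendsto_atTop.2 fun n => ?_
  refine tendsto_const_nhds.congr' ?_
  filter_upwards [eventually_ge_atTop n] with N hN
  simp [hN]

/-- The complements of balls around `c` are exactly the deviation events. This gives access to the
usual calculus of limits (continuous maps, products, squeezing) for convergence in probability. -/
theorem tendstoInMeasure_const_iff {μ : Measure Ω} {V : Type*} [PseudoEMetricSpace V]
    {f : ℕ → Ω → V} {c : V} :
    TendstoInMeasure μ f atTop (fun _ => c) ↔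
      Tendsto (fun x : ℕ × Ω => f x.1 x.2) (probFilter μ) (𝓝 c) := by
  rw [Metric.nhds_basis_eball.tendsto_right_iff]
  refine forall₂_congr fun ε _ => ?_
  change _ ↔ Tendsto (fun N => μ {ω | ¬ f N ω ∈ Metric.eball c ε}) atTop (𝓝 0)
  simp [Metric.mem_eball]

theorem tendsto_probFilter_of_ae {μ : Measure Ω} [IsFiniteMeasure μ] {V : Type*}
    [PseudoEMetricSpace V] {f : ℕ → Ω → V} {c : V}
    (hf : ∀ n, AEStronglyMeasurable (f n) μ)
    (h : ∀ᵐ ω ∂μ, Tendsto (fun n => f n ω) atTop (𝓝 c)) :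
    Tendsto (fun x : ℕ × Ω => f x.1 x.2) (probFilter μ) (𝓝 c) :=
  tendstoInMeasure_const_iff.1 (tendstoInMeasure_of_tendsto_ae hf h)

/-- Boundedness in probability. -/
def BoundedInProb (μ : Measure Ω) (ξ : ℕ × Ω → ℝ) : Prop :=
  ∀ η : ENNReal, 0 < η → ∃ M : ℝ, ∀ᶠ N in atTop, μ {ω | M < |ξ (N, ω)|} ≤ η

namespace BoundedInProb

variable {μ : Measure Ω} {ξ ζ : ℕ × Ω → ℝ}

theorem add (hξ : BoundedInProb μ ξ) (hζ : BoundedInProb μ ζ) :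
    BoundedInProb μ (fun x => ξ x + ζ x) := by
  intro η hη
  obtain ⟨M, hM⟩ := hξ (η / 2) (ENNReal.half_pos hη.ne')
  obtain ⟨M', hM'⟩ := hζ (η / 2) (ENNReal.half_pos hη.ne')
  refine ⟨M + M', ?_⟩
  filter_upwards [hM, hM'] with N h1 h2
  calc μ {ω | M + M' < |ξ (N, ω) + ζ (N, ω)|}
      ≤ μ ({ω | M < |ξ (N, ω)|} ∪ {ω | M' < |ζ (N, ω)|}) := by
        refine measure_mono fun ω hω => ?_
        by_contra hc
        simp only [Set.mem_union, Set.mem_ofPred_eq, not_or, not_lt] at hc hω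
        linarith [abs_add_le (ξ (N, ω)) (ζ (N, ω)), hc.1, hc.2]
    _ ≤ η / 2 + η / 2 := (measure_union_le _ _).trans (add_le_add h1 h2)
    _ = η := ENNReal.add_halves η

theorem zero : BoundedInProb μ (fun _ => 0) := fun η _ => ⟨0, by simp⟩

theorem sum {ι : Type*} (s : Finset ι) {ξ : ι → ℕ × Ω → ℝ}
    (h : ∀ i ∈ s, BoundedInProb μ (ξ i)) : BoundedInProb μ (fun x => ∑ i ∈ s, ξ i x) := by
  classical
  induction s using Finset.induction_on with
  | empty => simpa using zero
  | insert a s ha ih =>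
    simp only [Finset.sum_insert ha]
    exact (h a (by simp)).add (ih fun i hi => h i (by simp [hi]))

theorem of_abs_le (hξ : BoundedInProb μ ξ) {c : ℝ}
    (h : ∀ᶠ x in probFilter μ, |ζ x| ≤ c * |ξ x|) : BoundedInProb μ ζ := by
  intro η hη
  obtain ⟨M, hM⟩ := hξ (η / 2) (ENNReal.half_pos hη.ne')
  -- Neither `c` nor `M` is known to be nonnegative, hence the absolute values.
  refine ⟨|c| * |M|, ?_⟩
  have h' : ∀ᶠ N in atTop, μ {ω | ¬ |ζ (N, ω)| ≤ c * |ξ (N, ω)|} < η / 2 :=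
    (show Tendsto _ _ _ from h).eventually (gt_mem_nhds (ENNReal.half_pos hη.ne'))
  filter_upwards [hM, h'] with N h1 h2
  calc _ ≤ μ ({ω | M < |ξ (N, ω)|} ∪ {ω | ¬ |ζ (N, ω)| ≤ c * |ξ (N, ω)|}) := by
        refine measure_mono fun ω hω => ?_
        by_contra hc
        simp only [Set.mem_union, Set.mem_ofPred_eq, not_or, not_lt, not_not] at hc hω
        have h3 : c * |ξ (N, ω)| ≤ |c| * |M| :=
          (mul_le_mul_of_nonneg_right (le_abs_self c) (abs_nonneg _)).trans
            (mul_le_mul_of_nonneg_left (hc.1.trans (le_abs_self M)) (abs_nonneg _))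
        linarith [hc.2]
    _ ≤ η / 2 + η / 2 := (measure_union_le _ _).trans (add_le_add h1 h2.le)
    _ = η := ENNReal.add_halves η

theorem tendsto_mul_zero {a : ℕ × Ω → ℝ} (hξ : BoundedInProb μ ξ)
    (ha : Tendsto a (probFilter μ) (𝓝 0)) :
    Tendsto (fun x => a x * ξ x) (probFilter μ) (𝓝 0) := by
  rw [Metric.tendsto_nhds]
  intro ε hε
  rw [eventually_probFilter, WithProbTendingToOne, ENNReal.tendsto_nhds_zero]
  intro η hη
  obtain ⟨M, hM⟩ := hξ (η / 2) (ENNReal.half_pos hη.ne')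
  -- Adding `1` keeps the denominator positive when `M = 0`.
  have hpos : 0 < ε / (|M| + 1) := by positivity
  have h' : ∀ᶠ N in atTop, μ {ω | ¬ dist (a (N, ω)) 0 < ε / (|M| + 1)} < η / 2 :=
    (show Tendsto _ _ _ from (Metric.tendsto_nhds.1 ha) _ hpos).eventually
      (gt_mem_nhds (ENNReal.half_pos hη.ne'))
  filter_upwards [hM, h'] with N h1 h2
  calc _ ≤ μ ({ω | M < |ξ (N, ω)|} ∪ {ω | ¬ dist (a (N, ω)) 0 < ε / (|M| + 1)}) := by
        refine measure_mono fun ω hω => ?_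
        by_contra hc
        simp only [Set.mem_union, Set.mem_ofPred_eq, not_or, not_lt, dist_zero_right,
          Real.norm_eq_abs, abs_mul, not_le] at hc hω
        have h3 : |a (N, ω)| * |ξ (N, ω)| ≤ |a (N, ω)| * (|M| + 1) :=
          mul_le_mul_of_nonneg_left (by linarith [hc.1, le_abs_self M]) (abs_nonneg _)
        have h4 := (lt_div_iff₀ (by positivity)).1 hc.2
        linarith
    _ ≤ η / 2 + η / 2 := (measure_union_le _ _).trans (add_le_add h1 h2.le)
    _ = η := ENNReal.add_halves η

end BoundedInProb

end ProbFilter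

/-! ### Empirical means -/

section EmpMean

variable {Ω : Type*} {𝒟 : Type*} {V W : Type*}

/-- The mean of `f` over the first `x.1` units of the sample path `x.2`. -/
def empMean [AddCommGroup V] [Module ℝ V] (D : ℕ → Ω → 𝒟) (x : ℕ × Ω) (f : 𝒟 → V) : V :=
  (x.1 : ℝ)⁻¹ • ∑ i ∈ Finset.range x.1, f (D i x.2)

section Algebra

variable [AddCommGroup V] [Module ℝ V] (D : ℕ → Ω → 𝒟) (x : ℕ × Ω)

theorem empMean_add (f g : 𝒟 → V) :
    empMean D x (fun d => f d + g d) = empMean D x f + empMean D x g := by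
  simp [empMean, Finset.sum_add_distrib]

theorem empMean_sub (f g : 𝒟 → V) :
    empMean D x (fun d => f d - g d) = empMean D x f - empMean D x g := by
  simp [empMean, Finset.sum_sub_distrib, smul_sub]

theorem empMean_const_smul (c : ℝ) (f : 𝒟 → V) :
    empMean D x (fun d => c • f d) = c • empMean D x f := by
  simp only [empMean, ← Finset.smul_sum, smul_comm c]

theorem empMean_smul_const (f : 𝒟 → ℝ) (v : V) :
    empMean D x (fun d => f d • v) = empMean D x f • v := by
  simp only [empMean, ← Finset.sum_smul, smul_assoc]

theorem empMean_sum {ι : Type*} (s : Finset ι) (f : ι → 𝒟 → V) :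
    empMean D x (fun d => ∑ i ∈ s, f i d) = ∑ i ∈ s, empMean D x (f i) := by
  simp only [empMean, ← Finset.smul_sum]
  rw [Finset.sum_comm]

theorem map_empMean [AddCommGroup W] [Module ℝ W] {F : Type*} [FunLike F V W]
    [LinearMapClass F ℝ V W] (L : F) (f : 𝒟 → V) :
    L (empMean D x f) = empMean D x (fun d => L (f d)) := by
  simp [empMean, map_sum, map_smul]

end Algebra

theorem empMean_mono (D : ℕ → Ω → 𝒟) (x : ℕ × Ω) {f g : 𝒟 → ℝ} (h : ∀ d, f d ≤ g d) :
    empMean D x f ≤ empMean D x g :=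
  smul_le_smul_of_nonneg_left (Finset.sum_le_sum fun _ _ => h _) (by positivity)

theorem norm_empMean_le [NormedAddCommGroup V] [NormedSpace ℝ V] (D : ℕ → Ω → 𝒟) (x : ℕ × Ω)
    {f : 𝒟 → V} {g : 𝒟 → ℝ} (h : ∀ d, ‖f d‖ ≤ g d) : ‖empMean D x f‖ ≤ empMean D x g := by
  rw [empMean, norm_smul, norm_inv, Real.norm_natCast]
  exact mul_le_mul_of_nonneg_left (norm_sum_le_of_le _ fun _ _ => h _) (by positivity)

/-- The units `D i` are independent with law `P`. -/
structure IsIIDSample [MeasurableSpace Ω] [MeasurableSpace 𝒟] (P : Measure 𝒟) (μ : Measure Ω)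
    (D : ℕ → Ω → 𝒟) : Prop where
  measurable : ∀ i, Measurable (D i)
  map_eq : ∀ i, μ.map (D i) = P
  indep : iIndepFun D μ

variable [MeasurableSpace Ω] [MeasurableSpace 𝒟] {P : Measure 𝒟} {μ : Measure Ω} {D : ℕ → Ω → 𝒟}

/-- The weak law of large numbers in a Banach space. -/
theorem tendsto_empMean [IsProbabilityMeasure μ] (hD : IsIIDSample P μ D)
    [NormedAddCommGroup V] [NormedSpace ℝ V] [CompleteSpace V] [MeasurableSpace V] [BorelSpace V]
    {f : 𝒟 → V} (hf : Measurable f) (hint : Integrable f P) :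
    Tendsto (fun x => empMean D x f) (probFilter μ) (𝓝 (∫ d, f d ∂P)) := by
  have hint' : ∀ i, Integrable (fun ω => f (D i ω)) μ := fun i =>
    (show Integrable f (μ.map (D i)) from (hD.map_eq i).symm ▸ hint).comp_measurable
      (hD.measurable i)
  have hslln := strong_law_ae (μ := μ) (fun i ω => f (D i ω)) (hint' 0)
    (fun i j hij => (hD.indep.indepFun hij).comp hf hf)
    (fun i => IdentDistrib.comp
      ⟨(hD.measurable i).aemeasurable, (hD.measurable 0).aemeasurable,
        by rw [hD.map_eq, hD.map_eq]⟩ hf)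
  have hmean : ∫ ω, f (D 0 ω) ∂μ = ∫ d, f d ∂P := by
    rw [← hD.map_eq 0, integral_map (hD.measurable 0).aemeasurable]
    exact (hD.map_eq 0).symm ▸ hint.aestronglyMeasurable
  rw [hmean] at hslln
  refine tendsto_probFilter_of_ae (f := fun N ω => empMean D (N, ω) f) (fun n => ?_) hslln
  exact AEStronglyMeasurable.const_smul (Finset.aestronglyMeasurable_fun_sum (Finset.range n)
    fun i _ => (hint' i).aestronglyMeasurable) (n : ℝ)⁻¹

/-- Centred real empirical means of order `N ^ (-1 / 2)` are bounded in probability. -/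
theorem boundedInProb_sqrt_mul_empMean [IsProbabilityMeasure μ] (hD : IsIIDSample P μ D)
    {f : 𝒟 → ℝ} (hf : Measurable f) (hL2 : MemLp f 2 P) (h0 : ∫ d, f d ∂P = 0) :
    BoundedInProb μ (fun x => √(x.1 : ℝ) * empMean D x f) := by
  have hL2' : ∀ i, MemLp (fun ω => f (D i ω)) 2 μ := fun i =>
    (show MemLp f 2 (μ.map (D i)) from (hD.map_eq i).symm ▸ hL2).comp_of_map
      (hD.measurable i).aemeasurable
  have hident : ∀ i, IdentDistrib (fun ω => f (D i ω)) (fun ω => f (D 0 ω)) μ μ := fun i =>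
    IdentDistrib.comp
      ⟨(hD.measurable i).aemeasurable, (hD.measurable 0).aemeasurable,
        by rw [hD.map_eq, hD.map_eq]⟩ hf
  have hmean : ∫ ω, f (D 0 ω) ∂μ = 0 := by
    rw [← h0, ← hD.map_eq 0, integral_map (hD.measurable 0).aemeasurable hf.aestronglyMeasurable]
  set v := Var[fun ω => f (D 0 ω); μ] with hv
  have hvn : 0 ≤ v := variance_nonneg _ _
  intro η hη
  -- Chebyshev's inequality: the scaled mean has variance `v` for every `N ≥ 1`, so the bound `v / c
  -- ^ 2` does not depend on `N`.
  obtain ⟨c, hc0, hc⟩ : ∃ c : ℝ, 0 < c ∧ ENNReal.ofReal (v / c ^ 2) ≤ η := by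
    have : Tendsto (fun c : ℝ => ENNReal.ofReal (v / c ^ 2)) atTop (𝓝 0) := by
      rw [← ENNReal.ofReal_zero]
      exact (ENNReal.continuous_ofReal.tendsto 0).comp
        (tendsto_const_nhds.div_atTop (tendsto_pow_atTop two_ne_zero))
    obtain ⟨c, h1, h2⟩ := ((eventually_gt_atTop 0).and (this.eventually_le_const hη)).exists
    exact ⟨c, h1, h2⟩
  refine ⟨c, ?_⟩
  filter_upwards [eventually_gt_atTop 0] with N hN
  have hN' : (0 : ℝ) < N := by exact_mod_cast hN
  set Y : Ω → ℝ := fun ω => ∑ i ∈ Finset.range N, f (D i ω) with hY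
  have hYsum : Y = ∑ i ∈ Finset.range N, fun ω => f (D i ω) := by
    ext ω; simp [hY]
  have hYL2 : MemLp Y 2 μ := by
    rw [hYsum]; exact memLp_finsetSum' _ fun i _ => hL2' i
  have hYmean : ∫ ω, Y ω ∂μ = 0 := by
    rw [hY, integral_finsetSum _ fun i _ => (hL2' i).integrable (by norm_num)]
    refine Finset.sum_eq_zero fun i _ => ?_
    rw [(hident i).integral_eq, hmean]
  have hYvar : Var[Y; μ] = N * v := by
    rw [hYsum, IndepFun.variance_sum (fun i _ => hL2' i)
      (fun i _ j _ hij => (hD.indep.indepFun hij).comp hf hf)]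
    simp [fun i => (hident i).variance_eq, hv]
  have hs : 0 < √(N : ℝ) := Real.sqrt_pos.2 hN'
  calc μ {ω | c < |√((N, ω).1 : ℝ) * empMean D (N, ω) f|}
      ≤ μ {ω | c * √N ≤ |Y ω - ∫ ω, Y ω ∂μ|} := by
        refine measure_mono fun ω hω => ?_
        simp only [Set.mem_ofPred_eq, hYmean, sub_zero] at hω ⊢
        have : √(N : ℝ) * empMean D (N, ω) f = Y ω / √N := by
          simp only [empMean, hY, smul_eq_mul]
          field_simp
          rw [Real.sq_sqrt hN'.le, mul_comm]
        rw [this, abs_div, abs_of_pos hs, lt_div_iff₀ hs] at hω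
        exact hω.le
    _ ≤ ENNReal.ofReal (Var[Y; μ] / (c * √N) ^ 2) :=
        meas_ge_le_variance_div_sq hYL2 (by positivity)
    _ = ENNReal.ofReal (v / c ^ 2) := by
        rw [hYvar, mul_pow, Real.sq_sqrt hN'.le]
        congr 1
        field_simp
    _ ≤ η := hc

/-- The Euclidean norm is at most the sum of the absolute coordinates, and the real case applies to
each coordinate. -/
theorem boundedInProb_sqrt_mul_norm_empMean [IsProbabilityMeasure μ]
    (hD : IsIIDSample P μ D) {n : ℕ}
    {f : 𝒟 → E n} (hf : Measurable f) (hL2 : MemLp f 2 P) [IsFiniteMeasure P]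
    (h0 : ∫ d, f d ∂P = 0) :
    BoundedInProb μ (fun x => √(x.1 : ℝ) * ‖empMean D x f‖) := by
  have hcoord : ∀ j : Fin n, BoundedInProb μ
      (fun x => |√(x.1 : ℝ) * empMean D x (fun d => f d j)|) := by
    intro j
    have hL : MemLp (fun d => f d j) 2 P :=
      (EuclideanSpace.proj (𝕜 := ℝ) j).comp_memLp' hL2
    refine (boundedInProb_sqrt_mul_empMean hD (by fun_prop) hL ?_).of_abs_le
      (c := 1) (by simp)
    have := (EuclideanSpace.proj (𝕜 := ℝ) j).integral_comp_comm (hL2.integrable (by norm_num))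
    simpa [h0] using this
  refine (BoundedInProb.sum Finset.univ fun j _ => hcoord j).of_abs_le (c := 1)
    (Eventually.of_forall fun x => ?_)
  have hs : 0 ≤ √(x.1 : ℝ) := Real.sqrt_nonneg _
  rw [abs_of_nonneg (by positivity), abs_of_nonneg (by positivity), one_mul]
  simp only [abs_mul, abs_of_nonneg hs, ← Finset.mul_sum]
  refine mul_le_mul_of_nonneg_left ?_ hs
  have hj : ∀ j, empMean D x (fun d => f d j) = empMean D x f j := fun j =>
    (map_empMean D x (EuclideanSpace.proj (𝕜 := ℝ) j) f).symm
  simp only [hj]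
  generalize empMean D x f = u
  rw [EuclideanSpace.norm_eq]
  refine (Real.sqrt_le_sqrt (Finset.sum_sq_le_sq_sum_of_nonneg fun j _ => norm_nonneg _)).trans ?_
  rw [Real.sqrt_sq (by positivity)]
  rfl

/-- By continuity, membership in a closed ball of the sup norm is decided on a countable dense set
of points. Open sets are countable unions of closed balls, since `C(K, V)` is second countable. This
makes random functions admissible in the law of large numbers for Banach spaces. -/
theorem measurable_continuousMap_of_eval {K : Type*} [TopologicalSpace K] [CompactSpace K]
    [SecondCountableTopology K] [NormedAddCommGroup V] [SecondCountableTopology V]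
    [MeasurableSpace V] [BorelSpace V] [MeasurableSpace C(K, V)] [BorelSpace C(K, V)]
    [LocallyCompactSpace K]
    {F : 𝒟 → C(K, V)} (hF : ∀ k, Measurable fun d => F d k) : Measurable F := by
  obtain ⟨s, hsc, hsd⟩ := TopologicalSpace.exists_countable_dense K
  have hclosed : ∀ (g : C(K, V)) (r : ℝ), 0 ≤ r →
      MeasurableSet (F ⁻¹' Metric.closedBall g r) := by
    intro g r hr
    have : F ⁻¹' Metric.closedBall g r = ⋂ k ∈ s, {d | ‖F d k - g k‖ ≤ r} := by
      ext d
      simp only [Set.mem_preimage, Metric.mem_closedBall, dist_eq_norm,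
        ContinuousMap.norm_le _ hr, ContinuousMap.sub_apply, Set.mem_iInter, Set.mem_ofPred_eq]
      refine ⟨fun h k _ => h k, fun h k => ?_⟩
      have hcl : IsClosed {k | ‖F d k - g k‖ ≤ r} :=
        isClosed_le (by fun_prop) continuous_const
      exact hcl.closure_subset_iff.2 (show s ⊆ _ from h) (hsd k)
    rw [this]
    refine MeasurableSet.biInter hsc fun k _ => ?_
    exact measurableSet_le ((hF k).sub_const _).norm measurable_const
  refine measurable_of_isOpen fun U hU => ?_
  choose! r hr0 hr using fun g (hg : g ∈ U) => Metric.isOpen_iff.1 hU g hg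
  have hcover : ∀ g ∈ U, Metric.closedBall g (r g / 2) ∈ 𝓝[U] g := fun g hg =>
    mem_nhdsWithin_of_mem_nhds (Metric.closedBall_mem_nhds g (half_pos (hr0 g hg)))
  obtain ⟨t, htU, htc, ht⟩ := TopologicalSpace.countable_cover_nhdsWithin hcover
  have hUeq : F ⁻¹' U = ⋃ g ∈ t, F ⁻¹' Metric.closedBall g (r g / 2) := by
    rw [← Set.preimage_iUnion₂]
    congr 1
    refine ht.antisymm (Set.iUnion₂_subset fun g hg => ?_)
    exact (Metric.closedBall_subset_ball (half_lt_self (hr0 g (htU hg)))).trans (hr g (htU hg))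
  rw [hUeq]
  exact MeasurableSet.biUnion htc fun g hg => hclosed g _ (half_pos (hr0 g (htU hg))).le

/-- The uniform weak law of large numbers on a compact parameter set. -/
theorem exists_norm_empMean_sub_integral_le [IsProbabilityMeasure μ]
    (hD : IsIIDSample P μ D)
    [NormedAddCommGroup V] [NormedSpace ℝ V] [CompleteSpace V] [SecondCountableTopology V]
    [MeasurableSpace V] [BorelSpace V] {α : Type*} [TopologicalSpace α] [SecondCountableTopology α]
    [T2Space α]
    {Θ : Set α} (hΘ : IsCompact Θ) {f : α → 𝒟 → V} (hfm : ∀ θ ∈ Θ, Measurable (f θ))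
    (hfc : ∀ d, ContinuousOn (fun θ => f θ d) Θ) {g : 𝒟 → ℝ} (hg : Integrable g P)
    (hfg : ∀ θ ∈ Θ, ∀ d, ‖f θ d‖ ≤ g d) :
    ContinuousOn (fun θ => ∫ d, f θ d ∂P) Θ ∧
      ∃ ε : ℕ × Ω → ℝ, Tendsto ε (probFilter μ) (𝓝 0) ∧
        ∀ x, ∀ θ ∈ Θ, ‖empMean D x (f θ) - ∫ d, f θ d ∂P‖ ≤ ε x := by
  rcases Θ.eq_empty_or_nonempty with rfl | ⟨θ₁, hθ₁⟩
  · exact ⟨continuousOn_empty _, fun _ => 0, tendsto_const_nhds, by simp⟩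
  have : CompactSpace Θ := isCompact_iff_compactSpace.1 hΘ
  let _ : MeasurableSpace C(Θ, V) := borel _
  have : BorelSpace C(Θ, V) := ⟨rfl⟩
  -- Uniformity comes from applying the law of large numbers in the Banach space `C(Θ, V)`. The
  -- envelope `g` gives Bochner integrability, and the mean is an element of `C(Θ, V)`, hence
  -- continuous.
  let F : 𝒟 → C(Θ, V) := fun d => ⟨fun θ => f θ d, (hfc d).domRestrict⟩
  have hFm : Measurable F := measurable_continuousMap_of_eval fun θ => hfm θ θ.2
  have hFint : Integrable F P :=
    hg.mono' hFm.aestronglyMeasurable (Eventually.of_forall fun d =>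
      (ContinuousMap.norm_le _ ((norm_nonneg _).trans (hfg θ₁ hθ₁ d))).2 fun θ => hfg θ θ.2 d)
  have heval : ∀ θ : Θ, (∫ d, F d ∂P) θ = ∫ d, f θ d ∂P := fun θ =>
    ((ContinuousMap.evalCLM ℝ θ).integral_comp_comm hFint).symm
  refine ⟨?_, fun x => ‖empMean D x F - ∫ d, F d ∂P‖, ?_, fun x θ hθ => ?_⟩
  · rw [continuousOn_iff_continuous_domRestrict]
    exact (∫ d, F d ∂P).continuous.congr heval
  · exact tendsto_iff_norm_sub_tendsto_zero.1 (tendsto_empMean hD hFm hFint)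
  · have h1 : empMean D x (f θ) = (empMean D x F) ⟨θ, hθ⟩ :=
      (map_empMean D x (ContinuousMap.evalCLM ℝ (⟨θ, hθ⟩ : Θ)) F).symm
    rw [h1, ← heval ⟨θ, hθ⟩, ← ContinuousMap.sub_apply]
    exact ContinuousMap.norm_coe_le_norm _ _

end EmpMean

/-! ### Elementary inequalities and perturbation lemmas -/

section Analysis

/-- A global substitute for strong convexity of `exp`, quadratic near zero and linear far away. For
`a ≤ 0` it follows from `exp a * (1 - a) ≤ 1`. -/
theorem sq_div_one_add_abs_le (a : ℝ) : a ^ 2 / (1 + |a|) ≤ (Real.exp a - 1) * a := by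
  have h0 : 0 < 1 + |a| := by positivity
  rw [div_le_iff₀ h0]
  rcases le_total 0 a with ha | ha
  · rw [abs_of_nonneg ha]
    have h1 := Real.add_one_le_exp a
    have h2 : a * a ≤ (Real.exp a - 1) * a := mul_le_mul_of_nonneg_right (by linarith) ha
    nlinarith [mul_nonneg (mul_nonneg ha ha) ha]
  · rw [abs_of_nonpos ha]
    have h1 := Real.add_one_le_exp (-a)
    have h2 : Real.exp a * Real.exp (-a) = 1 := by rw [← Real.exp_add]; simp
    have h3 : Real.exp a * (1 - a) ≤ 1 := by
      rw [← h2]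
      exact mul_le_mul_of_nonneg_left (by linarith) (Real.exp_pos a).le
    nlinarith

theorem abs_exp_sub_one_le_abs_mul_exp (a : ℝ) : |Real.exp a - 1| ≤ |a| * Real.exp |a| := by
  have h := Complex.norm_exp_sub_sum_le_norm_mul_exp (a : ℂ) 1
  simp only [Finset.sum_range_one, pow_zero, Nat.factorial_zero, Nat.cast_one, div_one,
    pow_one, Complex.norm_real, Real.norm_eq_abs] at h
  rwa [← Complex.ofReal_exp, ← Complex.ofReal_one, ← Complex.ofReal_sub, Complex.norm_real] at h

theorem abs_exp_sub_one_sub_self_le (a : ℝ) :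
    |Real.exp a - 1 - a| ≤ |a| ^ 2 * Real.exp |a| := by
  have h := Complex.norm_exp_sub_sum_le_norm_mul_exp (a : ℂ) 2
  simp only [Finset.sum_range_succ, Finset.sum_range_zero, pow_zero, Nat.factorial_zero,
    Nat.cast_one, div_one, pow_one, Nat.factorial_one, Complex.norm_real, Real.norm_eq_abs,
    zero_add] at h
  rw [← Complex.ofReal_exp, ← Complex.ofReal_one, ← Complex.ofReal_add, ← Complex.ofReal_sub,
    Complex.norm_real] at h
  rwa [sub_sub]

theorem exists_one_add_pow_le_exp {ρ : ℝ} (hρ : 0 < ρ) (n : ℕ) :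
    ∃ C : ℝ, 0 < C ∧ ∀ a : ℝ, 0 ≤ a → (1 + a) ^ n ≤ C * Real.exp (ρ * a) := by
  -- The constant comes from `x ^ n / n! ≤ exp x` at `x = ρ * (1 + a)`.
  refine ⟨n.factorial / ρ ^ n * Real.exp ρ, by positivity, fun a ha => ?_⟩
  have h := Real.pow_div_factorial_le_exp (ρ * (1 + a)) (by positivity) n
  rw [div_le_iff₀ (by positivity), mul_pow, mul_add, mul_one, Real.exp_add] at h
  rw [div_mul_eq_mul_div, div_mul_eq_mul_div, le_div_iff₀ (by positivity)]
  linarith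

/-- Solutions in a compact set of equations that converge to an equation with a unique root. -/
theorem IsCompact.tendsto_of_tendsto_unique_zero {X Y V : Type*} [TopologicalSpace X]
    [TopologicalSpace V] [T2Space V] [Zero V] {s : Set X} (hs : IsCompact s) {M : X → V}
    (hM : ContinuousOn M s) {x₀ : X} (hx₀ : ∀ x ∈ s, M x = 0 → x = x₀) {l : Filter Y} {f : Y → X}
    (hf : ∀ᶠ y in l, f y ∈ s) (h : Tendsto (fun y => M (f y)) l (𝓝 0)) : Tendsto f l (𝓝 x₀) := by
  -- By compactness it is enough that every cluster point `x` of `f` is a root. Along the nontrivial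
  -- filter `𝓝 x ⊓ map f l`, the function `M` tends both to `M x` and to `0`.
  refine hs.tendsto_nhds_of_unique_mapClusterPt hf fun x hx hxc => hx₀ x hx ?_
  rw [MapClusterPt, ClusterPt] at hxc
  have hle : 𝓝 x ⊓ map f l ≤ 𝓝[s] x :=
    inf_le_inf_left _ (le_principal_iff.2 hf)
  have h1 : Tendsto M (𝓝 x ⊓ map f l) (𝓝 (M x)) := (hM x hx).mono_left hle
  have h2 : Tendsto M (𝓝 x ⊓ map f l) (𝓝 0) :=
    (show Tendsto M (map f l) (𝓝 0) from tendsto_map'_iff.2 h).mono_left inf_le_right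
  exact tendsto_nhds_unique h1 h2

variable {V : Type*} [NormedAddCommGroup V] [InnerProductSpace ℝ V] [FiniteDimensional ℝ V]

/-- The constant is the minimum of the quadratic form on the compact unit sphere; homogeneity of
degree two does the rest. An empty sphere means `V = 0`. -/
theorem ContinuousLinearMap.exists_mul_sq_le_inner {A : V →L[ℝ] V}
    (hA : ∀ v, v ≠ 0 → 0 < inner ℝ v (A v)) :
    ∃ c : ℝ, 0 < c ∧ ∀ v, c * ‖v‖ ^ 2 ≤ inner ℝ v (A v) := by
  have hc : Continuous fun v => (inner ℝ v (A v) : ℝ) := by fun_prop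
  rcases (Metric.sphere (0 : V) 1).eq_empty_or_nonempty with he | hne
  · refine ⟨1, one_pos, fun v => ?_⟩
    by_cases hv : v = 0
    · simp [hv]
    · have : (‖v‖⁻¹ • v) ∈ Metric.sphere (0 : V) 1 := by
        simp [norm_smul, inv_mul_cancel₀ (norm_ne_zero_iff.2 hv)]
      simp [he] at this
  · obtain ⟨u, hu, hmin⟩ := (isCompact_sphere (0 : V) 1).exists_isMinOn hne hc.continuousOn
    have hu0 : u ≠ 0 := by
      rintro rfl; simp at hu
    refine ⟨_, hA u hu0, fun v => ?_⟩
    by_cases hv : v = 0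
    · simp [hv]
    · have hmem : (‖v‖⁻¹ • v) ∈ Metric.sphere (0 : V) 1 := by
        simp [norm_smul, inv_mul_cancel₀ (norm_ne_zero_iff.2 hv)]
      have h := isMinOn_iff.1 hmin _ hmem
      simp only [map_smul, inner_smul_left, inner_smul_right, RCLike.conj_to_real] at h
      have hn : 0 < ‖v‖ := norm_pos_iff.2 hv
      calc _ ≤ (‖v‖⁻¹ * (‖v‖⁻¹ * inner ℝ v (A v))) * ‖v‖ ^ 2 :=
            mul_le_mul_of_nonneg_right h (by positivity)
        _ = _ := by field_simp

theorem ContinuousLinearMap.isInvertible_of_inner_pos {A : V →L[ℝ] V}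
    (hA : ∀ v, v ≠ 0 → 0 < inner ℝ v (A v)) : A.IsInvertible := by
  have hinj : Function.Injective (A : V →ₗ[ℝ] V) := by
    rw [injective_iff_map_eq_zero]
    intro v hv
    by_contra hne
    have := hA v hne
    rw [show A v = 0 from hv, inner_zero_right] at this
    exact lt_irrefl _ this
  exact ⟨(LinearEquiv.ofInjectiveEndo _ hinj).toContinuousLinearEquiv, by ext v; rfl⟩

theorem ContinuousLinearMap.IsInvertible.eventually_nhds {A : V →L[ℝ] V} (hA : A.IsInvertible) :
    ∀ᶠ B in 𝓝 A, B.IsInvertible := by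
  obtain ⟨e, rfl⟩ := hA
  filter_upwards [e.nhds] with B hB
  exact hB

theorem ContinuousLinearMap.IsInvertible.continuousAt_inverse {A : V →L[ℝ] V}
    (hA : A.IsInvertible) : ContinuousAt ContinuousLinearMap.inverse A :=
  have : CompleteSpace V := FiniteDimensional.complete ℝ V
  (hA.contDiffAt_map_inverse (n := 0)).continuousAt

end Analysis

/-! ### Weighted second moment operators -/

section SecondMoment

variable {α V : Type*} [MeasurableSpace α] [NormedAddCommGroup V] [InnerProductSpace ℝ V]
  [FiniteDimensional ℝ V]

/-- The quadratic form at `v` equals `∫ c ⟨v, z⟩²`, which vanishes only if the integrand vanishes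
almost everywhere. The alternative `c a = 0` is there because the weight will carry a pattern
indicator. -/
theorem inner_integral_rankOne_pos {ν : Measure α} {c : α → ℝ} {z : α → V}
    (hint : Integrable (fun a => c a • InnerProductSpace.rankOne ℝ (z a) (z a)) ν)
    (hc : ∀ a, 0 ≤ c a) (hz : ∀ v, (∀ᵐ a ∂ν, c a = 0 ∨ inner ℝ v (z a) = 0) → v = 0)
    (v : V) (hv : v ≠ 0) :
    0 < inner ℝ v ((∫ a, c a • InnerProductSpace.rankOne ℝ (z a) (z a) ∂ν) v) := by
  have : CompleteSpace V := FiniteDimensional.complete ℝ V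
  let L : (V →L[ℝ] V) →L[ℝ] ℝ := (innerSL ℝ v).comp (ContinuousLinearMap.apply ℝ V v)
  have hL : ∀ a, L (c a • InnerProductSpace.rankOne ℝ (z a) (z a))
      = c a * inner ℝ v (z a) ^ 2 := by
    intro a
    simp only [L, ContinuousLinearMap.comp_apply, ContinuousLinearMap.apply_apply,
      _root_.smul_apply, InnerProductSpace.rankOne_apply, innerSL_apply_apply,
      inner_smul_right, real_inner_comm]
    ring
  have h1 : inner ℝ v ((∫ a, c a • InnerProductSpace.rankOne ℝ (z a) (z a) ∂ν) v)
      = ∫ a, c a * inner ℝ v (z a) ^ 2 ∂ν := by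
    change L _ = _
    rw [← L.integral_comp_comm hint]
    simp only [hL]
  have hint2 : Integrable (fun a => c a * inner ℝ v (z a) ^ 2) ν := by
    simpa only [hL] using L.integrable_comp hint
  rw [h1]
  have hnn : ∀ a, 0 ≤ c a * inner ℝ v (z a) ^ 2 := fun a => mul_nonneg (hc a) (sq_nonneg _)
  refine lt_of_le_of_ne (integral_nonneg hnn) fun h0 => hv (hz v ?_)
  filter_upwards [(integral_eq_zero_iff_of_nonneg hnn hint2).1 h0.symm] with a ha
  simpa using ha

end SecondMoment

/-! ### Empirical means of smooth functions of a parameter -/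

section Smooth

variable {Ω : Type*} [MeasurableSpace Ω] {𝒟 : Type*} [MeasurableSpace 𝒟] {P : Measure 𝒟}
  {μ : Measure Ω} {D : ℕ → Ω → 𝒟} {m n : ℕ}

theorem measurable_clm_of_apply {A : 𝒟 → E m →L[ℝ] E n} (hA : ∀ v, Measurable fun d => A d v) :
    Measurable A := by
  have h : A = fun d => ∑ j, InnerProductSpace.rankOne ℝ (A d (EuclideanSpace.single j 1))
      (EuclideanSpace.single j (1 : ℝ)) := by
    ext1 d
    ext1 v
    conv_lhs => rw [← (EuclideanSpace.basisFun (Fin m) ℝ).sum_repr' v]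
    simp
  rw [h]
  refine Finset.measurable_sum _ fun j _ => ?_
  have hc : Continuous fun u : E n =>
      InnerProductSpace.rankOne ℝ u (EuclideanSpace.single j (1 : ℝ) : E m) := by fun_prop
  exact hc.measurable.comp (hA _)

theorem measurable_fderiv_apply {f : E m → 𝒟 → E n} {s : Set (E m)} {θ₀ : E m} (hs : s ∈ 𝓝 θ₀)
    (hfm : ∀ θ ∈ s, Measurable (f θ)) (hf : ∀ d, DifferentiableAt ℝ (fun θ => f θ d) θ₀) :
    Measurable fun d => fderiv ℝ (fun θ => f θ d) θ₀ := by
  refine measurable_clm_of_apply fun v => ?_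
  have hlim : Tendsto (fun k : ℕ => θ₀ + (k : ℝ)⁻¹ • v) atTop (𝓝 θ₀) := by
    have : Tendsto (fun k : ℕ => θ₀ + (k : ℝ)⁻¹ • v) atTop (𝓝 (θ₀ + (0 : ℝ) • v)) :=
      tendsto_const_nhds.add ((tendsto_inv_atTop_nhds_zero_nat (𝕜 := ℝ)).smul_const v)
    simpa using this
  -- The derivative is a limit of difference quotients. The shift by `k₀` keeps their base points in
  -- `s`, where `f` is known to be measurable.
  obtain ⟨k₀, hk₀⟩ := eventually_atTop.1 (hlim.eventually hs)
  refine measurable_of_tendsto_metrizable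
    (f := fun (k : ℕ) d => ((k + k₀ : ℕ) : ℝ) •
      (f (θ₀ + ((k + k₀ : ℕ) : ℝ)⁻¹ • v) d - f θ₀ d)) (fun k => ?_) ?_
  · exact ((hfm _ (hk₀ (k + k₀) (Nat.le_add_left _ _))).sub (hfm _ (mem_of_mem_nhds hs))).const_smul
      ((k + k₀ : ℕ) : ℝ)
  · refine tendsto_pi_nhds.2 fun d => (hf d).hasFDerivAt.lim v ?_
    simp only [Real.norm_natCast]
    exact tendsto_natCast_atTop_atTop.comp (tendsto_add_atTop_nat k₀)

variable {f : E m → 𝒟 → E n} {θ₀ : E m} {ρ : ℝ} {g : 𝒟 → ℝ}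

theorem hasFDerivAt_integral_of_norm_fderiv_le (hρ : 0 < ρ)
    (hfm : ∀ θ ∈ Metric.ball θ₀ ρ, Measurable (f θ))
    (hfd : ∀ d, ∀ θ ∈ Metric.ball θ₀ ρ, DifferentiableAt ℝ (fun θ => f θ d) θ)
    (hfg : ∀ d, ∀ θ ∈ Metric.ball θ₀ ρ, ‖fderiv ℝ (fun θ => f θ d) θ‖ ≤ g d)
    (hg : Integrable g P) (hf₀ : Integrable (f θ₀) P) :
    HasFDerivAt (fun θ => ∫ d, f θ d ∂P) (∫ d, fderiv ℝ (fun θ => f θ d) θ₀ ∂P) θ₀ := by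
  have hball := Metric.ball_mem_nhds θ₀ hρ
  refine hasFDerivAt_integral_of_dominated_of_fderiv_le
    (F' := fun θ d => fderiv ℝ (fun θ => f θ d) θ) hball ?_ hf₀ ?_
    (Eventually.of_forall hfg) hg (Eventually.of_forall fun d θ hθ => (hfd d θ hθ).hasFDerivAt)
  · filter_upwards [hball] with θ hθ using (hfm θ hθ).aestronglyMeasurable
  · exact (measurable_fderiv_apply hball hfm fun d =>
      hfd d θ₀ (Metric.mem_ball_self hρ)).aestronglyMeasurable

/-- The linearization error divided by `‖ϑ - θ₀‖` is continuous in `ϑ` and, by the mean value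
inequality, dominated by `2 * g`. The uniform law of large numbers applies to this quotient, whose
expectation is continuous and vanishes at `θ₀`. Differentiability near `θ₀` is enough; the
derivative need not be continuous. -/
theorem exists_norm_empMean_sub_linear_le [IsProbabilityMeasure μ] (hD : IsIIDSample P μ D)
    (hρ : 0 < ρ) (hfm : ∀ θ ∈ Metric.ball θ₀ ρ, Measurable (f θ))
    (hfd : ∀ d, ∀ θ ∈ Metric.ball θ₀ ρ, DifferentiableAt ℝ (fun θ => f θ d) θ)
    (hfg : ∀ d, ∀ θ ∈ Metric.ball θ₀ ρ, ‖fderiv ℝ (fun θ => f θ d) θ‖ ≤ g d)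
    (hg : Integrable g P) {θ : ℕ × Ω → E m} (hθ : Tendsto θ (probFilter μ) (𝓝 θ₀)) :
    ∃ a : ℕ × Ω → ℝ, Tendsto a (probFilter μ) (𝓝 0) ∧ ∀ᶠ x in probFilter μ,
      ‖empMean D x (f (θ x)) - empMean D x (f θ₀) -
        (∫ d, fderiv ℝ (fun θ => f θ d) θ₀ ∂P) (θ x - θ₀)‖ ≤ a x * ‖θ x - θ₀‖ := by
  set B := Metric.closedBall θ₀ (ρ / 2) with hB
  have hBball : B ⊆ Metric.ball θ₀ ρ := Metric.closedBall_subset_ball (half_lt_self hρ)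
  have hBnhds : B ∈ 𝓝 θ₀ := Metric.closedBall_mem_nhds θ₀ (half_pos hρ)
  have hθ₀ : θ₀ ∈ Metric.ball θ₀ ρ := Metric.mem_ball_self hρ
  set f' : 𝒟 → E m →L[ℝ] E n := fun d => fderiv ℝ (fun θ => f θ d) θ₀ with hf'
  have hf'm : Measurable f' := measurable_fderiv_apply (Metric.ball_mem_nhds θ₀ hρ) hfm
    fun d => hfd d θ₀ hθ₀
  have hf'int : Integrable f' P :=
    hg.mono' hf'm.aestronglyMeasurable (Eventually.of_forall fun d => hfg d θ₀ hθ₀)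
  let H : E m → 𝒟 → ℝ := fun ϑ d => ‖ϑ - θ₀‖⁻¹ * ‖f ϑ d - f θ₀ d - f' d (ϑ - θ₀)‖
  -- The convention `0⁻¹ = 0` gives the value that makes the quotient continuous at `θ₀`; this
  -- continuity is differentiability itself.
  have hH₀ : ∀ d, H θ₀ d = 0 := fun d => by simp [H]
  have hHm : ∀ ϑ ∈ B, Measurable (H ϑ) := fun ϑ hϑ =>
    ((((hfm ϑ (hBball hϑ)).sub (hfm θ₀ hθ₀)).sub
      ((ContinuousLinearMap.apply ℝ (E n) (ϑ - θ₀)).continuous.measurable.comp hf'm)).norm).const_mul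
        _
  have hHc : ∀ d, ContinuousOn (fun ϑ => H ϑ d) B := by
    intro d ϑ hϑ
    by_cases h : ϑ = θ₀
    · rw [h]
      refine ContinuousAt.continuousWithinAt ?_
      have := (hasFDerivAt_iff_tendsto.1 (hfd d θ₀ hθ₀).hasFDerivAt)
      rw [ContinuousAt, hH₀]
      exact this
    · refine ContinuousAt.continuousWithinAt ?_
      have h1 : ContinuousAt (fun θ => f θ d) ϑ := (hfd d ϑ (hBball hϑ)).continuousAt
      have h2 : ‖ϑ - θ₀‖ ≠ 0 := norm_ne_zero_iff.2 (sub_ne_zero.2 h)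
      have h3 : ContinuousAt (fun ϑ => ‖ϑ - θ₀‖) ϑ := by fun_prop
      exact (h3.inv₀ h2).mul (by fun_prop)
  have hHg : ∀ ϑ ∈ B, ∀ d, ‖H ϑ d‖ ≤ 2 * g d := by
    intro ϑ hϑ d
    have h1 : ‖f ϑ d - f θ₀ d‖ ≤ g d * ‖ϑ - θ₀‖ :=
      (convex_ball θ₀ ρ).norm_image_sub_le_of_norm_fderiv_le (𝕜 := ℝ)
        (fun x hx => hfd d x hx) (fun x hx => hfg d x hx) hθ₀ (hBball hϑ)
    have h2 : ‖f' d (ϑ - θ₀)‖ ≤ g d * ‖ϑ - θ₀‖ :=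
      ((f' d).le_opNorm _).trans (mul_le_mul_of_nonneg_right (hfg d θ₀ hθ₀) (norm_nonneg _))
    have hg0 : 0 ≤ g d := (norm_nonneg _).trans (hfg d θ₀ hθ₀)
    rw [Real.norm_of_nonneg (by positivity)]
    by_cases h : ϑ = θ₀
    · rw [h, hH₀]; positivity
    · have h3 : 0 < ‖ϑ - θ₀‖ := norm_pos_iff.2 (sub_ne_zero.2 h)
      simp only [H]
      rw [inv_mul_le_iff₀ h3]
      linarith [norm_sub_le (f ϑ d - f θ₀ d) (f' d (ϑ - θ₀))]
  obtain ⟨hcont, ε, hε, hεle⟩ := exists_norm_empMean_sub_integral_le hD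
    (isCompact_closedBall θ₀ (ρ / 2)) hHm hHc (hg.const_mul 2) hHg
  have hI : Tendsto (fun x => ∫ d, H (θ x) d ∂P) (probFilter μ) (𝓝 0) := by
    have := (hcont.continuousAt hBnhds).tendsto.comp hθ
    simp only [hH₀, integral_zero] at this
    exact this
  have hd := tendsto_iff_norm_sub_tendsto_zero.1 (tendsto_empMean hD hf'm hf'int)
  refine ⟨fun x => ε x + (∫ d, H (θ x) d ∂P) + ‖empMean D x f' - ∫ d, f' d ∂P‖,
    by simpa using (hε.add hI).add hd, ?_⟩
  filter_upwards [hθ.eventually hBnhds] with x hx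
  have h1 : ‖empMean D x (fun d => f (θ x) d - f θ₀ d - f' d (θ x - θ₀))‖ ≤
      empMean D x (fun d => H (θ x) d * ‖θ x - θ₀‖) := by
    refine norm_empMean_le D x fun d => ?_
    by_cases h : θ x = θ₀
    · simp [h]
    · have h3 : ‖θ x - θ₀‖ ≠ 0 := norm_ne_zero_iff.2 (sub_ne_zero.2 h)
      simp only [H]
      rw [mul_comm (‖θ x - θ₀‖⁻¹), mul_assoc, inv_mul_cancel₀ h3, mul_one]
  have h2 : empMean D x (fun d => H (θ x) d * ‖θ x - θ₀‖) =
      empMean D x (H (θ x)) * ‖θ x - θ₀‖ := empMean_smul_const D x (H (θ x)) ‖θ x - θ₀‖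
  have h3 : empMean D x (H (θ x)) ≤ ε x + ∫ d, H (θ x) d ∂P := by
    have := (le_abs_self _).trans (hεle x (θ x) hx)
    linarith
  have h4 : empMean D x (fun d => f' d (θ x - θ₀)) = empMean D x f' (θ x - θ₀) :=
    (map_empMean D x (ContinuousLinearMap.apply ℝ (E n) (θ x - θ₀)) f').symm
  rw [empMean_sub, empMean_sub, h4, h2] at h1
  calc _ = ‖(empMean D x (f (θ x)) - empMean D x (f θ₀) - empMean D x f' (θ x - θ₀)) +
        (empMean D x f' - ∫ d, f' d ∂P) (θ x - θ₀)‖ := by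
        rw [_root_.sub_apply]; congr 1; abel
    _ ≤ (ε x + ∫ d, H (θ x) d ∂P) * ‖θ x - θ₀‖ +
        ‖empMean D x f' - ∫ d, f' d ∂P‖ * ‖θ x - θ₀‖ :=
        (norm_add_le _ _).trans (add_le_add
          (h1.trans (mul_le_mul_of_nonneg_right h3 (norm_nonneg _)))
          (ContinuousLinearMap.le_opNorm _ _))
    _ = _ := by ring

end Smooth

/-! ### Population identities -/

namespace Design

section Pattern

variable {X : Type*} {p K q : ℕ} {V : Type*}

/-- The restriction of a function of the full data to the units with pattern `s`. -/
def onPattern [Zero V] (s : Fin (K + 1)) (f : FullData X p → V) (d : Datum X p K) : V :=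
  if d.2 = s then f d.1 else 0

theorem onPattern_eq_indicator [Zero V] (s : Fin (K + 1)) (f : FullData X p → V) :
    onPattern s f = Set.indicator {d : Datum X p K | d.2 = s} (fun d => f d.1) := by
  ext d; simp [onPattern, Set.indicator_apply]

theorem map_onPattern {W F : Type*} [Zero V] [Zero W] [FunLike F V W] [ZeroHomClass F V W]
    (L : F) (s : Fin (K + 1)) (f : FullData X p → V) (d : Datum X p K) :
    L (onPattern s f d) = onPattern s (fun w => L (f w)) d := by
  unfold onPattern; split_ifs <;> simp

theorem onPattern_add [AddZeroClass V] (s : Fin (K + 1)) (f g : FullData X p → V)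
    (d : Datum X p K) :
    onPattern s (fun w => f w + g w) d = onPattern s f d + onPattern s g d := by
  unfold onPattern; split_ifs <;> simp

theorem onPattern_sub [AddGroup V] (s : Fin (K + 1)) (f g : FullData X p → V)
    (d : Datum X p K) :
    onPattern s (fun w => f w - g w) d = onPattern s f d - onPattern s g d := by
  unfold onPattern; split_ifs <;> simp

theorem onPattern_sub_const [AddCommGroup V] [Module ℝ V] (s : Fin (K + 1))
    (f : FullData X p → V) (m : V) (d : Datum X p K) :
    onPattern s (fun w => f w - m) d = onPattern s f d - onPattern s (fun _ => (1 : ℝ)) d • m := by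
  unfold onPattern; split_ifs <;> simp

theorem onPattern_const_smul [AddCommGroup V] [Module ℝ V] (s : Fin (K + 1)) (c : ℝ)
    (f : FullData X p → V) (d : Datum X p K) :
    onPattern s (fun w => c • f w) d = c • onPattern s f d := by
  unfold onPattern; split_ifs <;> simp

theorem norm_onPattern_le [NormedAddCommGroup V] (s : Fin (K + 1)) {f : FullData X p → V}
    {g : FullData X p → ℝ} (h : ∀ w, ‖f w‖ ≤ g w) (d : Datum X p K) :
    ‖onPattern s f d‖ ≤ onPattern s g d := by
  unfold onPattern; split_ifs <;> simp [h]

theorem sum_onPattern [AddCommMonoid V] (f : FullData X p → V) (d : Datum X p K) :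
    ∑ s, onPattern s f d = f d.1 := by
  simp [onPattern]

variable [MeasurableSpace X]

theorem measurableSet_pattern (s : Fin (K + 1)) : MeasurableSet {d : Datum X p K | d.2 = s} :=
  measurable_snd (measurableSet_singleton s)

theorem measurable_onPattern [Zero V] [MeasurableSpace V] (s : Fin (K + 1))
    {f : FullData X p → V} (hf : Measurable f) :
    Measurable (onPattern s f : Datum X p K → V) := by
  rw [onPattern_eq_indicator]
  exact (hf.comp measurable_fst).indicator (measurableSet_pattern s)

variable {P : Measure (Datum X p K)} [NormedAddCommGroup V]

theorem integrable_onPattern_of_integrable (s : Fin (K + 1)) {f : FullData X p → V}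
    (hf : Integrable (fun d => f d.1) P) : Integrable (onPattern s f) P := by
  rw [onPattern_eq_indicator]
  exact hf.indicator (measurableSet_pattern s)

theorem memLp_onPattern_of_memLp (s : Fin (K + 1)) {f : FullData X p → V} {r : ENNReal}
    (hf : MemLp (fun d => f d.1) r P) : MemLp (onPattern s f) r P := by
  rw [onPattern_eq_indicator]
  exact hf.indicator (measurableSet_pattern s)

theorem sum_integral_onPattern [NormedSpace ℝ V] {f : FullData X p → V}
    (hf : Integrable (fun d => f d.1) P) :
    ∑ s, ∫ d, onPattern s f d ∂P = ∫ d, f d.1 ∂P := by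
  rw [← integral_finsetSum _ fun s _ => integrable_onPattern_of_integrable s hf]
  simp only [sum_onPattern]

variable [IsProbabilityMeasure P]

theorem memLp_onPattern_iff {s : Fin (K + 1)} (hs : P {d | d.2 = s} ≠ 0)
    {f : FullData X p → V} {r : ENNReal} :
    MemLp (onPattern s f) r P ↔ MemLp (fun d => f d.1) r (patternLaw P s) := by
  rw [onPattern_eq_indicator, memLp_indicator_iff_restrict (measurableSet_pattern s), patternLaw,
    ProbabilityTheory.cond]
  refine ⟨fun h => h.smul_measure (ENNReal.inv_ne_top.2 hs), fun h => ?_⟩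
  have := h.smul_measure (c := P {d | d.2 = s}) (measure_ne_top _ _)
  rwa [smul_smul, ENNReal.mul_inv_cancel hs (measure_ne_top _ _), one_smul] at this

theorem integrable_onPattern_iff {s : Fin (K + 1)} (hs : P {d | d.2 = s} ≠ 0)
    {f : FullData X p → V} :
    Integrable (onPattern s f) P ↔ Integrable (fun d => f d.1) (patternLaw P s) := by
  rw [← memLp_one_iff_integrable, ← memLp_one_iff_integrable, memLp_onPattern_iff hs]

theorem integral_onPattern [NormedSpace ℝ V] {s : Fin (K + 1)} (hs : P {d | d.2 = s} ≠ 0)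
    (f : FullData X p → V) :
    ∫ d, onPattern s f d ∂P = P.real {d | d.2 = s} • ∫ d, f d.1 ∂(patternLaw P s) := by
  rw [onPattern_eq_indicator, integral_indicator (measurableSet_pattern s), patternLaw,
    ProbabilityTheory.cond, integral_smul_measure, smul_smul, measureReal_def,
    ENNReal.toReal_inv, mul_inv_cancel₀, one_smul]
  exact ENNReal.toReal_ne_zero.2 ⟨hs, measure_ne_top _ _⟩

end Pattern

variable {X : Type*} {p K q : ℕ} (S : Design X p K q)

theorem r_pos (t : Fin K) (φ : E (S.L t + 1)) (w : FullData X p) : 0 < S.r t φ w :=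
  Real.exp_pos _

theorem z_zero (t : Fin K) (w : FullData X p) : S.z t w 0 = 1 := rfl

variable [MeasurableSpace X]

theorem measurable_z {t : Fin K} (hb : Measurable (S.b t)) : Measurable (S.z t) := by
  refine (WithLp.measurable_toLp 2 _).comp (measurable_pi_iff.2 fun j => ?_)
  refine Fin.cases ?_ (fun j => ?_) j
  · simp
  · simp only [Fin.cons_succ]
    exact (measurable_pi_apply j).comp
      (hb.comp (measurable_fst.prodMk ((Finset.measurable_restrict _).comp measurable_snd)))

theorem measurable_r {t : Fin K} (hb : Measurable (S.b t)) (φ : E (S.L t + 1)) :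
    Measurable (S.r t φ) :=
  Real.measurable_exp.comp (measurable_const.inner (S.measurable_z hb))

variable {S} {P : Measure (Datum X p K)}
  {lam : (t : Fin K) → E (S.L t + 1)} {V : Type*} [NormedAddCommGroup V] [NormedSpace ℝ V]

theorem DensityRatioModel.integral_comp_z (hmodel : S.DensityRatioModel P lam) {t : Fin K}
    (hb : Measurable (S.b t)) {g : E (S.L t + 1) → V} (hg : StronglyMeasurable g) :
    ∫ d, g (S.z t d.1) ∂(patternLaw P t.succ) =
      ∫ d, S.r t (lam t) d.1 • g (S.z t d.1) ∂(patternLaw P 0) := by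
  have hz : Measurable fun d : Datum X p K => S.z t d.1 := (S.measurable_z hb).comp measurable_fst
  have hexp : Measurable fun v : E (S.L t + 1) => Real.exp (inner ℝ (lam t) v) := by fun_prop
  rw [← integral_map (φ := fun d : Datum X p K => S.z t d.1) hz.aemeasurable
      hg.aestronglyMeasurable, hmodel t,
    integral_withDensity_eq_integral_toReal_smul hexp.ennreal_ofReal (by simp),
    integral_map hz.aemeasurable]
  · simp only [ENNReal.toReal_ofReal (Real.exp_pos _).le]; rfl
  · exact (hexp.ennreal_ofReal.ennreal_toReal.stronglyMeasurable.smul hg).aestronglyMeasurable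

theorem DensityRatioModel.integrable_comp_z_iff (hmodel : S.DensityRatioModel P lam) {t : Fin K}
    (hb : Measurable (S.b t)) {g : E (S.L t + 1) → V} (hg : StronglyMeasurable g) :
    Integrable (fun d => g (S.z t d.1)) (patternLaw P t.succ) ↔
      Integrable (fun d => S.r t (lam t) d.1 • g (S.z t d.1)) (patternLaw P 0) := by
  have hz : Measurable fun d : Datum X p K => S.z t d.1 := (S.measurable_z hb).comp measurable_fst
  have hexp : Measurable fun v : E (S.L t + 1) => Real.exp (inner ℝ (lam t) v) := by fun_prop
  have h1 := integrable_map_measure (μ := patternLaw P t.succ) (f := fun d => S.z t d.1)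
    hg.aestronglyMeasurable hz.aemeasurable
  rw [hmodel t, integrable_withDensity_iff_integrable_smul' hexp.ennreal_ofReal (by simp),
    integrable_map_measure _ hz.aemeasurable] at h1
  · rw [← Function.comp_def, ← h1]
    simp only [Function.comp_def, ENNReal.toReal_ofReal (Real.exp_pos _).le]; rfl
  · exact (hexp.ennreal_ofReal.ennreal_toReal.stronglyMeasurable.smul hg).aestronglyMeasurable

/-- Conditioning on `z_t` replaces `U` by `h(z_t)` in pattern `t`, and the density ratio carries
`h(z_t)` to the complete pattern. There the weight is a function of `z_t`, so the conditioning can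
be undone with the same `h`. -/
theorem ReducedMAR.integral_U {Θ : Set (E q)} (hmar : S.ReducedMAR P Θ)
    (hmodel : S.DensityRatioModel P lam) {t : Fin K}
    (hb : Measurable (S.b t)) {θ : E q} (hθ : θ ∈ Θ)
    (h0 : Integrable (fun d => S.U θ d.1) (patternLaw P 0))
    (hr : Integrable (fun d => S.r t (lam t) d.1 • S.U θ d.1) (patternLaw P 0)) :
    ∫ d, S.U θ d.1 ∂(patternLaw P t.succ) =
      ∫ d, S.r t (lam t) d.1 • S.U θ d.1 ∂(patternLaw P 0) := by
  obtain ⟨h, hh, hcond⟩ := hmar t θ hθ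
  have hz : Measurable fun d : Datum X p K => S.z t d.1 := (S.measurable_z hb).comp measurable_fst
  have hm := hz.comap_le
  have : ∀ s, IsFiniteMeasure (patternLaw P s) := fun s => by unfold patternLaw; infer_instance
  have hr_meas : AEStronglyMeasurable[MeasurableSpace.comap (fun d : Datum X p K => S.z t d.1)
      inferInstance] (fun d : Datum X p K => S.r t (lam t) d.1) (patternLaw P 0) := by
    have hexp : Measurable fun v : E (S.L t + 1) => Real.exp (inner ℝ (lam t) v) := by fun_prop
    exact (hexp.comp (comap_measurable fun d : Datum X p K => S.z t d.1)).aestronglyMeasurable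
  have h2 := condExp_smul_of_aestronglyMeasurable_left hr_meas hr h0
  have h3 := integral_condExp hm (μ := patternLaw P 0)
    (f := fun d => S.r t (lam t) d.1 • S.U θ d.1)
  rw [← integral_condExp hm, integral_congr_ae (hcond t.succ (by simp)),
    hmodel.integral_comp_z hb hh.stronglyMeasurable]
  refine Eq.trans (integral_congr_ae ?_) h3
  filter_upwards [hcond 0 (by simp), h2] with d hd1 hd2
  refine Eq.trans ?_ hd2.symm
  simp [hd1]

end Design

namespace Design

/-! ### Integrability under the envelope condition -/

section Envelope

variable {X : Type*} {p K q : ℕ} (S : Design X p K q)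

/-- The envelope of the density ratios with parameter within `ρ` of `lam t`, times `1 + G`. -/
def env (lam : (t : Fin K) → E (S.L t + 1)) (ρ : ℝ) (G : FullData X p → ℝ) (t : Fin K)
    (w : FullData X p) : ℝ :=
  Real.exp (inner ℝ (lam t) (S.z t w) + ρ * ‖S.z t w‖) * (1 + G w)

variable [MeasurableSpace X]

/-- The domination condition of `Regular` with given radius and envelope. -/
structure Envelope (P : Measure (Datum X p K)) (Θ : Set (E q)) (θ₀ : E q)
    (lam : (t : Fin K) → E (S.L t + 1)) (ρ : ℝ) (G : FullData X p → ℝ) : Prop where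
  pos : 0 < ρ
  measurable_G : Measurable G
  norm_U_le : ∀ w, ∀ θ ∈ Θ, ‖S.U θ w‖ ≤ G w
  norm_fderiv_le : ∀ w, ∀ θ ∈ Metric.ball θ₀ ρ, ‖fderiv ℝ (fun θ' => S.U θ' w) θ‖ ≤ G w
  integrable_G : Integrable (fun d => G d.1) P
  integrable_env : ∀ t, Integrable (fun d => S.env lam ρ G t d.1) (patternLaw P 0)

variable {S} {P : Measure (Datum X p K)} {Θ : Set (E q)} {θ₀ : E q}
  {lam : (t : Fin K) → E (S.L t + 1)} {ρ : ℝ} {G : FullData X p → ℝ}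

theorem Regular.exists_envelope (hreg : S.Regular P Θ θ₀ lam) :
    ∃ ρ G, S.Envelope P Θ θ₀ lam ρ G := by
  obtain ⟨ρ, h1, G, h2, h3, h4, h5, h6⟩ := hreg.dominated
  exact ⟨ρ, G, h1, h2, h3, h4, h5, h6⟩

theorem Regular.mem (hreg : S.Regular P Θ θ₀ lam) : θ₀ ∈ Θ := interior_subset hreg.mem_interior

omit [MeasurableSpace X] in
theorem r_eq_mul_exp (t : Fin K) (φ ψ : E (S.L t + 1)) (w : FullData X p) :
    S.r t φ w = S.r t ψ w * Real.exp (inner ℝ (φ - ψ) (S.z t w)) := by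
  simp only [r, ← Real.exp_add, inner_sub_left]
  congr 1; ring

theorem Envelope.G_nonneg (he : S.Envelope P Θ θ₀ lam ρ G) (hreg : S.Regular P Θ θ₀ lam)
    (w : FullData X p) : 0 ≤ G w :=
  (norm_nonneg _).trans (he.norm_U_le w θ₀ hreg.mem)

/-- The margin `ρ` in the exponent is split in halves: one absorbs `exp |⟨φ - lam t, z⟩|` for `‖φ -
lam t‖ ≤ ρ / 2`, the other the polynomial factors. The third power is what the quadratic Taylor
remainder needs: two factors `‖z‖` from the remainder and one `1 + ‖z‖` from the growth of the
regression residual. -/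
theorem Envelope.exists_bounds (he : S.Envelope P Θ θ₀ lam ρ G) (hreg : S.Regular P Θ θ₀ lam) :
    ∃ C : ℝ, 0 < C ∧ ∀ t w,
      S.r t (lam t) w * (1 + ‖S.z t w‖) ^ 3 * (1 + G w) ≤ C * S.env lam ρ G t w ∧
      ∀ φ, ‖φ - lam t‖ ≤ ρ / 2 →
        |S.r t φ w - S.r t (lam t) w| * (1 + G w) ≤ C * ‖φ - lam t‖ * S.env lam ρ G t w ∧
        |S.r t φ w - S.r t (lam t) w - S.r t (lam t) w * inner ℝ (φ - lam t) (S.z t w)| *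
          ((1 + ‖S.z t w‖) * (1 + G w)) ≤ C * ‖φ - lam t‖ ^ 2 * S.env lam ρ G t w := by
  obtain ⟨C, hC, hle⟩ := exists_one_add_pow_le_exp (half_pos he.pos) 3
  refine ⟨C, hC, fun t w => ?_⟩
  have hG : 0 ≤ 1 + G w := by linarith [he.G_nonneg hreg w]
  set a := ‖S.z t w‖ with ha
  have ha0 : 0 ≤ a := norm_nonneg _
  have hr := S.r_pos t (lam t) w
  have hexp : Real.exp (ρ / 2 * a) * Real.exp (ρ / 2 * a) = Real.exp (ρ * a) := by
    rw [← Real.exp_add]; congr 1; ring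
  have henv : S.env lam ρ G t w = S.r t (lam t) w * Real.exp (ρ * a) * (1 + G w) := by
    rw [env, Real.exp_add]; rfl
  have hmain : (1 + a) ^ 3 * Real.exp (ρ / 2 * a) ≤ C * Real.exp (ρ * a) := by
    rw [← hexp, ← mul_assoc]
    exact mul_le_mul_of_nonneg_right (hle a ha0) (Real.exp_pos _).le
  have hmono : Real.exp (ρ / 2 * a) ≥ 1 :=
    Real.one_le_exp (mul_nonneg (half_pos he.pos).le ha0)
  have ha3 : 0 < (1 + a) ^ 3 := by positivity
  have hfin : ∀ b c : ℝ, 0 ≤ c → b ≤ c * ((1 + a) ^ 3 * Real.exp (ρ / 2 * a)) →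
      S.r t (lam t) w * b * (1 + G w) ≤ C * c * S.env lam ρ G t w := by
    intro b c hc hb
    have h1 : b ≤ c * (C * Real.exp (ρ * a)) := hb.trans (mul_le_mul_of_nonneg_left hmain hc)
    calc _ ≤ S.r t (lam t) w * (c * (C * Real.exp (ρ * a))) * (1 + G w) := by gcongr
      _ = _ := by rw [henv]; ring
  refine ⟨?_, fun φ hφ => ?_⟩
  · have := hfin ((1 + a) ^ 3) 1 zero_le_one (by nlinarith)
    simpa using this
  · set δ := ‖φ - lam t‖ with hδ
    have hδ0 : 0 ≤ δ := norm_nonneg _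
    set s : ℝ := inner ℝ (φ - lam t) (S.z t w) with hs
    have hsa : |s| ≤ δ * a := abs_real_inner_le_norm _ _
    have hes : Real.exp |s| ≤ Real.exp (ρ / 2 * a) :=
      Real.exp_le_exp.2 (hsa.trans (mul_le_mul_of_nonneg_right hφ ha0))
    have h1 : a ≤ (1 + a) ^ 3 := by nlinarith [sq_nonneg a, mul_nonneg ha0 (sq_nonneg a)]
    have h2 : a ^ 2 * (1 + a) ≤ (1 + a) ^ 3 := by nlinarith [sq_nonneg a]
    rw [r_eq_mul_exp t φ (lam t) w, ← hs]
    constructor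
    · have e : |S.r t (lam t) w * Real.exp s - S.r t (lam t) w| =
          S.r t (lam t) w * |Real.exp s - 1| := by
        rw [← mul_sub_one, abs_mul, abs_of_pos hr]
      rw [e]
      refine hfin _ δ hδ0 ?_
      calc _ ≤ |s| * Real.exp |s| := abs_exp_sub_one_le_abs_mul_exp s
        _ ≤ (δ * a) * Real.exp (ρ / 2 * a) := by gcongr
        _ ≤ (δ * (1 + a) ^ 3) * Real.exp (ρ / 2 * a) := by gcongr
        _ = _ := by ring
    · have e : |S.r t (lam t) w * Real.exp s - S.r t (lam t) w - S.r t (lam t) w * s| =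
          S.r t (lam t) w * |Real.exp s - 1 - s| := by
        rw [← abs_of_pos hr, ← abs_mul, abs_of_pos hr]; congr 1; ring
      rw [e]
      have := hfin (|Real.exp s - 1 - s| * (1 + a)) (δ ^ 2) (by positivity) ?_
      · linarith
      calc _ ≤ (|s| ^ 2 * Real.exp |s|) * (1 + a) := by
            gcongr; exact abs_exp_sub_one_sub_self_le s
        _ ≤ ((δ * a) ^ 2 * Real.exp (ρ / 2 * a)) * (1 + a) := by gcongr
        _ = δ ^ 2 * (a ^ 2 * (1 + a)) * Real.exp (ρ / 2 * a) := by ring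
        _ ≤ δ ^ 2 * (1 + a) ^ 3 * Real.exp (ρ / 2 * a) := by gcongr
        _ = _ := by ring

theorem Envelope.integrable_U (he : S.Envelope P Θ θ₀ lam ρ G)
    (hreg : S.Regular P Θ θ₀ lam) {θ : E q} (hθ : θ ∈ Θ) :
    Integrable (fun d => S.U θ d.1) P :=
  he.integrable_G.mono' ((hreg.measurable_U θ hθ).comp measurable_fst).aestronglyMeasurable
    (Eventually.of_forall fun d => he.norm_U_le d.1 θ hθ)

variable [IsProbabilityMeasure P]

theorem Envelope.integrable_onPattern_env (he : S.Envelope P Θ θ₀ lam ρ G)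
    (hreg : S.Regular P Θ θ₀ lam) (t : Fin K) :
    Integrable (onPattern 0 (S.env lam ρ G t)) P :=
  (integrable_onPattern_iff (hreg.pattern_pos 0)).2 (he.integrable_env t)

theorem Envelope.integrable_onPattern (he : S.Envelope P Θ θ₀ lam ρ G)
    (hreg : S.Regular P Θ θ₀ lam) (t : Fin K) {V : Type*} [NormedAddCommGroup V]
    [MeasurableSpace V] [BorelSpace V] [SecondCountableTopology V]
    {f : FullData X p → V} (hf : Measurable f) {c : ℝ} (hc : 0 ≤ c)
    (hle : ∀ w, ‖f w‖ ≤ c * (S.r t (lam t) w * (1 + ‖S.z t w‖) ^ 3 * (1 + G w))) :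
    Integrable (onPattern 0 f) P := by
  obtain ⟨C, hC, hb⟩ := he.exists_bounds hreg
  refine ((he.integrable_onPattern_env hreg t).const_mul (c * C)).mono'
    (measurable_onPattern 0 hf).aestronglyMeasurable (Eventually.of_forall fun d => ?_)
  refine (norm_onPattern_le 0 (fun w => (hle w).trans
    (mul_le_mul_of_nonneg_left (hb t w).1 hc)) d).trans (le_of_eq ?_)
  unfold onPattern; split_ifs
  · ring
  · simp

theorem Envelope.integrable_r_G (he : S.Envelope P Θ θ₀ lam ρ G)
    (hreg : S.Regular P Θ θ₀ lam) (t : Fin K) :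
    Integrable (onPattern 0 fun w => S.r t (lam t) w * G w) P := by
  refine he.integrable_onPattern hreg t
    ((S.measurable_r (hreg.measurable_b t) _).mul he.measurable_G) zero_le_one fun w => ?_
  have hG := he.G_nonneg hreg w
  have hr := S.r_pos t (lam t) w
  have hz := norm_nonneg (S.z t w)
  rw [Real.norm_of_nonneg (by positivity), one_mul, mul_assoc]
  refine mul_le_mul_of_nonneg_left ?_ hr.le
  have : 1 ≤ (1 + ‖S.z t w‖) ^ 3 := one_le_pow₀ (by linarith)
  nlinarith

theorem Envelope.integrable_r_U (he : S.Envelope P Θ θ₀ lam ρ G)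
    (hreg : S.Regular P Θ θ₀ lam) (t : Fin K) {θ : E q} (hθ : θ ∈ Θ) :
    Integrable (onPattern 0 fun w => S.r t (lam t) w • S.U θ w) P := by
  refine (he.integrable_r_G hreg t).mono' (measurable_onPattern 0
    ((S.measurable_r (hreg.measurable_b t) _).smul (hreg.measurable_U θ hθ))).aestronglyMeasurable
    (Eventually.of_forall (norm_onPattern_le 0 fun w => ?_))
  rw [norm_smul, Real.norm_of_nonneg (S.r_pos _ _ _).le]
  exact mul_le_mul_of_nonneg_left (he.norm_U_le w θ hθ) (S.r_pos _ _ _).le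

/-! ### Population identities between patterns -/

/-- The ratio of the probabilities of pattern `t` and of the complete pattern. -/
def patternRatio (P : Measure (Datum X p K)) (t : Fin K) : ℝ :=
  P.real {d | d.2 = t.succ} / P.real {d | d.2 = 0}

theorem Regular.prob_pos (hreg : S.Regular P Θ θ₀ lam) (s : Fin (K + 1)) :
    0 < P.real {d | d.2 = s} :=
  ENNReal.toReal_pos (hreg.pattern_pos s) (measure_ne_top _ _)

theorem Regular.patternRatio_pos (hreg : S.Regular P Θ θ₀ lam) (t : Fin K) :
    0 < patternRatio P t :=
  div_pos (hreg.prob_pos _) (hreg.prob_pos _)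

theorem Regular.integral_onPattern_comp_z (hreg : S.Regular P Θ θ₀ lam)
    (hmodel : S.DensityRatioModel P lam) (t : Fin K) {V : Type*} [NormedAddCommGroup V]
    [NormedSpace ℝ V] {g : E (S.L t + 1) → V} (hg : StronglyMeasurable g) :
    ∫ d, onPattern t.succ (fun w => g (S.z t w)) d ∂P =
      patternRatio P t • ∫ d, onPattern 0 (fun w => S.r t (lam t) w • g (S.z t w)) d ∂P := by
  rw [integral_onPattern (hreg.pattern_pos _), integral_onPattern (hreg.pattern_pos _),
    hmodel.integral_comp_z (hreg.measurable_b t) hg, smul_smul, patternRatio,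
    div_mul_cancel₀ _ (hreg.prob_pos 0).ne']

theorem Regular.integrable_onPattern_comp_z_iff (hreg : S.Regular P Θ θ₀ lam)
    (hmodel : S.DensityRatioModel P lam) (t : Fin K) {V : Type*} [NormedAddCommGroup V]
    [NormedSpace ℝ V] {g : E (S.L t + 1) → V} (hg : StronglyMeasurable g) :
    Integrable (onPattern t.succ (fun w => g (S.z t w))) P ↔
      Integrable (onPattern 0 (fun w => S.r t (lam t) w • g (S.z t w))) P := by
  rw [integrable_onPattern_iff (hreg.pattern_pos _), integrable_onPattern_iff (hreg.pattern_pos _),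
    hmodel.integrable_comp_z_iff (hreg.measurable_b t) hg]

theorem Envelope.integral_onPattern_U (he : S.Envelope P Θ θ₀ lam ρ G)
    (hreg : S.Regular P Θ θ₀ lam) (hmodel : S.DensityRatioModel P lam) (hmar : S.ReducedMAR P Θ)
    (t : Fin K) {θ : E q} (hθ : θ ∈ Θ) :
    ∫ d, onPattern t.succ (S.U θ) d ∂P =
      patternRatio P t • ∫ d, onPattern 0 (fun w => S.r t (lam t) w • S.U θ w) d ∂P := by
  rw [integral_onPattern (hreg.pattern_pos _), integral_onPattern (hreg.pattern_pos _),
    hmar.integral_U hmodel (hreg.measurable_b t) hθ, smul_smul, patternRatio,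
    div_mul_cancel₀ _ (hreg.prob_pos 0).ne']
  · exact (integrable_onPattern_iff (hreg.pattern_pos 0)).1
      (integrable_onPattern_of_integrable 0 (he.integrable_U hreg hθ))
  · exact (integrable_onPattern_iff (hreg.pattern_pos 0)).1 (he.integrable_r_U hreg t hθ)

theorem Regular.integrable_onPattern_z (hreg : S.Regular P Θ θ₀ lam)
    (hmodel : S.DensityRatioModel P lam) (t : Fin K) :
    Integrable (onPattern t.succ (S.z t)) P := by
  refine (hreg.integrable_onPattern_comp_z_iff hmodel t stronglyMeasurable_id).2 ?_
  refine (integrable_onPattern_iff (hreg.pattern_pos 0)).2 ?_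
  have : IsProbabilityMeasure (patternLaw P 0) := cond_isProbabilityMeasure (hreg.pattern_pos 0)
  exact (hreg.memLp_r_z t).integrable (by norm_num)

/-- On the complete pattern this second moment carries only the first power of `r`, so it is
controlled by the envelope and not by `memLp_r_z`. -/
theorem Envelope.memLp_onPattern_z (he : S.Envelope P Θ θ₀ lam ρ G)
    (hreg : S.Regular P Θ θ₀ lam) (hmodel : S.DensityRatioModel P lam) (t : Fin K) :
    MemLp (onPattern t.succ (S.z t)) 2 P := by
  have hz := S.measurable_z (hreg.measurable_b t)
  refine (memLp_two_iff_integrable_sq_norm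
    (measurable_onPattern _ hz).aestronglyMeasurable).2 ?_
  have h : (fun d => ‖onPattern t.succ (S.z t) d‖ ^ 2) =
      onPattern t.succ (fun w : FullData X p => ‖S.z t w‖ ^ 2) := by
    ext d; unfold onPattern; split_ifs <;> simp
  rw [h]
  refine (hreg.integrable_onPattern_comp_z_iff hmodel t (g := fun v => ‖v‖ ^ 2)
    (by fun_prop)).2 ?_
  refine he.integrable_onPattern hreg t
    ((S.measurable_r (hreg.measurable_b t) _).mul (hz.norm.pow_const 2)) zero_le_one fun w => ?_
  have hG := he.G_nonneg hreg w
  have hr := S.r_pos t (lam t) w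
  have hz := norm_nonneg (S.z t w)
  rw [smul_eq_mul, Real.norm_of_nonneg (by positivity), one_mul, mul_assoc]
  refine mul_le_mul_of_nonneg_left ?_ hr.le
  have h1 : ‖S.z t w‖ ^ 2 ≤ (1 + ‖S.z t w‖) ^ 3 := by
    nlinarith [sq_nonneg ‖S.z t w‖, mul_nonneg hz (sq_nonneg ‖S.z t w‖)]
  have h2 : 0 ≤ (1 + ‖S.z t w‖) ^ 3 := by positivity
  nlinarith

end Envelope

end Design

theorem Measurable.rankOne {𝒟 : Type*} [MeasurableSpace 𝒟] {m n : ℕ} {u : 𝒟 → E n} {v : 𝒟 → E m}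
    (hu : Measurable u) (hv : Measurable v) :
    Measurable fun d => InnerProductSpace.rankOne ℝ (u d) (v d) := by
  refine measurable_clm_of_apply fun w => ?_
  simp only [InnerProductSpace.rankOne_apply]
  exact (Measurable.inner (𝕜 := ℝ) hv measurable_const).smul hu

namespace Design

/-! ### Population regression of `U` on `z_t` and weighted moments -/

section Moments

variable {X : Type*} {p K q : ℕ} {V : Type*}

theorem onPattern_smul [AddCommGroup V] [Module ℝ V] (s : Fin (K + 1)) (c : FullData X p → ℝ)
    (f : FullData X p → V) (d : Datum X p K) :
    onPattern s (fun w => c w • f w) d = onPattern s c d • f d.1 := by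
  unfold onPattern; split_ifs <;> simp

variable [MeasurableSpace X] (S : Design X p K q)

/-- The second moment operator of `z_t` on the complete pattern, weighted by the density ratio. -/
def secondMoment (P : Measure (Datum X p K)) (lam : (t : Fin K) → E (S.L t + 1)) (t : Fin K) :
    E (S.L t + 1) →L[ℝ] E (S.L t + 1) :=
  ∫ d, onPattern 0
    (fun w => S.r t (lam t) w • InnerProductSpace.rankOne ℝ (S.z t w) (S.z t w)) d ∂P

/-- The mixed moment operator of `U` and `z_t` on the complete pattern, weighted by the density
ratio. -/
def crossMoment (P : Measure (Datum X p K)) (θ₀ : E q) (lam : (t : Fin K) → E (S.L t + 1))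
    (t : Fin K) : E (S.L t + 1) →L[ℝ] E q :=
  ∫ d, onPattern 0
    (fun w => S.r t (lam t) w • InnerProductSpace.rankOne ℝ (S.U θ₀ w) (S.z t w)) d ∂P

/-- The population regression coefficient of `U` on `z_t`. -/
def regCoeff (P : Measure (Datum X p K)) (θ₀ : E q) (lam : (t : Fin K) → E (S.L t + 1))
    (t : Fin K) : E (S.L t + 1) →L[ℝ] E q :=
  S.crossMoment P θ₀ lam t ∘L (S.secondMoment P lam t).inverse

/-- The population residual of the regression of `U` on `z_t`. -/
def resid (P : Measure (Datum X p K)) (θ₀ : E q) (lam : (t : Fin K) → E (S.L t + 1))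
    (t : Fin K) (w : FullData X p) : E q :=
  S.U θ₀ w - S.regCoeff P θ₀ lam t (S.z t w)

variable {S} {P : Measure (Datum X p K)} {Θ : Set (E q)} {θ₀ : E q}
  {lam : (t : Fin K) → E (S.L t + 1)} {ρ : ℝ} {G : FullData X p → ℝ}

theorem Envelope.norm_resid_le (he : S.Envelope P Θ θ₀ lam ρ G)
    (hreg : S.Regular P Θ θ₀ lam) (t : Fin K) (w : FullData X p) :
    ‖S.resid P θ₀ lam t w‖ ≤
      (1 + ‖S.regCoeff P θ₀ lam t‖) * ((1 + ‖S.z t w‖) * (1 + G w)) := by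
  have hG := he.G_nonneg hreg w
  have h1 := he.norm_U_le w θ₀ hreg.mem
  have h2 := (S.regCoeff P θ₀ lam t).le_opNorm (S.z t w)
  have hz := norm_nonneg (S.z t w)
  have hβ := norm_nonneg (S.regCoeff P θ₀ lam t)
  calc _ ≤ ‖S.U θ₀ w‖ + ‖S.regCoeff P θ₀ lam t (S.z t w)‖ := norm_sub_le _ _
    _ ≤ 1 * ((1 + ‖S.z t w‖) * (1 + G w)) +
        ‖S.regCoeff P θ₀ lam t‖ * ((1 + ‖S.z t w‖) * (1 + G w)) := by
        refine add_le_add (h1.trans (by nlinarith)) (h2.trans ?_)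
        exact mul_le_mul_of_nonneg_left (by nlinarith) hβ
    _ = _ := by ring

theorem Regular.measurable_resid (hreg : S.Regular P Θ θ₀ lam) (t : Fin K) :
    Measurable (S.resid P θ₀ lam t) :=
  (hreg.measurable_U θ₀ hreg.mem).sub
    ((S.regCoeff P θ₀ lam t).continuous.measurable.comp (S.measurable_z (hreg.measurable_b t)))

theorem Regular.eq_zero_of_ae (hreg : S.Regular P Θ θ₀ lam) {t : Fin K}
    {c : FullData X p → ℝ} (hc : ∀ w, 0 < c w) (v : E (S.L t + 1))
    (h : ∀ᵐ d ∂P, onPattern 0 c d = 0 ∨ inner ℝ v (S.z t d.1) = 0) : v = 0 := by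
  refine hreg.linearIndependent t v ?_
  rw [patternLaw, ProbabilityTheory.cond]
  refine Measure.ae_smul_measure ?_ _
  rw [ae_restrict_iff' (measurableSet_pattern 0)]
  filter_upwards [h] with d hd h0
  refine hd.resolve_left ?_
  rw [onPattern, if_pos h0]
  exact (hc d.1).ne'

theorem Envelope.exists_ball (he : S.Envelope P Θ θ₀ lam ρ G) (hreg : S.Regular P Θ θ₀ lam) :
    ∃ ρ', 0 < ρ' ∧ Metric.ball θ₀ ρ' ⊆ interior Θ ∧ Metric.ball θ₀ ρ' ⊆ Metric.ball θ₀ ρ := by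
  obtain ⟨ε, hε, h⟩ := Metric.isOpen_iff.1 isOpen_interior θ₀ hreg.mem_interior
  exact ⟨min ε ρ, lt_min hε he.pos, (Metric.ball_subset_ball (min_le_left _ _)).trans h,
    Metric.ball_subset_ball (min_le_right _ _)⟩

theorem Regular.differentiableAt_U (hreg : S.Regular P Θ θ₀ lam) {θ : E q} (hθ : θ ∈ interior Θ)
    (w : FullData X p) : DifferentiableAt ℝ (fun θ => S.U θ w) θ :=
  ((hreg.contDiffOn_U w).contDiffAt (isOpen_interior.mem_nhds hθ)).differentiableAt one_ne_zero

theorem Regular.hasFDerivAt_onPattern (hreg : S.Regular P Θ θ₀ lam) {θ : E q}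
    (hθ : θ ∈ interior Θ) (s : Fin (K + 1)) (c : FullData X p → ℝ) (d : Datum X p K) :
    HasFDerivAt (fun θ => onPattern s (fun w => c w • S.U θ w) d)
      (onPattern s (fun w => c w • fderiv ℝ (fun θ => S.U θ w) θ) d) θ := by
  by_cases h : d.2 = s
  · simp only [onPattern, if_pos h]
    exact (hreg.differentiableAt_U hθ d.1).hasFDerivAt.const_smul (c d.1)
  · simp only [onPattern, if_neg h]
    exact hasFDerivAt_const _ _

theorem Regular.measurable_onPattern_smul_U (hreg : S.Regular P Θ θ₀ lam) {θ : E q}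
    (hθ : θ ∈ Θ) (s : Fin (K + 1)) {c : FullData X p → ℝ} (hc : Measurable c) :
    Measurable (onPattern s (fun w => c w • S.U θ w) : Datum X p K → E q) :=
  measurable_onPattern s (hc.smul (hreg.measurable_U θ hθ))

theorem Envelope.norm_fderiv_onPattern_le (he : S.Envelope P Θ θ₀ lam ρ G)
    (hreg : S.Regular P Θ θ₀ lam) (s : Fin (K + 1)) {c : FullData X p → ℝ} (hc : ∀ w, 0 ≤ c w)
    (d : Datum X p K) {θ : E q} (hθ : θ ∈ interior Θ) (hθ' : θ ∈ Metric.ball θ₀ ρ) :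
    ‖fderiv ℝ (fun θ => onPattern s (fun w => c w • S.U θ w) d) θ‖ ≤
      onPattern s (fun w => c w * G w) d := by
  rw [(hreg.hasFDerivAt_onPattern hθ s c d).fderiv]
  refine norm_onPattern_le s (fun w => ?_) d
  rw [norm_smul, Real.norm_of_nonneg (hc w)]
  exact mul_le_mul_of_nonneg_left (he.norm_fderiv_le w θ hθ') (hc w)

theorem Envelope.integrable_smul_U (he : S.Envelope P Θ θ₀ lam ρ G)
    (hreg : S.Regular P Θ θ₀ lam) (s : Fin (K + 1)) {c : FullData X p → ℝ} (hc : ∀ w, 0 ≤ c w)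
    (hcm : Measurable c) (hint : Integrable (onPattern s fun w => c w * G w) P) {θ : E q}
    (hθ : θ ∈ Θ) : Integrable (onPattern s fun w => c w • S.U θ w) P := by
  refine hint.mono' (hreg.measurable_onPattern_smul_U hθ s hcm).aestronglyMeasurable
    (Eventually.of_forall (norm_onPattern_le s fun w => ?_))
  rw [norm_smul, Real.norm_of_nonneg (hc w)]
  exact mul_le_mul_of_nonneg_left (he.norm_U_le w θ hθ) (hc w)

/-- Weighted second moment operators of `z_t` with a positive weight are positive definite. -/
theorem Regular.inner_integral_pos (hreg : S.Regular P Θ θ₀ lam) {t : Fin K}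
    {c : FullData X p → ℝ} (hc : ∀ w, 0 < c w)
    (hint : Integrable (onPattern 0
      fun w => c w • InnerProductSpace.rankOne ℝ (S.z t w) (S.z t w)) P)
    (v : E (S.L t + 1)) (hv : v ≠ 0) :
    0 < inner ℝ v ((∫ d, onPattern 0
      (fun w => c w • InnerProductSpace.rankOne ℝ (S.z t w) (S.z t w)) d ∂P) v) := by
  have e : (onPattern 0 fun w => c w • InnerProductSpace.rankOne ℝ (S.z t w) (S.z t w)) =
      fun d : Datum X p K =>
        onPattern 0 c d • InnerProductSpace.rankOne ℝ (S.z t d.1) (S.z t d.1) := by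
    ext1 d; rw [onPattern_smul]
  rw [e] at hint ⊢
  refine inner_integral_rankOne_pos hint (fun d => ?_) (fun v h => hreg.eq_zero_of_ae hc v h) v hv
  unfold onPattern; split_ifs
  exacts [(hc _).le, le_rfl]

theorem Envelope.hasFDerivAt_integral (he : S.Envelope P Θ θ₀ lam ρ G)
    (hreg : S.Regular P Θ θ₀ lam) (s : Fin (K + 1)) {c : FullData X p → ℝ} (hc : ∀ w, 0 ≤ c w)
    (hcm : Measurable c) (hint : Integrable (onPattern s fun w => c w * G w) P) :
    HasFDerivAt (fun θ => ∫ d, onPattern s (fun w => c w • S.U θ w) d ∂P)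
      (∫ d, onPattern s (fun w => c w • fderiv ℝ (fun θ => S.U θ w) θ₀) d ∂P) θ₀ := by
  obtain ⟨ρ', hρ', h1, h2⟩ := he.exists_ball hreg
  have h := hasFDerivAt_integral_of_norm_fderiv_le (P := P)
    (f := fun θ d => onPattern s (fun w => c w • S.U θ w) d) hρ'
    (fun θ hθ => hreg.measurable_onPattern_smul_U (interior_subset (h1 hθ)) s hcm)
    (fun d θ hθ => (hreg.hasFDerivAt_onPattern (h1 hθ) s c d).differentiableAt)
    (fun d θ hθ => he.norm_fderiv_onPattern_le hreg s hc d (h1 hθ) (h2 hθ)) hint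
    (he.integrable_smul_U hreg s hc hcm hint hreg.mem)
  simpa only [(hreg.hasFDerivAt_onPattern hreg.mem_interior s c _).fderiv] using h

variable [IsProbabilityMeasure P]

theorem Envelope.integrable_r_rankOne (he : S.Envelope P Θ θ₀ lam ρ G)
    (hreg : S.Regular P Θ θ₀ lam) (t : Fin K) {n : ℕ} {u : FullData X p → E n} (hu : Measurable u)
    {c : ℝ} (hc : 0 ≤ c) (hle : ∀ w, ‖u w‖ ≤ c * ((1 + ‖S.z t w‖) * (1 + G w))) :
    Integrable (onPattern 0
      fun w => S.r t (lam t) w • InnerProductSpace.rankOne ℝ (u w) (S.z t w)) P := by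
  have hz := S.measurable_z (hreg.measurable_b t)
  refine he.integrable_onPattern hreg t
    ((S.measurable_r (hreg.measurable_b t) _).smul (hu.rankOne hz)) hc fun w => ?_
  have hG := he.G_nonneg hreg w
  have hr := S.r_pos t (lam t) w
  have hz0 := norm_nonneg (S.z t w)
  rw [norm_smul, Real.norm_of_nonneg hr.le, InnerProductSpace.norm_rankOne]
  have h1 : (1 + ‖S.z t w‖) * ‖S.z t w‖ ≤ (1 + ‖S.z t w‖) ^ 3 := by
    nlinarith [sq_nonneg ‖S.z t w‖, mul_nonneg hz0 (sq_nonneg ‖S.z t w‖)]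
  calc _ ≤ S.r t (lam t) w * (c * ((1 + ‖S.z t w‖) * (1 + G w)) * ‖S.z t w‖) := by
        gcongr; exact hle w
    _ = S.r t (lam t) w * c * (1 + G w) * ((1 + ‖S.z t w‖) * ‖S.z t w‖) := by ring
    _ ≤ S.r t (lam t) w * c * (1 + G w) * (1 + ‖S.z t w‖) ^ 3 := by gcongr
    _ = _ := by ring

theorem Envelope.integrable_secondMoment (he : S.Envelope P Θ θ₀ lam ρ G)
    (hreg : S.Regular P Θ θ₀ lam) (t : Fin K) :
    Integrable (onPattern 0
      fun w => S.r t (lam t) w • InnerProductSpace.rankOne ℝ (S.z t w) (S.z t w)) P := by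
  refine he.integrable_r_rankOne hreg t (S.measurable_z (hreg.measurable_b t)) zero_le_one
    fun w => ?_
  have hG := he.G_nonneg hreg w
  nlinarith [norm_nonneg (S.z t w)]

theorem Envelope.integrable_crossMoment (he : S.Envelope P Θ θ₀ lam ρ G)
    (hreg : S.Regular P Θ θ₀ lam) (t : Fin K) :
    Integrable (onPattern 0
      fun w => S.r t (lam t) w • InnerProductSpace.rankOne ℝ (S.U θ₀ w) (S.z t w)) P := by
  refine he.integrable_r_rankOne hreg t (hreg.measurable_U θ₀ hreg.mem) zero_le_one fun w => ?_
  have hG := he.G_nonneg hreg w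
  nlinarith [norm_nonneg (S.z t w), he.norm_U_le w θ₀ hreg.mem]

theorem Envelope.isInvertible_secondMoment (he : S.Envelope P Θ θ₀ lam ρ G)
    (hreg : S.Regular P Θ θ₀ lam) (t : Fin K) : (S.secondMoment P lam t).IsInvertible :=
  ContinuousLinearMap.isInvertible_of_inner_pos
    (hreg.inner_integral_pos (S.r_pos t (lam t)) (he.integrable_secondMoment hreg t))

/-- The population normal equations. -/
theorem Envelope.integral_r_rankOne_resid (he : S.Envelope P Θ θ₀ lam ρ G)
    (hreg : S.Regular P Θ θ₀ lam) (t : Fin K) :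
    ∫ d, onPattern 0 (fun w => S.r t (lam t) w •
      InnerProductSpace.rankOne ℝ (S.resid P θ₀ lam t w) (S.z t w)) d ∂P = 0 := by
  set β := S.regCoeff P θ₀ lam t with hβ
  have hC := he.integrable_crossMoment hreg t
  have hA := he.integrable_secondMoment hreg t
  let Φ : (E (S.L t + 1) →L[ℝ] E (S.L t + 1)) →L[ℝ] (E (S.L t + 1) →L[ℝ] E q) :=
    ContinuousLinearMap.compL ℝ _ _ _ β
  have e : ∀ d : Datum X p K, onPattern 0 (fun w => S.r t (lam t) w •
      InnerProductSpace.rankOne ℝ (S.resid P θ₀ lam t w) (S.z t w)) d =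
      onPattern 0 (fun w => S.r t (lam t) w •
        InnerProductSpace.rankOne ℝ (S.U θ₀ w) (S.z t w)) d -
      Φ (onPattern 0 (fun w => S.r t (lam t) w •
        InnerProductSpace.rankOne ℝ (S.z t w) (S.z t w)) d) := by
    intro d
    rw [map_onPattern, ← onPattern_sub]
    congr 1
    ext1 w
    ext1 v
    simp [Φ, resid, smul_sub, ← hβ]
  simp only [e]
  rw [integral_sub hC (Φ.integrable_comp hA), Φ.integral_comp_comm hA]
  change S.crossMoment P θ₀ lam t - β ∘L S.secondMoment P lam t = 0
  rw [hβ, regCoeff, ContinuousLinearMap.comp_assoc]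
  obtain ⟨e', he'⟩ := he.isInvertible_secondMoment hreg t
  rw [← he', ContinuousLinearMap.inverse_equiv]
  simp

theorem Envelope.integrable_r_rankOne_resid (he : S.Envelope P Θ θ₀ lam ρ G)
    (hreg : S.Regular P Θ θ₀ lam) (t : Fin K) :
    Integrable (onPattern 0 (fun w => S.r t (lam t) w •
      InnerProductSpace.rankOne ℝ (S.resid P θ₀ lam t w) (S.z t w))) P :=
  he.integrable_r_rankOne hreg t (hreg.measurable_resid t) (by positivity)
    (he.norm_resid_le hreg t)

/-- This is the intercept column of the normal equations, since the coordinate `0` of `z_t` is `1`.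
It lets the random ratio `N_t / N₁` multiply a centred mean. -/
theorem Envelope.integral_r_resid (he : S.Envelope P Θ θ₀ lam ρ G)
    (hreg : S.Regular P Θ θ₀ lam) (t : Fin K) :
    ∫ d, onPattern 0 (fun w => S.r t (lam t) w • S.resid P θ₀ lam t w) d ∂P = 0 := by
  have h := (ContinuousLinearMap.apply ℝ (E q)
    (EuclideanSpace.single (0 : Fin (S.L t + 1)) (1 : ℝ))).integral_comp_comm
      (he.integrable_r_rankOne_resid hreg t)
  rw [he.integral_r_rankOne_resid hreg t, map_zero] at h
  rw [← h]
  congr 1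
  ext1 d
  rw [map_onPattern]
  congr 1
  ext1 w
  simp [EuclideanSpace.inner_single_right, z_zero]

/-! ### Smoothness in the parameter -/

/-- The model restricts the regression of `U` only, not that of its derivative. The identity for `U`
holds throughout a neighbourhood of `θ₀`, however, so the derivatives of its two sides agree. -/
theorem Envelope.integral_onPattern_fderiv (he : S.Envelope P Θ θ₀ lam ρ G)
    (hreg : S.Regular P Θ θ₀ lam) (hmodel : S.DensityRatioModel P lam) (hmar : S.ReducedMAR P Θ)
    (t : Fin K) :
    ∫ d, onPattern t.succ (fun w => fderiv ℝ (fun θ => S.U θ w) θ₀) d ∂P =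
      patternRatio P t • ∫ d, onPattern 0
        (fun w => S.r t (lam t) w • fderiv ℝ (fun θ => S.U θ w) θ₀) d ∂P := by
  have h1 := he.hasFDerivAt_integral hreg t.succ (c := fun _ => 1) (fun _ => zero_le_one)
    measurable_const (integrable_onPattern_of_integrable _ (by simpa using he.integrable_G))
  have h2 := (he.hasFDerivAt_integral hreg 0 (fun w => (S.r_pos t (lam t) w).le)
    (S.measurable_r (hreg.measurable_b t) _) (he.integrable_r_G hreg t)).const_smul
      (patternRatio P t)
  simp only [one_smul] at h1
  refine h1.unique (h2.congr_of_eventuallyEq ?_)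
  filter_upwards [mem_interior_iff_mem_nhds.1 hreg.mem_interior] with θ hθ
  exact he.integral_onPattern_U hreg hmodel hmar t hθ

theorem Envelope.gradient_eq (he : S.Envelope P Θ θ₀ lam ρ G)
    (hreg : S.Regular P Θ θ₀ lam) (hmodel : S.DensityRatioModel P lam) (hmar : S.ReducedMAR P Θ) :
    S.gradient P θ₀ =
      ∫ d, onPattern 0 (fun w => fderiv ℝ (fun θ => S.U θ w) θ₀) d ∂P +
      ∑ t, patternRatio P t • ∫ d, onPattern 0
        (fun w => S.r t (lam t) w • fderiv ℝ (fun θ => S.U θ w) θ₀) d ∂P := by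
  have hm : Measurable fun w => fderiv ℝ (fun θ => S.U θ w) θ₀ :=
    measurable_fderiv_apply (s := Θ) (mem_interior_iff_mem_nhds.1 hreg.mem_interior)
      hreg.measurable_U fun w => hreg.differentiableAt_U hreg.mem_interior w
  have hint : Integrable (fun d => fderiv ℝ (fun θ => S.U θ d.1) θ₀) P :=
    he.integrable_G.mono' (hm.comp measurable_fst).aestronglyMeasurable
      (Eventually.of_forall fun d =>
        he.norm_fderiv_le d.1 θ₀ (Metric.mem_ball_self he.pos))
  rw [gradient, ← sum_integral_onPattern (f := fun w => fderiv ℝ (fun θ => S.U θ w) θ₀) hint,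
    Fin.sum_univ_succ]
  simp only [he.integral_onPattern_fderiv hreg hmodel hmar]

/-- The right side is the population limit of the weighted estimating function, which therefore
identifies `θ₀`. -/
theorem Envelope.integral_U_eq (he : S.Envelope P Θ θ₀ lam ρ G)
    (hreg : S.Regular P Θ θ₀ lam) (hmodel : S.DensityRatioModel P lam) (hmar : S.ReducedMAR P Θ)
    {θ : E q} (hθ : θ ∈ Θ) :
    ∫ d, S.U θ d.1 ∂P =
      ∫ d, onPattern 0 (S.U θ) d ∂P +
      ∑ t, patternRatio P t • ∫ d, onPattern 0 (fun w => S.r t (lam t) w • S.U θ w) d ∂P := by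
  rw [← sum_integral_onPattern (he.integrable_U hreg hθ), Fin.sum_univ_succ]
  simp only [he.integral_onPattern_U hreg hmodel hmar _ hθ]

end Moments

end Design

namespace Design

/-! ### Sample quantities as empirical means -/

section Sample

variable {X : Type*} {p K q : ℕ} (S : Design X p K q) {Ω : Type*} {V : Type*}
  [AddCommGroup V] [Module ℝ V] (D : ℕ → Ω → Datum X p K) (x : ℕ × Ω)

/-- The sample path with its first `x.1` units considered. -/
abbrev path : ℕ → Datum X p K := fun i => D i x.2

theorem inv_smul_sum_sampleSet (s : Fin (K + 1)) (f : FullData X p → V) :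
    (x.1 : ℝ)⁻¹ • ∑ i ∈ sampleSet (path D x) x.1 s, f (path D x i).1 =
      empMean D x (onPattern s f) := by
  simp [sampleSet, Finset.sum_filter, empMean, onPattern]

/-- The ratio `N_t / N₁`. -/
def ratio (t : Fin K) : ℝ := count (path D x) x.1 t.succ / count (path D x) x.1 0

theorem ratio_nonneg (t : Fin K) : 0 ≤ ratio D x t := by
  unfold ratio count; positivity

theorem inv_mul_count (s : Fin (K + 1)) :
    (x.1 : ℝ)⁻¹ * count (path D x) x.1 s =
      empMean D x (onPattern s fun _ : FullData X p => (1 : ℝ)) := by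
  rw [← inv_smul_sum_sampleSet]
  simp [count]

theorem ratio_eq (hx : x.1 ≠ 0) (t : Fin K) :
    ratio D x t = empMean D x (onPattern t.succ fun _ : FullData X p => (1 : ℝ)) /
      empMean D x (onPattern 0 fun _ : FullData X p => (1 : ℝ)) := by
  have hx' : ((x.1 : ℝ)⁻¹) ≠ 0 := inv_ne_zero (Nat.cast_ne_zero.2 hx)
  rw [← inv_mul_count, ← inv_mul_count, mul_div_mul_left _ _ hx', ratio]

theorem USPS_eq (φ : (t : Fin K) → E (S.L t + 1)) (θ : E q) :
    S.USPS (path D x) x.1 φ θ = empMean D x (onPattern 0 (S.U θ)) +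
      ∑ t, ratio D x t • empMean D x (onPattern 0 fun w => S.r t (φ t) w • S.U θ w) := by
  simp only [← inv_smul_sum_sampleSet, USPS, weight, add_smul, one_smul, Finset.sum_add_distrib,
    smul_add, Finset.sum_smul]
  congr 1
  rw [Finset.sum_comm, Finset.smul_sum]
  refine Finset.sum_congr rfl fun t _ => ?_
  rw [smul_comm (ratio D x t)]
  simp only [mul_smul, ratio, Finset.smul_sum]

variable {S D x}

/-- The calibration equation multiplied by `N_t / N`, a form in which both sides are related to
empirical means over the whole sample. If `N_t = 0`, both sides are zero. -/
theorem IsCalibrated.ratio_smul {t : Fin K} {φ : E (S.L t + 1)}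
    (h : S.IsCalibrated (path D x) x.1 t φ) :
    ratio D x t • empMean D x (onPattern 0 fun w => S.r t φ w • S.z t w) =
      empMean D x (onPattern t.succ (S.z t)) := by
  rw [← inv_smul_sum_sampleSet, ← inv_smul_sum_sampleSet, ratio, div_eq_mul_inv,
    smul_comm, mul_smul, h]
  congr 1
  by_cases hc : count (path D x) x.1 t.succ = 0
  · have : sampleSet (path D x) x.1 t.succ = ∅ := by
      simpa [count] using hc
    simp [hc, this]
  · rw [smul_smul, mul_inv_cancel₀ hc, one_smul]

/-- The columns of the normal equations are the values of one operator equation on the standard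
basis. -/
theorem isRegressionCoeff_iff (hx : x.1 ≠ 0) {θ₀ : E q} {t : Fin K} {φ : E (S.L t + 1)}
    {B : E (S.L t + 1) →L[ℝ] E q} :
    S.IsRegressionCoeff (path D x) x.1 θ₀ t φ B ↔
      empMean D x (onPattern 0
        fun w => S.r t φ w • InnerProductSpace.rankOne ℝ (S.U θ₀ w) (S.z t w)) =
      B ∘L empMean D x (onPattern 0
        fun w => S.r t φ w • InnerProductSpace.rankOne ℝ (S.z t w) (S.z t w)) := by
  have hx' : ((x.1 : ℝ)⁻¹) ≠ 0 := inv_ne_zero (Nat.cast_ne_zero.2 hx)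
  have key : ∀ v : E (S.L t + 1), (empMean D x (onPattern 0
        fun w => S.r t φ w • InnerProductSpace.rankOne ℝ (S.U θ₀ w) (S.z t w)) -
      B ∘L empMean D x (onPattern 0
        fun w => S.r t φ w • InnerProductSpace.rankOne ℝ (S.z t w) (S.z t w))) v =
      empMean D x (onPattern 0 fun w =>
        (S.r t φ w * inner ℝ (S.z t w) v) • (S.U θ₀ w - B (S.z t w))) := by
    intro v
    rw [_root_.sub_apply, ContinuousLinearMap.comp_apply]
    rw [show ∀ {W : Type} [NormedAddCommGroup W] [NormedSpace ℝ W]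
      (A : E (S.L t + 1) →L[ℝ] W), A v = ContinuousLinearMap.apply ℝ W v A from fun _ => rfl]
    rw [show ∀ (A : E (S.L t + 1) →L[ℝ] E (S.L t + 1)),
      A v = ContinuousLinearMap.apply ℝ _ v A from fun _ => rfl]
    rw [map_empMean, map_empMean, map_empMean, ← empMean_sub]
    congr 1
    ext1 d
    rw [map_onPattern, map_onPattern, map_onPattern, ← onPattern_sub]
    congr 1
    ext1 w
    simp [smul_sub, smul_smul]
  rw [← sub_eq_zero, IsRegressionCoeff]
  constructor
  · intro h
    ext1 v
    rw [← (EuclideanSpace.basisFun _ ℝ).sum_repr v, map_sum, _root_.zero_apply]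
    refine Finset.sum_eq_zero fun j _ => ?_
    rw [map_smul, key, ← inv_smul_sum_sampleSet]
    have := h j
    simp only [EuclideanSpace.basisFun_apply, EuclideanSpace.inner_single_right, one_mul,
      RCLike.conj_to_real]
    rw [this, smul_zero, smul_zero]
  · intro h j
    have := key (EuclideanSpace.single j 1)
    rw [h, _root_.zero_apply, ← inv_smul_sum_sampleSet] at this
    simp only [EuclideanSpace.inner_single_right, one_mul, RCLike.conj_to_real] at this
    exact (smul_eq_zero.1 this.symm).resolve_left hx'

end Sample

end Design

namespace Design

/-! ### Limits of the pattern ratios, the regression coefficient and the calibration score -/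

section Asymptotics

variable {X : Type*} [MeasurableSpace X] {p K q : ℕ} {S : Design X p K q}
  {P : Measure (Datum X p K)} [IsProbabilityMeasure P] {Θ : Set (E q)} {θ₀ : E q}
  {lam : (t : Fin K) → E (S.L t + 1)} {ρ : ℝ} {G : FullData X p → ℝ}
  {Ω : Type*} [MeasurableSpace Ω] {μ : Measure Ω} {D : ℕ → Ω → Datum X p K}

theorem eventually_fst_ne_zero : ∀ᶠ x : ℕ × Ω in probFilter μ, x.1 ≠ 0 :=
  (tendsto_fst_probFilter μ).eventually (eventually_ne_atTop 0)

theorem boundedInProb_mul_of_tendsto {a ξ : ℕ × Ω → ℝ} {c : ℝ}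
    (ha : Tendsto a (probFilter μ) (𝓝 c)) (hξ : BoundedInProb μ ξ) :
    BoundedInProb μ fun x => a x * ξ x := by
  refine hξ.of_abs_le (c := |c| + 1) ?_
  filter_upwards [ha.abs.eventually_le_const (lt_add_one |c|)] with x hx
  rw [abs_mul]
  exact mul_le_mul_of_nonneg_right hx (abs_nonneg _)

variable [IsProbabilityMeasure μ]

theorem integral_onPattern_one (hreg : S.Regular P Θ θ₀ lam) (s : Fin (K + 1)) :
    ∫ d, onPattern s (fun _ : FullData X p => (1 : ℝ)) d ∂P = P.real {d | d.2 = s} := by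
  have : IsProbabilityMeasure (patternLaw P s) := cond_isProbabilityMeasure (hreg.pattern_pos s)
  rw [integral_onPattern (hreg.pattern_pos s)]
  simp

theorem tendsto_empMean_onPattern_one (hD : IsIIDSample P μ D) (hreg : S.Regular P Θ θ₀ lam)
    (s : Fin (K + 1)) :
    Tendsto (fun x => empMean D x (onPattern s fun _ : FullData X p => (1 : ℝ))) (probFilter μ)
      (𝓝 (P.real {d | d.2 = s})) := by
  rw [← integral_onPattern_one hreg]
  exact tendsto_empMean hD (measurable_onPattern s measurable_const)
    (integrable_onPattern_of_integrable s (integrable_const _))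

theorem tendsto_ratio (hD : IsIIDSample P μ D) (hreg : S.Regular P Θ θ₀ lam) (t : Fin K) :
    Tendsto (fun x => ratio D x t) (probFilter μ) (𝓝 (patternRatio P t)) := by
  refine ((tendsto_empMean_onPattern_one hD hreg t.succ).div
    (tendsto_empMean_onPattern_one hD hreg 0) (hreg.prob_pos 0).ne').congr' ?_
  filter_upwards [eventually_fst_ne_zero] with x hx
  exact (ratio_eq D x hx t).symm

/-! ### The regression coefficient -/

theorem Envelope.tendsto_secondMoment (he : S.Envelope P Θ θ₀ lam ρ G)
    (hreg : S.Regular P Θ θ₀ lam) (hD : IsIIDSample P μ D) (t : Fin K) :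
    Tendsto (fun x => empMean D x (onPattern 0
      fun w => S.r t (lam t) w • InnerProductSpace.rankOne ℝ (S.z t w) (S.z t w)))
      (probFilter μ) (𝓝 (S.secondMoment P lam t)) := by
  have hz := S.measurable_z (hreg.measurable_b t)
  exact tendsto_empMean hD (measurable_onPattern 0
    ((S.measurable_r (hreg.measurable_b t) _).smul (hz.rankOne hz)))
    (he.integrable_secondMoment hreg t)

theorem Envelope.tendsto_crossMoment (he : S.Envelope P Θ θ₀ lam ρ G)
    (hreg : S.Regular P Θ θ₀ lam) (hD : IsIIDSample P μ D) (t : Fin K) :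
    Tendsto (fun x => empMean D x (onPattern 0
      fun w => S.r t (lam t) w • InnerProductSpace.rankOne ℝ (S.U θ₀ w) (S.z t w)))
      (probFilter μ) (𝓝 (S.crossMoment P θ₀ lam t)) := by
  have hz := S.measurable_z (hreg.measurable_b t)
  exact tendsto_empMean hD (measurable_onPattern 0
    ((S.measurable_r (hreg.measurable_b t) _).smul
      ((hreg.measurable_U θ₀ hreg.mem).rankOne hz)))
    (he.integrable_crossMoment hreg t)

theorem eq_comp_iff_eq_comp_inverse {m n : ℕ} {A : E m →L[ℝ] E m} (hA : A.IsInvertible)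
    {B C : E m →L[ℝ] E n} : C = B ∘L A ↔ B = C ∘L A.inverse := by
  obtain ⟨e, rfl⟩ := hA
  rw [ContinuousLinearMap.inverse_equiv]
  constructor
  · rintro rfl; ext1 v; simp
  · rintro rfl; ext1 v; simp

/-- Invertibility is an open condition, so the sample second moment operator inherits it from its
limit with probability tending to one. -/
theorem Envelope.eventually_isRegressionCoeff_iff (he : S.Envelope P Θ θ₀ lam ρ G)
    (hreg : S.Regular P Θ θ₀ lam) (hD : IsIIDSample P μ D) (t : Fin K) :
    ∀ᶠ x in probFilter μ, ∀ B, S.IsRegressionCoeff (path D x) x.1 θ₀ t (lam t) B ↔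
      B = empMean D x (onPattern 0
        fun w => S.r t (lam t) w • InnerProductSpace.rankOne ℝ (S.U θ₀ w) (S.z t w)) ∘L
        (empMean D x (onPattern 0 fun w => S.r t (lam t) w •
          InnerProductSpace.rankOne ℝ (S.z t w) (S.z t w))).inverse := by
  filter_upwards [eventually_fst_ne_zero, (he.tendsto_secondMoment hreg hD t).eventually
    (he.isInvertible_secondMoment hreg t).eventually_nhds] with x hx hinv B
  rw [isRegressionCoeff_iff hx, eq_comp_iff_eq_comp_inverse hinv]

theorem Envelope.existsUnique_isRegressionCoeff (he : S.Envelope P Θ θ₀ lam ρ G)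
    (hreg : S.Regular P Θ θ₀ lam) (hD : IsIIDSample P μ D) (t : Fin K) :
    ∀ᶠ x in probFilter μ, ∃! B, S.IsRegressionCoeff (path D x) x.1 θ₀ t (lam t) B := by
  filter_upwards [he.eventually_isRegressionCoeff_iff hreg hD t] with x hx
  exact ⟨_, (hx _).2 rfl, fun B hB => (hx B).1 hB⟩

theorem Envelope.tendsto_of_isRegressionCoeff (he : S.Envelope P Θ θ₀ lam ρ G)
    (hreg : S.Regular P Θ θ₀ lam) (hD : IsIIDSample P μ D) (t : Fin K)
    {B : ℕ × Ω → E (S.L t + 1) →L[ℝ] E q}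
    (hB : ∀ᶠ x in probFilter μ, S.IsRegressionCoeff (path D x) x.1 θ₀ t (lam t) (B x)) :
    Tendsto B (probFilter μ) (𝓝 (S.regCoeff P θ₀ lam t)) := by
  have hinv := (he.isInvertible_secondMoment hreg t).continuousAt_inverse.tendsto.comp
    (he.tendsto_secondMoment hreg hD t)
  refine Tendsto.congr' ?_ (Tendsto.comp
    (g := fun Y : (E (S.L t + 1) →L[ℝ] E q) × (E (S.L t + 1) →L[ℝ] E (S.L t + 1)) => Y.1 ∘L Y.2)
    (Continuous.tendsto (by fun_prop) _)
    ((he.tendsto_crossMoment hreg hD t).prodMk_nhds hinv))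
  filter_upwards [hB, he.eventually_isRegressionCoeff_iff hreg hD t] with x h1 h2
  exact ((h2 _).1 h1).symm

/-! ### The calibration equations -/

/-- The calibration score of pattern `t` at the true parameter. -/
def score (S : Design X p K q) (lam : (t : Fin K) → E (S.L t + 1)) (D : ℕ → Ω → Datum X p K)
    (t : Fin K) (x : ℕ × Ω) : E (S.L t + 1) :=
  ratio D x t • empMean D x (onPattern 0 fun w => S.r t (lam t) w • S.z t w) -
    empMean D x (onPattern t.succ (S.z t))

theorem Regular.memLp_onPattern_r_z (hreg : S.Regular P Θ θ₀ lam) (t : Fin K) :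
    MemLp (onPattern 0 fun w => S.r t (lam t) w • S.z t w) 2 P :=
  (memLp_onPattern_iff (hreg.pattern_pos 0)).2 (hreg.memLp_r_z t)

theorem tendsto_score (hD : IsIIDSample P μ D) (hreg : S.Regular P Θ θ₀ lam)
    (hmodel : S.DensityRatioModel P lam) (t : Fin K) :
    Tendsto (score S lam D t) (probFilter μ) (𝓝 0) := by
  have hz := S.measurable_z (hreg.measurable_b t)
  have hrz : Measurable fun w => S.r t (lam t) w • S.z t w :=
    (S.measurable_r (hreg.measurable_b t) (lam t)).smul hz
  have h1 := tendsto_empMean hD (measurable_onPattern 0 hrz)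
    ((hreg.memLp_onPattern_r_z t).integrable (by norm_num))
  have h2 := tendsto_empMean hD (measurable_onPattern t.succ hz)
    (hreg.integrable_onPattern_z hmodel t)
  have h3 := ((tendsto_ratio hD hreg t).smul h1).sub h2
  rwa [hreg.integral_onPattern_comp_z hmodel t (g := fun v => v) stronglyMeasurable_id,
    sub_self] at h3

theorem Envelope.boundedInProb_score (he : S.Envelope P Θ θ₀ lam ρ G) (hD : IsIIDSample P μ D)
    (hreg : S.Regular P Θ θ₀ lam)
    (hmodel : S.DensityRatioModel P lam) (t : Fin K) :
    BoundedInProb μ fun x => √(x.1 : ℝ) * ‖score S lam D t x‖ := by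
  have hz := S.measurable_z (hreg.measurable_b t)
  have hrz : Measurable fun w => S.r t (lam t) w • S.z t w :=
    (S.measurable_r (hreg.measurable_b t) (lam t)).smul hz
  -- The score is not a mean of i.i.d. terms, because of the random ratio. The vector `m` is the
  -- mean of `z_t` in pattern `t` and also, by the model, that of `r_t z_t` in the complete pattern,
  -- so subtracting it centres both parts.
  set m : E (S.L t + 1) := (P.real {d | d.2 = t.succ})⁻¹ • ∫ d, onPattern t.succ (S.z t) d ∂P
    with hm
  have hI1 : ∫ d, onPattern t.succ (fun w => S.z t w - m) d ∂P = 0 := by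
    simp only [onPattern_sub_const]
    rw [integral_sub (hreg.integrable_onPattern_z hmodel t)
      ((integrable_onPattern_of_integrable _ (integrable_const _)).smul_const _),
      integral_smul_const, integral_onPattern_one hreg, hm, smul_smul,
      mul_inv_cancel₀ (hreg.prob_pos _).ne', one_smul, sub_self]
  have hI0 : ∫ d, onPattern 0 (fun w => S.r t (lam t) w • S.z t w - m) d ∂P = 0 := by
    simp only [onPattern_sub_const]
    rw [integral_sub ((hreg.memLp_onPattern_r_z t).integrable (by norm_num))
      ((integrable_onPattern_of_integrable _ (integrable_const _)).smul_const _),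
      integral_smul_const, integral_onPattern_one hreg, hm,
      hreg.integral_onPattern_comp_z hmodel t (g := fun v => v) stronglyMeasurable_id,
      smul_smul, smul_smul, patternRatio]
    have h0 := (hreg.prob_pos 0).ne'
    have h1 := (hreg.prob_pos t.succ).ne'
    rw [show P.real {d | d.2 = 0} * (P.real {d | d.2 = t.succ})⁻¹ *
      (P.real {d | d.2 = t.succ} / P.real {d | d.2 = 0}) = 1 by field_simp, one_smul, sub_self]
  have hconst : ∀ s : Fin (K + 1), MemLp (onPattern s (fun _ : FullData X p => m)) 2 P :=
    fun s => memLp_onPattern_of_memLp s (memLp_const m)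
  have hL1 : MemLp (onPattern t.succ (fun w => S.z t w - m)) 2 P := by
    rw [show onPattern t.succ (fun w => S.z t w - m) = onPattern t.succ (S.z t) -
      onPattern t.succ (fun _ => m) from funext (onPattern_sub _ _ _)]
    exact (he.memLp_onPattern_z hreg hmodel t).sub (hconst t.succ)
  have hL0 : MemLp (onPattern 0 (fun w => S.r t (lam t) w • S.z t w - m)) 2 P := by
    rw [show onPattern 0 (fun w => S.r t (lam t) w • S.z t w - m) =
      onPattern 0 (fun w => S.r t (lam t) w • S.z t w) - onPattern 0 (fun _ => m) from
      funext (onPattern_sub _ _ _)]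
    exact (hreg.memLp_onPattern_r_z t).sub (hconst 0)
  have hB1 := boundedInProb_sqrt_mul_norm_empMean hD
    (measurable_onPattern t.succ (hz.sub_const m)) hL1 hI1
  have hB0 := boundedInProb_sqrt_mul_norm_empMean hD
    (measurable_onPattern 0 (hrz.sub_const m)) hL0 hI0
  refine ((boundedInProb_mul_of_tendsto (tendsto_ratio hD hreg t) hB0).add hB1).of_abs_le
    (c := 1) ?_
  filter_upwards [eventually_fst_ne_zero, (tendsto_empMean_onPattern_one hD hreg 0).eventually_ne
    (hreg.prob_pos 0).ne'] with x hx hx0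
  have hk := ratio_nonneg D x t
  have hs : 0 ≤ √(x.1 : ℝ) := Real.sqrt_nonneg _
  have e : ∀ (s : Fin (K + 1)) (f : FullData X p → E (S.L t + 1)),
      empMean D x (onPattern s fun w => f w - m) = empMean D x (onPattern s f) -
        empMean D x (onPattern s fun _ => (1 : ℝ)) • m := by
    intro s f
    rw [← empMean_smul_const, ← empMean_sub]
    exact congrArg _ (funext (onPattern_sub_const s f m))
  -- Recentring leaves the score unchanged: the two multiples of `m` have coefficients `(N_t / N₁)
  -- (N₁ / N)` and `N_t / N`, and cancel.
  have hscore : score S lam D t x =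
      ratio D x t • empMean D x (onPattern 0 fun w => S.r t (lam t) w • S.z t w - m) -
        empMean D x (onPattern t.succ fun w => S.z t w - m) := by
    rw [e, e, smul_sub, smul_smul, ratio_eq D x hx t, div_mul_cancel₀ _ hx0, score,
      ratio_eq D x hx t]
    abel
  rw [one_mul, abs_of_nonneg (by positivity), abs_of_nonneg (by positivity), hscore]
  calc _ ≤ √(x.1 : ℝ) * (ratio D x t *
        ‖empMean D x (onPattern 0 fun w => S.r t (lam t) w • S.z t w - m)‖ +
        ‖empMean D x (onPattern t.succ fun w => S.z t w - m)‖) := by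
        refine mul_le_mul_of_nonneg_left ((norm_sub_le _ _).trans ?_) hs
        rw [norm_smul, Real.norm_of_nonneg hk]
    _ = _ := by ring

end Asymptotics

end Design

namespace Design

/-! ### Rate of the calibrated parameters and expansion of the density ratios -/

section Calibration

variable {X : Type*} [MeasurableSpace X] {p K q : ℕ} {S : Design X p K q}
  {P : Measure (Datum X p K)} {Θ : Set (E q)} {θ₀ : E q}
  {lam : (t : Fin K) → E (S.L t + 1)} {ρ : ℝ} {G : FullData X p → ℝ}
  {Ω : Type*} [MeasurableSpace Ω] {μ : Measure Ω} {D : ℕ → Ω → Datum X p K}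

omit [MeasurableSpace X] [MeasurableSpace Ω] in
/-- Monotonicity of the calibration equations. -/
theorem IsCalibrated.ratio_mul_inner_le {t : Fin K} {x : ℕ × Ω} {φ : E (S.L t + 1)}
    (h : S.IsCalibrated (path D x) x.1 t φ) :
    ratio D x t * inner ℝ (φ - lam t) (empMean D x (onPattern 0 fun w =>
      (S.r t (lam t) w / (1 + ‖S.z t w‖)) • InnerProductSpace.rankOne ℝ (S.z t w) (S.z t w))
        (φ - lam t)) ≤
      ‖score S lam D t x‖ * ‖φ - lam t‖ * (1 + ‖φ - lam t‖) := by
  set u := φ - lam t with hu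
  let L : (E (S.L t + 1) →L[ℝ] E (S.L t + 1)) →L[ℝ] ℝ :=
    (innerSL ℝ u).comp (ContinuousLinearMap.apply ℝ _ u)
  have h1 : inner ℝ u (empMean D x (onPattern 0 fun w => (S.r t (lam t) w / (1 + ‖S.z t w‖)) •
      InnerProductSpace.rankOne ℝ (S.z t w) (S.z t w)) u) =
      empMean D x (onPattern 0 fun w =>
        S.r t (lam t) w / (1 + ‖S.z t w‖) * inner ℝ u (S.z t w) ^ 2) := by
    have hL : ∀ M, L M = inner ℝ u (M u) := fun _ => rfl
    rw [← hL, map_empMean]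
    refine congrArg _ (funext fun d => ?_)
    rw [map_onPattern]
    refine congrArg (onPattern 0 · d) (funext fun w => ?_)
    simp only [L, ContinuousLinearMap.comp_apply, ContinuousLinearMap.apply_apply,
      _root_.smul_apply, InnerProductSpace.rankOne_apply, innerSL_apply_apply,
      inner_smul_right, real_inner_comm]
    ring
  -- The calibration equation, with the score subtracted, is tested against the direction `u`.
  have h2 : ratio D x t * empMean D x (onPattern 0 fun w =>
      (S.r t φ w - S.r t (lam t) w) * inner ℝ u (S.z t w)) = -inner ℝ u (score S lam D t x) := by
    rw [score, ← h.ratio_smul, ← smul_sub, ← empMean_sub, inner_smul_right, ← mul_neg,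
      ← inner_neg_right]
    congr 1
    rw [show ∀ v, inner ℝ u (-v) = -(innerSL ℝ u) v from fun v => inner_neg_right _ _, map_empMean,
      ← neg_one_smul ℝ, ← empMean_const_smul]
    refine congrArg _ (funext fun d => ?_)
    rw [← onPattern_sub, map_onPattern, ← onPattern_const_smul]
    refine congrArg (onPattern 0 · d) (funext fun w => ?_)
    rw [← sub_smul, map_smul, smul_eq_mul, smul_eq_mul, innerSL_apply_apply]
    ring
  -- Pointwise, `s ^ 2 / (1 + |s|)` bounds `(exp s - 1) * s` from below. The estimate `1 + |s| ≤ (1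
  -- + ‖u‖) * (1 + ‖z‖)` then separates the unknown `u` from the data.
  have h3 : empMean D x (onPattern 0 fun w =>
      S.r t (lam t) w / (1 + ‖S.z t w‖) * inner ℝ u (S.z t w) ^ 2) ≤
      (1 + ‖u‖) * empMean D x (onPattern 0 fun w =>
        (S.r t φ w - S.r t (lam t) w) * inner ℝ u (S.z t w)) := by
    rw [← smul_eq_mul, ← empMean_const_smul]
    refine empMean_mono D x fun d => ?_
    rw [← onPattern_const_smul]
    unfold onPattern
    split_ifs
    swap
    · exact le_rfl
    generalize d.1 = w
    beta_reduce
    set s : ℝ := inner ℝ u (S.z t w) with hs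
    have hr := S.r_pos t (lam t) w
    have hz := norm_nonneg (S.z t w)
    have hun := norm_nonneg u
    have hsle : 1 + |s| ≤ (1 + ‖u‖) * (1 + ‖S.z t w‖) := by
      have := abs_real_inner_le_norm u (S.z t w)
      nlinarith
    have hpsi := sq_div_one_add_abs_le s
    rw [div_le_iff₀ (by positivity)] at hpsi
    have hnn : 0 ≤ (Real.exp s - 1) * s :=
      (div_nonneg (sq_nonneg s) (by positivity)).trans (sq_div_one_add_abs_le s)
    rw [r_eq_mul_exp t φ (lam t) w, ← hu, ← hs, smul_eq_mul, div_mul_eq_mul_div,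
      div_le_iff₀ (by positivity)]
    calc S.r t (lam t) w * s ^ 2
        ≤ S.r t (lam t) w * ((Real.exp s - 1) * s * ((1 + ‖u‖) * (1 + ‖S.z t w‖))) :=
          mul_le_mul_of_nonneg_left (hpsi.trans (mul_le_mul_of_nonneg_left hsle hnn)) hr.le
      _ = _ := by ring
  have h4 : -inner ℝ u (score S lam D t x) ≤ ‖score S lam D t x‖ * ‖u‖ := by
    rw [mul_comm]
    exact (neg_le_abs _).trans (abs_real_inner_le_norm _ _)
  rw [h1]
  calc _ ≤ ratio D x t * ((1 + ‖u‖) * empMean D x (onPattern 0 fun w =>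
        (S.r t φ w - S.r t (lam t) w) * inner ℝ u (S.z t w))) :=
        mul_le_mul_of_nonneg_left h3 (ratio_nonneg D x t)
    _ = (-inner ℝ u (score S lam D t x)) * (1 + ‖u‖) := by rw [← h2]; ring
    _ ≤ _ := mul_le_mul_of_nonneg_right h4 (by positivity)

variable [IsProbabilityMeasure P] [IsProbabilityMeasure μ]

/-- The second moment operator with weight `r / (1 + ‖z‖)` has a positive definite limit.
Monotonicity therefore gives `κ ‖u‖² ≤ ‖score‖ ‖u‖ (1 + ‖u‖)` for `u = φ - lam t`. Once the score is
at most `κ / 2`, the quadratic term on the right is absorbed. Consistency of `φ` is a consequence,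
not an assumption. -/
theorem Envelope.norm_calibrated_sub_le (he : S.Envelope P Θ θ₀ lam ρ G)
    (hreg : S.Regular P Θ θ₀ lam) (hmodel : S.DensityRatioModel P lam) (hD : IsIIDSample P μ D)
    {t : Fin K} {φ : ℕ × Ω → E (S.L t + 1)}
    (hφ : ∀ᶠ x in probFilter μ, S.IsCalibrated (path D x) x.1 t (φ x)) :
    ∃ C, 0 ≤ C ∧ ∀ᶠ x in probFilter μ, ‖φ x - lam t‖ ≤ C * ‖score S lam D t x‖ := by
  have hz := S.measurable_z (hreg.measurable_b t)
  set A : FullData X p → E (S.L t + 1) →L[ℝ] E (S.L t + 1) := fun w =>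
    (S.r t (lam t) w / (1 + ‖S.z t w‖)) • InnerProductSpace.rankOne ℝ (S.z t w) (S.z t w) with hA
  have hAm : Measurable A := by
    have h1 : Measurable fun w => S.r t (lam t) w / (1 + ‖S.z t w‖) :=
      (S.measurable_r (hreg.measurable_b t) _).div (measurable_const.add hz.norm)
    exact h1.smul (hz.rankOne hz)
  have hAint : Integrable (onPattern 0 A) P := by
    refine he.integrable_onPattern hreg t hAm zero_le_one fun w => ?_
    have hr := S.r_pos t (lam t) w
    have hzn := norm_nonneg (S.z t w)
    have hG := he.G_nonneg hreg w
    rw [hA, norm_smul, InnerProductSpace.norm_rankOne, Real.norm_of_nonneg (by positivity),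
      div_mul_eq_mul_div, div_le_iff₀ (by positivity), one_mul, mul_assoc, mul_assoc]
    refine mul_le_mul_of_nonneg_left ?_ hr.le
    have h2 : ‖S.z t w‖ * ‖S.z t w‖ ≤ (1 + ‖S.z t w‖) ^ 3 := by
      nlinarith [sq_nonneg ‖S.z t w‖, mul_nonneg hzn (sq_nonneg ‖S.z t w‖)]
    have h3 : 0 ≤ (1 + ‖S.z t w‖) ^ 3 := by positivity
    nlinarith [mul_nonneg h3 (mul_nonneg hG hzn), mul_nonneg h3 hG, mul_nonneg h3 hzn]
  obtain ⟨c, hc, hcle⟩ := ContinuousLinearMap.exists_mul_sq_le_inner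
    (hreg.inner_integral_pos (t := t) (c := fun w => S.r t (lam t) w / (1 + ‖S.z t w‖))
      (fun w => div_pos (S.r_pos _ _ _) (by positivity)) hAint)
  have hlim := tendsto_iff_norm_sub_tendsto_zero.1
    (tendsto_empMean hD (measurable_onPattern 0 hAm) hAint)
  have hk := hreg.patternRatio_pos t
  -- Half of each limit is given up to pass to the sample ratio and the sample operator.
  set κ := patternRatio P t / 2 * (c / 2) with hκ
  have hκ0 : 0 < κ := by positivity
  have hg := (tendsto_score hD hreg hmodel t).norm
  rw [norm_zero] at hg
  refine ⟨2 / κ, by positivity, ?_⟩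
  filter_upwards [hφ, hlim.eventually_le_const (half_pos hc),
    (tendsto_ratio hD hreg t).eventually_const_le (half_lt_self hk),
    hg.eventually_le_const (half_pos hκ0)] with x h1 h2 h3 h4
  have hmono := h1.ratio_mul_inner_le (lam := lam)
  set u := φ x - lam t with hu
  set gn := ‖score S lam D t x‖ with hgn
  have hgn0 : 0 ≤ gn := norm_nonneg _
  set M := empMean D x (onPattern 0 A) with hM
  have hinner : c / 2 * ‖u‖ ^ 2 ≤ inner ℝ u (M u) := by
    have e : inner ℝ u (M u) = inner ℝ u ((∫ d, onPattern 0 A d ∂P) u) +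
        inner ℝ u ((M - ∫ d, onPattern 0 A d ∂P) u) := by
      rw [← inner_add_right, _root_.sub_apply]; congr 1; abel
    have h5 : |inner ℝ u ((M - ∫ d, onPattern 0 A d ∂P) u)| ≤ c / 2 * ‖u‖ ^ 2 :=
      calc _ ≤ ‖u‖ * ‖(M - ∫ d, onPattern 0 A d ∂P) u‖ := abs_real_inner_le_norm _ _
        _ ≤ ‖u‖ * (c / 2 * ‖u‖) := by
          refine mul_le_mul_of_nonneg_left ((ContinuousLinearMap.le_opNorm _ _).trans ?_)
            (norm_nonneg _)
          exact mul_le_mul_of_nonneg_right h2 (norm_nonneg _)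
        _ = _ := by ring
    have h6 := hcle u
    have h7 := neg_abs_le (inner ℝ u ((M - ∫ d, onPattern 0 A d ∂P) u))
    rw [e]
    linarith
  have h8 : κ * ‖u‖ ^ 2 ≤ gn * ‖u‖ * (1 + ‖u‖) :=
    calc _ = patternRatio P t / 2 * (c / 2 * ‖u‖ ^ 2) := by rw [hκ]; ring
      _ ≤ ratio D x t * inner ℝ u (M u) :=
        mul_le_mul h3 hinner (by positivity) (ratio_nonneg D x t)
      _ ≤ _ := hmono
  rw [div_mul_eq_mul_div, le_div_iff₀ hκ0]
  rcases (norm_nonneg u).eq_or_lt with h0 | h0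
  · rw [← h0]; simp [hgn0]
  · have h9 : κ * ‖u‖ ≤ gn * (1 + ‖u‖) := by
      refine le_of_mul_le_mul_right ?_ h0
      linarith
    have h10 : gn * ‖u‖ ≤ κ / 2 * ‖u‖ := mul_le_mul_of_nonneg_right h4 h0.le
    linarith

theorem tendsto_of_norm_sub_le_score
    (hreg : S.Regular P Θ θ₀ lam) (hmodel : S.DensityRatioModel P lam) (hD : IsIIDSample P μ D)
    {t : Fin K} {φ : ℕ × Ω → E (S.L t + 1)} {C : ℝ}
    (hφ : ∀ᶠ x in probFilter μ, ‖φ x - lam t‖ ≤ C * ‖score S lam D t x‖) :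
    Tendsto φ (probFilter μ) (𝓝 (lam t)) := by
  rw [tendsto_iff_norm_sub_tendsto_zero]
  have h := (tendsto_score hD hreg hmodel t).norm.const_mul C
  rw [norm_zero, mul_zero] at h
  exact squeeze_zero' (Eventually.of_forall fun _ => norm_nonneg _) hφ h

/-! ### Expansion in the parameter of the density ratio -/

omit [IsProbabilityMeasure P] [IsProbabilityMeasure μ] [MeasurableSpace Ω] in
-- A deterministic bound, uniform in `f`. It is used for `f = U(θ)` with `c = 1`, and for increments
-- `U(θ) - U(θ₀)` with `c = ‖θ - θ₀‖`.
theorem Envelope.exists_norm_empMean_r_sub_le (he : S.Envelope P Θ θ₀ lam ρ G)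
    (hreg : S.Regular P Θ θ₀ lam) (D : ℕ → Ω → Datum X p K) :
    ∃ C, 0 < C ∧ ∀ (x : ℕ × Ω) (t : Fin K) (φ : E (S.L t + 1)), ‖φ - lam t‖ ≤ ρ / 2 →
      ∀ (f : FullData X p → E q) (c : ℝ), 0 ≤ c → (∀ w, ‖f w‖ ≤ c * (1 + G w)) →
      ‖empMean D x (onPattern 0 fun w => S.r t φ w • f w) -
        empMean D x (onPattern 0 fun w => S.r t (lam t) w • f w)‖ ≤
      C * ‖φ - lam t‖ * empMean D x (onPattern 0 (S.env lam ρ G t)) * c := by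
  obtain ⟨C, hC, hb⟩ := he.exists_bounds hreg
  refine ⟨C, hC, fun x t φ hφ f c hc hf => ?_⟩
  rw [← empMean_sub]
  have h1 : ∀ d : Datum X p K, ‖onPattern 0 (fun w => S.r t φ w • f w) d -
      onPattern 0 (fun w => S.r t (lam t) w • f w) d‖ ≤
      (C * ‖φ - lam t‖ * c) • onPattern 0 (S.env lam ρ G t) d := by
    intro d
    rw [← onPattern_sub, ← onPattern_const_smul]
    refine norm_onPattern_le 0 (fun w => ?_) d
    rw [← sub_smul, norm_smul, Real.norm_eq_abs, smul_eq_mul]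
    calc _ ≤ |S.r t φ w - S.r t (lam t) w| * (c * (1 + G w)) :=
          mul_le_mul_of_nonneg_left (hf w) (abs_nonneg _)
      _ = |S.r t φ w - S.r t (lam t) w| * (1 + G w) * c := by ring
      _ ≤ C * ‖φ - lam t‖ * S.env lam ρ G t w * c :=
          mul_le_mul_of_nonneg_right ((hb t w).2 φ hφ).1 hc
      _ = _ := by ring
  refine (norm_empMean_le D x h1).trans (le_of_eq ?_)
  rw [empMean_const_smul, smul_eq_mul]
  ring

theorem Envelope.tendsto_empMean_env (he : S.Envelope P Θ θ₀ lam ρ G)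
    (hreg : S.Regular P Θ θ₀ lam) (hD : IsIIDSample P μ D) (t : Fin K) :
    Tendsto (fun x => empMean D x (onPattern 0 (S.env lam ρ G t))) (probFilter μ)
      (𝓝 (∫ d, onPattern 0 (S.env lam ρ G t) d ∂P)) := by
  have hz := S.measurable_z (hreg.measurable_b t)
  refine tendsto_empMean hD (measurable_onPattern 0 ?_) (he.integrable_onPattern_env hreg t)
  have h1 : Measurable fun w =>
      Real.exp (inner ℝ (lam t) (S.z t w) + ρ * ‖S.z t w‖) := by fun_prop
  exact h1.mul (he.measurable_G.const_add 1)

omit [IsProbabilityMeasure P] [IsProbabilityMeasure μ] in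
theorem Envelope.eventually_norm_sub_le (he : S.Envelope P Θ θ₀ lam ρ G) {t : Fin K}
    {φ : ℕ × Ω → E (S.L t + 1)} (hφ : Tendsto φ (probFilter μ) (𝓝 (lam t))) :
    ∀ᶠ x in probFilter μ, ‖φ x - lam t‖ ≤ ρ / 2 :=
  (tendsto_iff_norm_sub_tendsto_zero.1 hφ).eventually_le_const (half_pos he.pos)

/-- Estimating the density ratio has no first order effect on the mean of the residuals. -/
theorem Envelope.exists_norm_empMean_resid_le (he : S.Envelope P Θ θ₀ lam ρ G)
    (hreg : S.Regular P Θ θ₀ lam) (hD : IsIIDSample P μ D) {t : Fin K}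
    {φ : ℕ × Ω → E (S.L t + 1)} (hφ : Tendsto φ (probFilter μ) (𝓝 (lam t))) :
    ∃ a : ℕ × Ω → ℝ, Tendsto a (probFilter μ) (𝓝 0) ∧ ∀ᶠ x in probFilter μ,
      ‖ratio D x t • (empMean D x (onPattern 0 fun w => S.r t (φ x) w • S.resid P θ₀ lam t w) -
        empMean D x (onPattern 0 fun w => S.r t (lam t) w • S.resid P θ₀ lam t w))‖ ≤
      a x * ‖φ x - lam t‖ := by
  obtain ⟨C, hC, hb⟩ := he.exists_bounds hreg
  have hz := S.measurable_z (hreg.measurable_b t)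
  set B := 1 + ‖S.regCoeff P θ₀ lam t‖ with hB
  have hB0 : 0 ≤ B := by positivity
  set Q : FullData X p → E (S.L t + 1) →L[ℝ] E q := fun w => S.r t (lam t) w •
    InnerProductSpace.rankOne ℝ (S.resid P θ₀ lam t w) (S.z t w) with hQ
  have hQm : Measurable Q :=
    (S.measurable_r (hreg.measurable_b t) _).smul ((hreg.measurable_resid t).rankOne hz)
  have hQlim := tendsto_empMean hD (measurable_onPattern 0 hQm)
    (he.integrable_r_rankOne_resid hreg t)
  -- `Q` is the coefficient of the first order term in `φ`; the normal equations make its mean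
  -- vanish in the limit.
  rw [he.integral_r_rankOne_resid hreg t] at hQlim
  have hlim := (tendsto_ratio hD hreg t).mul (hQlim.norm.add
    (((tendsto_iff_norm_sub_tendsto_zero.1 hφ).const_mul (B * C)).mul
      (he.tendsto_empMean_env hreg hD t)))
  simp only [norm_zero, mul_zero, zero_mul, add_zero] at hlim
  refine ⟨_, hlim, ?_⟩
  filter_upwards [he.eventually_norm_sub_le hφ] with x hx
  set u := φ x - lam t with hu
  have e : empMean D x (onPattern 0 fun w => S.r t (φ x) w • S.resid P θ₀ lam t w) -
      empMean D x (onPattern 0 fun w => S.r t (lam t) w • S.resid P θ₀ lam t w) =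
      empMean D x (onPattern 0 Q) u + empMean D x (onPattern 0 fun w =>
        (S.r t (φ x) w - S.r t (lam t) w - S.r t (lam t) w * inner ℝ u (S.z t w)) •
          S.resid P θ₀ lam t w) := by
    have hL : ∀ M : E (S.L t + 1) →L[ℝ] E q, M u = ContinuousLinearMap.apply ℝ (E q) u M :=
      fun _ => rfl
    rw [hL (empMean D x (onPattern 0 Q)), map_empMean, ← empMean_sub, ← empMean_add]
    refine congrArg _ (funext fun d => ?_)
    rw [map_onPattern, ← onPattern_sub, ← onPattern_add]
    refine congrArg (onPattern 0 · d) (funext fun w => ?_)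
    simp only [hQ, ContinuousLinearMap.apply_apply, _root_.smul_apply,
      InnerProductSpace.rankOne_apply, smul_smul, ← sub_smul, ← add_smul,
      real_inner_comm u]
    congr 1; ring
  have h2 : ‖empMean D x (onPattern 0 fun w =>
        (S.r t (φ x) w - S.r t (lam t) w - S.r t (lam t) w * inner ℝ u (S.z t w)) •
          S.resid P θ₀ lam t w)‖ ≤
      (B * C * ‖u‖ ^ 2) * empMean D x (onPattern 0 (S.env lam ρ G t)) := by
    rw [← smul_eq_mul, ← empMean_const_smul]
    refine norm_empMean_le D x fun d => ?_
    rw [← onPattern_const_smul]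
    refine norm_onPattern_le 0 (fun w => ?_) d
    rw [norm_smul, Real.norm_eq_abs, smul_eq_mul]
    calc _ ≤ |S.r t (φ x) w - S.r t (lam t) w - S.r t (lam t) w * inner ℝ u (S.z t w)| *
          (B * ((1 + ‖S.z t w‖) * (1 + G w))) :=
          mul_le_mul_of_nonneg_left (he.norm_resid_le hreg t w) (abs_nonneg _)
      _ = B * (|S.r t (φ x) w - S.r t (lam t) w - S.r t (lam t) w * inner ℝ u (S.z t w)| *
          ((1 + ‖S.z t w‖) * (1 + G w))) := by ring
      _ ≤ B * (C * ‖u‖ ^ 2 * S.env lam ρ G t w) :=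
          mul_le_mul_of_nonneg_left ((hb t w).2 (φ x) hx).2 hB0
      _ = _ := by ring
  rw [norm_smul, Real.norm_of_nonneg (ratio_nonneg D x t), e, mul_assoc]
  refine mul_le_mul_of_nonneg_left ((norm_add_le _ _).trans ?_) (ratio_nonneg D x t)
  calc _ ≤ ‖empMean D x (onPattern 0 Q)‖ * ‖u‖ +
        (B * C * ‖u‖ ^ 2) * empMean D x (onPattern 0 (S.env lam ρ G t)) :=
        add_le_add (ContinuousLinearMap.le_opNorm _ _) h2
    _ = _ := by ring

end Calibration

end Design

namespace Design

section Estimator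

variable {X : Type*} [MeasurableSpace X] {p K q : ℕ} {S : Design X p K q}
  {P : Measure (Datum X p K)} {Θ : Set (E q)} {θ₀ : E q}
  {lam : (t : Fin K) → E (S.L t + 1)} {ρ : ℝ} {G : FullData X p → ℝ}
  {Ω : Type*} [MeasurableSpace Ω] {μ : Measure Ω} [IsProbabilityMeasure μ]
  {D : ℕ → Ω → Datum X p K}

/-! ### Consistency -/

theorem Envelope.uniform_lln (he : S.Envelope P Θ θ₀ lam ρ G)
    (hreg : S.Regular P Θ θ₀ lam) (hD : IsIIDSample P μ D) {c : FullData X p → ℝ}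
    (hc : ∀ w, 0 ≤ c w) (hcm : Measurable c)
    (hint : Integrable (onPattern 0 fun w => c w * G w) P) :
    ContinuousOn (fun θ => ∫ d, onPattern 0 (fun w => c w • S.U θ w) d ∂P) Θ ∧
      ∃ ε : ℕ × Ω → ℝ, Tendsto ε (probFilter μ) (𝓝 0) ∧ ∀ x, ∀ θ ∈ Θ,
        ‖empMean D x (onPattern 0 fun w => c w • S.U θ w) -
          ∫ d, onPattern 0 (fun w => c w • S.U θ w) d ∂P‖ ≤ ε x := by
  refine exists_norm_empMean_sub_integral_le hD hreg.isCompact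
    (fun θ hθ => hreg.measurable_onPattern_smul_U hθ 0 hcm) (fun d => ?_) hint
    (fun θ hθ d => norm_onPattern_le 0 (fun w => ?_) d)
  · unfold onPattern
    split_ifs
    · exact (hreg.continuousOn_U d.1).const_smul (c d.1)
    · exact continuousOn_const
  · rw [norm_smul, Real.norm_of_nonneg (hc w)]
    exact mul_le_mul_of_nonneg_left (he.norm_U_le w θ hθ) (hc w)

theorem Envelope.exists_norm_empMean_smul_U_sub_linear_le (he : S.Envelope P Θ θ₀ lam ρ G)
    (hreg : S.Regular P Θ θ₀ lam) (hD : IsIIDSample P μ D) {c : FullData X p → ℝ}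
    (hc : ∀ w, 0 ≤ c w) (hcm : Measurable c)
    (hint : Integrable (onPattern 0 fun w => c w * G w) P)
    {θ : ℕ × Ω → E q} (hθ : Tendsto θ (probFilter μ) (𝓝 θ₀)) :
    ∃ a : ℕ × Ω → ℝ, Tendsto a (probFilter μ) (𝓝 0) ∧ ∀ᶠ x in probFilter μ,
      ‖empMean D x (onPattern 0 fun w => c w • S.U (θ x) w) -
        empMean D x (onPattern 0 fun w => c w • S.U θ₀ w) -
        (∫ d, onPattern 0 (fun w => c w • fderiv ℝ (fun θ => S.U θ w) θ₀) d ∂P) (θ x - θ₀)‖ ≤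
      a x * ‖θ x - θ₀‖ := by
  obtain ⟨ρ', hρ', h1, h2⟩ := he.exists_ball hreg
  have h := exists_norm_empMean_sub_linear_le hD
    (f := fun θ => onPattern 0 (fun w => c w • S.U θ w)) hρ'
    (fun θ hθ => hreg.measurable_onPattern_smul_U (interior_subset (h1 hθ)) 0 hcm)
    (fun d θ hθ => (hreg.hasFDerivAt_onPattern (h1 hθ) 0 c d).differentiableAt)
    (fun d θ hθ => he.norm_fderiv_onPattern_le hreg 0 hc d (h1 hθ) (h2 hθ)) hint hθ
  simpa only [(hreg.hasFDerivAt_onPattern hreg.mem_interior 0 c _).fderiv] using h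

variable [IsProbabilityMeasure P]

/-- Three replacements, each uniform on `Θ`: the estimated density ratio by the true one, the
empirical mean by the expectation, and `N_t / N₁` by its limit. The last uses that the expectation
is bounded on the compact set. -/
theorem Envelope.uniform_lln_calibrated (he : S.Envelope P Θ θ₀ lam ρ G)
    (hreg : S.Regular P Θ θ₀ lam) (hD : IsIIDSample P μ D) {t : Fin K}
    {φ : ℕ × Ω → E (S.L t + 1)} (hφ : Tendsto φ (probFilter μ) (𝓝 (lam t))) :
    ∃ ε : ℕ × Ω → ℝ, Tendsto ε (probFilter μ) (𝓝 0) ∧ ∀ᶠ x in probFilter μ, ∀ θ ∈ Θ,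
        ‖ratio D x t • empMean D x (onPattern 0 fun w => S.r t (φ x) w • S.U θ w) -
          patternRatio P t •
            ∫ d, onPattern 0 (fun w => S.r t (lam t) w • S.U θ w) d ∂P‖ ≤ ε x := by
  obtain ⟨C, hC, hbound⟩ := he.exists_norm_empMean_r_sub_le hreg D
  obtain ⟨hcont, ε, hε, hle⟩ := he.uniform_lln hreg hD (fun w => (S.r_pos t (lam t) w).le)
    (S.measurable_r (hreg.measurable_b t) _) (he.integrable_r_G hreg t)
  obtain ⟨J, hJ⟩ := hreg.isCompact.exists_bound_of_continuousOn hcont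
  have hk := tendsto_ratio hD hreg t
  have hlim := ((hk.mul ((((tendsto_iff_norm_sub_tendsto_zero.1 hφ).const_mul C).mul
    (he.tendsto_empMean_env hreg hD t)).add hε))).add
      ((tendsto_iff_norm_sub_tendsto_zero.1 hk).mul_const J)
  simp only [mul_zero, zero_mul, add_zero] at hlim
  refine ⟨_, hlim, ?_⟩
  filter_upwards [he.eventually_norm_sub_le hφ] with x hx θ hθ
  have h1 := hbound x t (φ x) hx (S.U θ) 1 zero_le_one fun w => by
    linarith [he.norm_U_le w θ hθ]
  have h2 := hle x θ hθ
  have h3 := hJ θ hθ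
  set A := empMean D x (onPattern 0 fun w => S.r t (φ x) w • S.U θ w)
  set B := empMean D x (onPattern 0 fun w => S.r t (lam t) w • S.U θ w)
  set I := ∫ d, onPattern 0 (fun w => S.r t (lam t) w • S.U θ w) d ∂P
  have e : ratio D x t • A - patternRatio P t • I =
      ratio D x t • ((A - B) + (B - I)) + (ratio D x t - patternRatio P t) • I := by
    module
  rw [e]
  refine (norm_add_le _ _).trans (add_le_add ?_ ?_)
  · rw [norm_smul, Real.norm_of_nonneg (ratio_nonneg D x t)]
    refine mul_le_mul_of_nonneg_left ((norm_add_le _ _).trans (add_le_add ?_ h2))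
      (ratio_nonneg D x t)
    rwa [mul_one] at h1
  · rw [norm_smul]
    exact mul_le_mul_of_nonneg_left h3 (norm_nonneg _)

/-- The estimating function vanishes at the estimator and is uniformly close to `E U`, so `E U` at
the estimator tends to zero; compactness and uniqueness of the root conclude. -/
theorem Envelope.tendsto_estimator (he : S.Envelope P Θ θ₀ lam ρ G)
    (hreg : S.Regular P Θ θ₀ lam) (hmodel : S.DensityRatioModel P lam) (hmar : S.ReducedMAR P Θ)
    (hD : IsIIDSample P μ D) {φ : ℕ × Ω → (t : Fin K) → E (S.L t + 1)}
    (hφ : ∀ t, Tendsto (fun x => φ x t) (probFilter μ) (𝓝 (lam t))) {θ : ℕ × Ω → E q}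
    (hθ : ∀ᶠ x in probFilter μ, θ x ∈ Θ ∧ S.USPS (path D x) x.1 (φ x) (θ x) = 0) :
    Tendsto θ (probFilter μ) (𝓝 θ₀) := by
  have hG0 : Integrable (onPattern 0 fun w => 1 * G w) P :=
    integrable_onPattern_of_integrable 0 (by simpa using he.integrable_G)
  obtain ⟨hcont0, ε0, hε0, hle0⟩ := he.uniform_lln hreg hD (c := fun _ => 1)
    (fun _ => zero_le_one) measurable_const hG0
  simp only [one_smul] at hcont0 hle0
  choose ε hε hle using fun t => he.uniform_lln_calibrated hreg hD (hφ t)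
  have hcont : ContinuousOn (fun θ => ∫ d, S.U θ d.1 ∂P) Θ := by
    refine ContinuousOn.congr (hcont0.add (continuousOn_finsetSum Finset.univ fun t _ =>
      ((he.uniform_lln hreg hD (fun w => (S.r_pos t (lam t) w).le)
      (S.measurable_r (hreg.measurable_b t) _) (he.integrable_r_G hreg t)).1.const_smul
        (patternRatio P t)))) fun θ hθ => ?_
    exact he.integral_U_eq hreg hmodel hmar hθ
  refine hreg.isCompact.tendsto_of_tendsto_unique_zero hcont
    (fun θ hθ => (hreg.identified θ hθ).1) (hθ.mono fun x hx => hx.1) ?_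
  have hlim := hε0.add (tendsto_finsetSum Finset.univ fun t _ => hε t)
  simp only [Finset.sum_const_zero, add_zero] at hlim
  refine squeeze_zero_norm' ?_ hlim
  filter_upwards [hθ, eventually_all.2 hle] with x hx hlex
  have e := S.USPS_eq D x (φ x) (θ x)
  rw [hx.2] at e
  rw [he.integral_U_eq hreg hmodel hmar hx.1, ← norm_neg]
  calc _ = ‖(empMean D x (onPattern 0 (S.U (θ x))) - ∫ d, onPattern 0 (S.U (θ x)) d ∂P) +
        ∑ t, (ratio D x t • empMean D x (onPattern 0 fun w => S.r t (φ x t) w • S.U (θ x) w) -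
          patternRatio P t • ∫ d, onPattern 0 (fun w => S.r t (lam t) w • S.U (θ x) w) d ∂P)‖ := by
        congr 1
        rw [Finset.sum_sub_distrib, ← zero_sub]
        nth_rewrite 1 [e]
        abel
    _ ≤ _ := (norm_add_le _ _).trans (add_le_add (hle0 x _ hx.1)
        (norm_sum_le_of_le _ fun t _ => hlex t _ hx.1))

/-! ### Expansion in the parameter of the estimating function -/

/-- The error in the density ratio meets only the increment `U(θ) - U(θ₀)`, which is itself bounded
by `‖θ - θ₀‖ (1 + G)`. Consistency of `φ` thus suffices here; its rate plays no role. -/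
theorem Envelope.exists_norm_calibrated_sub_linear_le (he : S.Envelope P Θ θ₀ lam ρ G)
    (hreg : S.Regular P Θ θ₀ lam) (hD : IsIIDSample P μ D) {t : Fin K}
    {φ : ℕ × Ω → E (S.L t + 1)} (hφ : Tendsto φ (probFilter μ) (𝓝 (lam t)))
    {θ : ℕ × Ω → E q} (hθ : Tendsto θ (probFilter μ) (𝓝 θ₀)) :
    ∃ a : ℕ × Ω → ℝ, Tendsto a (probFilter μ) (𝓝 0) ∧ ∀ᶠ x in probFilter μ,
      ‖ratio D x t • empMean D x (onPattern 0 fun w => S.r t (φ x) w • S.U (θ x) w) -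
        ratio D x t • empMean D x (onPattern 0 fun w => S.r t (φ x) w • S.U θ₀ w) -
        (patternRatio P t • ∫ d, onPattern 0
          (fun w => S.r t (lam t) w • fderiv ℝ (fun θ => S.U θ w) θ₀) d ∂P) (θ x - θ₀)‖ ≤
      a x * ‖θ x - θ₀‖ := by
  obtain ⟨C, hC, hbound⟩ := he.exists_norm_empMean_r_sub_le hreg D
  obtain ⟨a, ha, hle⟩ := he.exists_norm_empMean_smul_U_sub_linear_le hreg hD
    (fun w => (S.r_pos t (lam t) w).le) (S.measurable_r (hreg.measurable_b t) _)
    (he.integrable_r_G hreg t) hθ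
  obtain ⟨ρ', hρ', hb1, hb2⟩ := he.exists_ball hreg
  set T := ∫ d, onPattern 0 (fun w => S.r t (lam t) w • fderiv ℝ (fun θ => S.U θ w) θ₀) d ∂P
  have hk := tendsto_ratio hD hreg t
  have hlim := ((hk.mul ((((tendsto_iff_norm_sub_tendsto_zero.1 hφ).const_mul C).mul
    (he.tendsto_empMean_env hreg hD t)).add ha))).add
      ((tendsto_iff_norm_sub_tendsto_zero.1 hk).mul_const ‖T‖)
  simp only [mul_zero, zero_mul, add_zero] at hlim
  refine ⟨_, hlim, ?_⟩
  filter_upwards [he.eventually_norm_sub_le hφ, hle,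
    hθ.eventually (Metric.ball_mem_nhds θ₀ hρ')] with x hx h2 hball
  have hU : ∀ w, ‖S.U (θ x) w - S.U θ₀ w‖ ≤ ‖θ x - θ₀‖ * (1 + G w) := by
    intro w
    have h := (convex_ball θ₀ ρ').norm_image_sub_le_of_norm_fderiv_le (𝕜 := ℝ)
      (fun θ hθ => hreg.differentiableAt_U (hb1 hθ) w)
      (fun θ hθ => he.norm_fderiv_le w θ (hb2 hθ)) (Metric.mem_ball_self hρ') hball
    nlinarith [norm_nonneg (θ x - θ₀)]
  have h1 := hbound x t (φ x) hx (fun w => S.U (θ x) w - S.U θ₀ w) _ (norm_nonneg _) hU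
  have hsplit : ∀ ψ, empMean D x (onPattern 0 fun w => S.r t ψ w • (S.U (θ x) w - S.U θ₀ w)) =
      empMean D x (onPattern 0 fun w => S.r t ψ w • S.U (θ x) w) -
      empMean D x (onPattern 0 fun w => S.r t ψ w • S.U θ₀ w) := by
    intro ψ
    rw [← empMean_sub]
    refine congrArg _ (funext fun d => ?_)
    rw [← onPattern_sub]
    simp only [smul_sub]
  rw [hsplit, hsplit] at h1
  set A1 := empMean D x (onPattern 0 fun w => S.r t (φ x) w • S.U (θ x) w)
  set A0 := empMean D x (onPattern 0 fun w => S.r t (φ x) w • S.U θ₀ w)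
  set B1 := empMean D x (onPattern 0 fun w => S.r t (lam t) w • S.U (θ x) w)
  set B0 := empMean D x (onPattern 0 fun w => S.r t (lam t) w • S.U θ₀ w)
  have e : ratio D x t • A1 - ratio D x t • A0 - (patternRatio P t • T) (θ x - θ₀) =
      ratio D x t • ((A1 - A0 - (B1 - B0)) + (B1 - B0 - T (θ x - θ₀))) +
        (ratio D x t - patternRatio P t) • T (θ x - θ₀) := by
    rw [_root_.smul_apply]
    module
  rw [e]
  calc _ ≤ ratio D x t * (C * ‖φ x - lam t‖ * empMean D x (onPattern 0 (S.env lam ρ G t)) *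
        ‖θ x - θ₀‖ + a x * ‖θ x - θ₀‖) + ‖ratio D x t - patternRatio P t‖ *
        (‖T‖ * ‖θ x - θ₀‖) := by
        refine (norm_add_le _ _).trans (add_le_add ?_ ?_)
        · rw [norm_smul, Real.norm_of_nonneg (ratio_nonneg D x t)]
          exact mul_le_mul_of_nonneg_left ((norm_add_le _ _).trans (add_le_add h1 h2))
            (ratio_nonneg D x t)
        · rw [norm_smul]
          exact mul_le_mul_of_nonneg_left (T.le_opNorm _) (norm_nonneg _)
    _ = _ := by ring

theorem Envelope.exists_norm_USPS_sub_linear_le (he : S.Envelope P Θ θ₀ lam ρ G)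
    (hreg : S.Regular P Θ θ₀ lam) (hmodel : S.DensityRatioModel P lam) (hmar : S.ReducedMAR P Θ)
    (hD : IsIIDSample P μ D) {φ : ℕ × Ω → (t : Fin K) → E (S.L t + 1)}
    (hφ : ∀ t, Tendsto (fun x => φ x t) (probFilter μ) (𝓝 (lam t))) {θ : ℕ × Ω → E q}
    (hθ : Tendsto θ (probFilter μ) (𝓝 θ₀)) :
    ∃ a : ℕ × Ω → ℝ, Tendsto a (probFilter μ) (𝓝 0) ∧ ∀ᶠ x in probFilter μ,
      ‖S.USPS (path D x) x.1 (φ x) (θ x) - S.USPS (path D x) x.1 (φ x) θ₀ -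
        S.gradient P θ₀ (θ x - θ₀)‖ ≤ a x * ‖θ x - θ₀‖ := by
  have hG0 : Integrable (onPattern 0 fun w => 1 * G w) P :=
    integrable_onPattern_of_integrable 0 (by simpa using he.integrable_G)
  obtain ⟨a0, ha0, hle0⟩ := he.exists_norm_empMean_smul_U_sub_linear_le hreg hD
    (c := fun _ => 1) (fun _ => zero_le_one) measurable_const hG0 hθ
  simp only [one_smul] at hle0
  choose a ha hle using fun t => he.exists_norm_calibrated_sub_linear_le hreg hD (hφ t) hθ
  have hlim := ha0.add (tendsto_finsetSum Finset.univ fun t _ => ha t)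
  simp only [Finset.sum_const_zero, add_zero] at hlim
  refine ⟨_, hlim, ?_⟩
  filter_upwards [hle0, eventually_all.2 hle] with x h0 h1
  rw [USPS_eq, USPS_eq, he.gradient_eq hreg hmodel hmar, _root_.add_apply,
    _root_.sum_apply, add_mul, Finset.sum_mul]
  refine le_trans (le_of_eq ?_) ((norm_add_le _ _).trans (add_le_add h0
    (norm_sum_le_of_le Finset.univ fun t _ => h1 t)))
  congr 1
  rw [Finset.sum_sub_distrib, Finset.sum_sub_distrib]
  abel

/-! ### The linearized estimating function -/

/-- The mean of the bracket in the influence function. -/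
def linearScore (S : Design X p K q) (P : Measure (Datum X p K)) (θ₀ : E q)
    (lam : (t : Fin K) → E (S.L t + 1)) (D : ℕ → Ω → Datum X p K) (x : ℕ × Ω) : E q :=
  empMean D x (onPattern 0 (S.U θ₀)) +
    ∑ t, (empMean D x (onPattern t.succ fun w => S.regCoeff P θ₀ lam t (S.z t w)) +
      ratio D x t • empMean D x (onPattern 0 fun w => S.r t (lam t) w • S.resid P θ₀ lam t w))

omit [IsProbabilityMeasure P] [MeasurableSpace Ω] in
theorem inv_sqrt_smul_sum_influence (x : ℕ × Ω) :
    (√(x.1 : ℝ))⁻¹ • ∑ i ∈ Finset.range x.1,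
      S.influence (path D x) x.1 P θ₀ lam (S.regCoeff P θ₀ lam) i =
    -(√(x.1 : ℝ) • (S.gradient P θ₀).inverse (linearScore S P θ₀ lam D x)) := by
  have e : linearScore S P θ₀ lam D x = empMean D x (fun d : Datum X p K =>
      onPattern 0 (S.U θ₀) d +
      ∑ t, onPattern t.succ (fun w => S.regCoeff P θ₀ lam t (S.z t w)) d +
      ∑ t, ratio D x t • onPattern 0 (fun w => S.r t (lam t) w • S.resid P θ₀ lam t w) d) := by
    rw [empMean_add, empMean_add, empMean_sum, empMean_sum, linearScore, Finset.sum_add_distrib,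
      add_assoc]
    simp only [empMean_const_smul]
  have hinf : ∀ i, S.influence (path D x) x.1 P θ₀ lam (S.regCoeff P θ₀ lam) i =
      -(S.gradient P θ₀).inverse ((fun d : Datum X p K =>
      onPattern 0 (S.U θ₀) d +
      ∑ t, onPattern t.succ (fun w => S.regCoeff P θ₀ lam t (S.z t w)) d +
      ∑ t, ratio D x t • onPattern 0 (fun w => S.r t (lam t) w • S.resid P θ₀ lam t w) d)
        (D i x.2)) := by
    intro i
    rw [influence]
    congr 2
    simp only [onPattern, ratio, resid]
    split_ifs <;> simp [mul_smul]
  simp only [hinf, Finset.sum_neg_distrib, smul_neg, ← map_sum]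
  rw [e, empMean, ← map_smul, ← map_smul, smul_smul]
  congr 3
  -- `√N / N = 1 / √N` also for `N = 0`, where both sides are zero.
  rw [← div_eq_mul_inv, ← one_div, Real.sqrt_div_self']

/-- The random ratios are kept apart: the terms without them form a centred i.i.d. mean, and each
ratio multiplies a mean of weighted residuals that is centred on its own. -/
theorem Envelope.boundedInProb_linearScore (he : S.Envelope P Θ θ₀ lam ρ G)
    (hreg : S.Regular P Θ θ₀ lam) (hmodel : S.DensityRatioModel P lam) (hmar : S.ReducedMAR P Θ)
    (hD : IsIIDSample P μ D) :
    BoundedInProb μ fun x => √(x.1 : ℝ) * ‖linearScore S P θ₀ lam D x‖ := by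
  have hUm := hreg.measurable_U θ₀ hreg.mem
  have hβm : ∀ t, Measurable fun w => S.regCoeff P θ₀ lam t (S.z t w) := fun t =>
    (S.regCoeff P θ₀ lam t).continuous.measurable.comp (S.measurable_z (hreg.measurable_b t))
  have hU2 : MemLp (onPattern 0 (S.U θ₀)) 2 P := memLp_onPattern_of_memLp 0 hreg.memLp_U
  have hβ2 : ∀ t, MemLp (onPattern t.succ fun w => S.regCoeff P θ₀ lam t (S.z t w)) 2 P := by
    intro t
    have := (S.regCoeff P θ₀ lam t).comp_memLp' (he.memLp_onPattern_z hreg hmodel t)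
    refine this.ae_eq (Eventually.of_forall fun d => ?_)
    exact map_onPattern _ _ _ _
  have hr2 : ∀ t, MemLp (onPattern 0 fun w => S.r t (lam t) w • S.resid P θ₀ lam t w) 2 P := by
    intro t
    have h1 := (memLp_onPattern_iff (hreg.pattern_pos 0)
      (f := fun w => S.r t (lam t) w • S.U θ₀ w)).2 (hreg.memLp_r_U t)
    have h2 := (S.regCoeff P θ₀ lam t).comp_memLp' (hreg.memLp_onPattern_r_z t)
    refine (h1.sub h2).ae_eq (Eventually.of_forall fun d => ?_)
    simp only [Pi.sub_apply, Function.comp_apply]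
    rw [map_onPattern, ← onPattern_sub]
    simp only [map_smul, ← smul_sub, resid]
  let F : Datum X p K → E q := fun d => onPattern 0 (S.U θ₀) d +
    ∑ t : Fin K, onPattern t.succ (fun w => S.regCoeff P θ₀ lam t (S.z t w)) d
  have hFm : Measurable F := (measurable_onPattern 0 hUm).add
    (Finset.measurable_sum _ fun t _ => measurable_onPattern t.succ (hβm t))
  have hF2 : MemLp F 2 P := hU2.add (memLp_finsetSum _ fun t _ => hβ2 t)
  -- Moving `β z_t` to the complete pattern and replacing it there by `U`, as the normal equations
  -- permit, yields the decomposition of `E U(θ₀) = 0`.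
  have hF0 : ∫ d, F d ∂P = 0 := by
    have h1 : ∀ t, ∫ d, onPattern t.succ (fun w => S.regCoeff P θ₀ lam t (S.z t w)) d ∂P =
        patternRatio P t • ∫ d, onPattern 0 (fun w => S.r t (lam t) w • S.U θ₀ w) d ∂P := by
      intro t
      rw [hreg.integral_onPattern_comp_z hmodel t (g := fun v => S.regCoeff P θ₀ lam t v)
        (S.regCoeff P θ₀ lam t).continuous.stronglyMeasurable]
      congr 1
      have h2 := he.integral_r_resid hreg t
      have e : ∀ d : Datum X p K, onPattern 0 (fun w => S.r t (lam t) w • S.resid P θ₀ lam t w) d =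
          onPattern 0 (fun w => S.r t (lam t) w • S.U θ₀ w) d -
          onPattern 0 (fun w => S.r t (lam t) w • S.regCoeff P θ₀ lam t (S.z t w)) d := by
        intro d
        rw [← onPattern_sub]
        simp only [← smul_sub, resid]
      simp only [e] at h2
      rw [integral_sub (he.integrable_r_U hreg t hreg.mem)] at h2
      · exact (sub_eq_zero.1 h2).symm
      · exact (hreg.integrable_onPattern_comp_z_iff hmodel t
          (g := fun v => S.regCoeff P θ₀ lam t v)
          (S.regCoeff P θ₀ lam t).continuous.stronglyMeasurable).1
          ((hβ2 t).integrable (by norm_num))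
    rw [integral_add (hU2.integrable (by norm_num))
      (integrable_finsetSum _ fun t _ => (hβ2 t).integrable (by norm_num)),
      integral_finsetSum _ fun t _ => (hβ2 t).integrable (by norm_num)]
    simp only [h1]
    rw [← he.integral_U_eq hreg hmodel hmar hreg.mem]
    exact (hreg.identified θ₀ hreg.mem).2 rfl
  have hB := (boundedInProb_sqrt_mul_norm_empMean hD hFm hF2 hF0).add
    (BoundedInProb.sum Finset.univ fun t _ => boundedInProb_mul_of_tendsto
      (tendsto_ratio hD hreg t) (boundedInProb_sqrt_mul_norm_empMean hD
        (measurable_onPattern 0 ((S.measurable_r (hreg.measurable_b t) _).smul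
          (hreg.measurable_resid t))) (hr2 t) (he.integral_r_resid hreg t)))
  refine hB.of_abs_le (c := 1) (Eventually.of_forall fun x => ?_)
  have hs : 0 ≤ √(x.1 : ℝ) := Real.sqrt_nonneg _
  have hk := fun t => ratio_nonneg D x t
  rw [one_mul, abs_of_nonneg (by positivity)]
  refine le_trans ?_ (le_abs_self _)
  have e : linearScore S P θ₀ lam D x = empMean D x F + ∑ t, ratio D x t •
      empMean D x (onPattern 0 fun w => S.r t (lam t) w • S.resid P θ₀ lam t w) := by
    rw [empMean_add, empMean_sum, linearScore, Finset.sum_add_distrib, add_assoc]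
  rw [e]
  calc _ ≤ √(x.1 : ℝ) * (‖empMean D x F‖ + ∑ t, ratio D x t *
        ‖empMean D x (onPattern 0 fun w => S.r t (lam t) w • S.resid P θ₀ lam t w)‖) := by
        refine mul_le_mul_of_nonneg_left ((norm_add_le _ _).trans (add_le_add le_rfl
          (norm_sum_le_of_le _ fun t _ => ?_))) hs
        rw [norm_smul, Real.norm_of_nonneg (hk t)]
    _ = _ := by
        rw [mul_add, Finset.mul_sum]
        congr 1
        refine Finset.sum_congr rfl fun t _ => ?_
        exact mul_left_comm _ _ _

/-- Calibration trades the weighted fitted values on the complete units for the observed ones in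
pattern `t` without error. Only the effect of `φ` on the residual means remains. -/
theorem Envelope.exists_norm_USPS_sub_linearScore_le (he : S.Envelope P Θ θ₀ lam ρ G)
    (hreg : S.Regular P Θ θ₀ lam)
    (hD : IsIIDSample P μ D) {φ : ℕ × Ω → (t : Fin K) → E (S.L t + 1)}
    (hcal : ∀ᶠ x in probFilter μ, ∀ t, S.IsCalibrated (path D x) x.1 t (φ x t))
    (hφ : ∀ t, Tendsto (fun x => φ x t) (probFilter μ) (𝓝 (lam t))) :
    ∃ a : Fin K → ℕ × Ω → ℝ, (∀ t, Tendsto (a t) (probFilter μ) (𝓝 0)) ∧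
      ∀ᶠ x in probFilter μ,
      ‖S.USPS (path D x) x.1 (φ x) θ₀ - linearScore S P θ₀ lam D x‖ ≤
        ∑ t, a t x * ‖φ x t - lam t‖ := by
  choose a ha hle using fun t => he.exists_norm_empMean_resid_le hreg hD (hφ t)
  refine ⟨a, ha, ?_⟩
  filter_upwards [hcal, eventually_all.2 hle] with x hx h1
  refine le_trans (le_of_eq ?_) (norm_sum_le_of_le Finset.univ fun t _ => h1 t)
  congr 1
  rw [USPS_eq, linearScore, add_sub_add_left_eq_sub, ← Finset.sum_sub_distrib]
  refine Finset.sum_congr rfl fun t _ => ?_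
  have h2 : ratio D x t • empMean D x (onPattern 0 fun w => S.r t (φ x t) w • S.U θ₀ w) =
      ratio D x t • empMean D x
        (onPattern 0 fun w => S.r t (φ x t) w • S.resid P θ₀ lam t w) +
      empMean D x (onPattern t.succ fun w => S.regCoeff P θ₀ lam t (S.z t w)) := by
    -- The exchange: the regression coefficient is applied to both sides of the calibration
    -- equation.
    have h3 := congrArg (S.regCoeff P θ₀ lam t) (hx t).ratio_smul
    rw [map_smul, map_empMean, map_empMean] at h3
    simp only [map_onPattern, map_smul] at h3
    rw [← h3, ← smul_add, ← empMean_add]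
    congr 2
    ext1 d
    rw [← onPattern_add]
    simp only [resid, ← smul_add, sub_add_cancel]
  rw [h2, smul_sub]
  abel

end Estimator

end Design

namespace Design

/-! ### The root-`N` expansion of the estimator -/

section Linearization

variable {X : Type*} [MeasurableSpace X] {p K q : ℕ} {S : Design X p K q}
  {P : Measure (Datum X p K)} [IsProbabilityMeasure P] {Θ : Set (E q)} {θ₀ : E q}
  {lam : (t : Fin K) → E (S.L t + 1)} {ρ : ℝ} {G : FullData X p → ℝ}
  {Ω : Type*} [MeasurableSpace Ω] {μ : Measure Ω} [IsProbabilityMeasure μ]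
  {D : ℕ → Ω → Datum X p K}

/-- The asymptotically linear representation of the smoothed propensity score estimator. -/
theorem Envelope.tendsto_estimator_sub_linear (he : S.Envelope P Θ θ₀ lam ρ G)
    (hreg : S.Regular P Θ θ₀ lam) (hmodel : S.DensityRatioModel P lam) (hmar : S.ReducedMAR P Θ)
    (hD : IsIIDSample P μ D) {φ : ℕ × Ω → (t : Fin K) → E (S.L t + 1)}
    (hcal : ∀ᶠ x in probFilter μ, ∀ t, S.IsCalibrated (path D x) x.1 t (φ x t))
    {θ : ℕ × Ω → E q}
    (hest : ∀ᶠ x in probFilter μ, θ x ∈ Θ ∧ S.USPS (path D x) x.1 (φ x) (θ x) = 0) :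
    Tendsto (fun x => √(x.1 : ℝ) • (θ x - θ₀ +
      (S.gradient P θ₀).inverse (linearScore S P θ₀ lam D x))) (probFilter μ) (𝓝 0) := by
  choose C hC hφC using fun t => he.norm_calibrated_sub_le hreg hmodel hD
    (hcal.mono fun x hx => hx t)
  have hφ : ∀ t, Tendsto (fun x => φ x t) (probFilter μ) (𝓝 (lam t)) := fun t =>
    tendsto_of_norm_sub_le_score hreg hmodel hD (hφC t)
  have hθ := he.tendsto_estimator hreg hmodel hmar hD hφ hest
  obtain ⟨a, ha, hle⟩ := he.exists_norm_USPS_sub_linear_le hreg hmodel hmar hD hφ hθ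
  obtain ⟨b, hb, hleb⟩ := he.exists_norm_USPS_sub_linearScore_le hreg hD hcal hφ
  set T := (S.gradient P θ₀).inverse with hT
  have hTinv : ∀ v, T (S.gradient P θ₀ v) = v := by
    intro v
    obtain ⟨e, he'⟩ := hreg.nonsingular
    rw [hT, ← he', ContinuousLinearMap.inverse_equiv]
    simp
  set τ := ‖T‖ with hτ
  have hτ0 : 0 ≤ τ := norm_nonneg _
  set r : ℕ × Ω → ℝ := fun x => ∑ t, |b t x| * C t * ‖score S lam D t x‖ with hr
  have hr0 : ∀ x, 0 ≤ r x := fun x =>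
    Finset.sum_nonneg fun t _ => mul_nonneg (mul_nonneg (abs_nonneg _) (hC t)) (norm_nonneg _)
  -- An `o_p(1)` factor times a score of order `N^{-1/2}`: here the rate of the calibrated
  -- parameters enters.
  have hrlim : Tendsto (fun x => √(x.1 : ℝ) * r x) (probFilter μ) (𝓝 0) := by
    have hbC : ∀ t, Tendsto (fun x => |b t x| * C t) (probFilter μ) (𝓝 0) := fun t => by
      simpa using (hb t).abs.mul_const (C t)
    have h := tendsto_finsetSum Finset.univ fun t _ =>
      (he.boundedInProb_score hD hreg hmodel t).tendsto_mul_zero (hbC t)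
    rw [Finset.sum_const_zero] at h
    refine h.congr fun x => ?_
    rw [hr, Finset.mul_sum]
    exact Finset.sum_congr rfl fun t _ => by ring
  have ha' : Tendsto (fun x => |a x|) (probFilter μ) (𝓝 0) := by simpa using ha.abs
  have hBlim := (he.boundedInProb_linearScore hreg hmodel hmar hD).tendsto_mul_zero ha'
  have hlim := (((hBlim.add (ha'.mul hrlim)).const_mul (2 * τ)).add hrlim).const_mul τ
  simp only [mul_zero, add_zero] at hlim
  refine squeeze_zero_norm' ?_ hlim
  -- The threshold `1 / 2` lets the term `τ |a| ‖Δ‖` be absorbed into `‖Δ‖`. The resulting bound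
  -- `‖Δ‖ ≤ 2 τ (‖B‖ + r)` supplies the rate of the estimator, which turns the linearization error
  -- into `o_p(N^{-1/2})`.
  have hsmall : ∀ᶠ x in probFilter μ, τ * |a x| ≤ 1 / 2 := by
    have h := ha'.const_mul τ
    rw [mul_zero] at h
    exact h.eventually_le_const (by norm_num)
  filter_upwards [hest, hle, hleb, eventually_all.2 hφC, hsmall] with x hx h1 h2 h3 h4
  set Δ := θ x - θ₀ with hΔ
  set B := linearScore S P θ₀ lam D x with hB
  have hs : 0 ≤ √(x.1 : ℝ) := Real.sqrt_nonneg _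
  have hr1 : ∑ t, b t x * ‖φ x t - lam t‖ ≤ r x := Finset.sum_le_sum fun t _ =>
    calc _ ≤ |b t x| * ‖φ x t - lam t‖ :=
          mul_le_mul_of_nonneg_right (le_abs_self _) (norm_nonneg _)
      _ ≤ |b t x| * (C t * ‖score S lam D t x‖) :=
          mul_le_mul_of_nonneg_left (h3 t) (abs_nonneg _)
      _ = _ := by ring
  have h5 : ‖S.gradient P θ₀ Δ + B‖ ≤ |a x| * ‖Δ‖ + r x := by
    have e : S.gradient P θ₀ Δ + B =
        -(S.USPS (path D x) x.1 (φ x) (θ x) - S.USPS (path D x) x.1 (φ x) θ₀ -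
          S.gradient P θ₀ Δ) - (S.USPS (path D x) x.1 (φ x) θ₀ - B) := by
      rw [hx.2]; abel
    rw [e]
    refine (norm_sub_le _ _).trans (add_le_add ?_ (h2.trans hr1))
    rw [norm_neg]
    exact h1.trans (mul_le_mul_of_nonneg_right (le_abs_self _) (norm_nonneg _))
  have h6 : ‖Δ + T B‖ ≤ τ * (|a x| * ‖Δ‖ + r x) := by
    rw [show Δ + T B = T (S.gradient P θ₀ Δ + B) by rw [map_add, hTinv]]
    exact (T.le_opNorm _).trans (mul_le_mul_of_nonneg_left h5 hτ0)
  have h7 : ‖Δ‖ ≤ 2 * τ * (‖B‖ + r x) := by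
    have e : ‖Δ‖ ≤ ‖Δ + T B‖ + ‖T B‖ := by
      simpa using norm_sub_le (Δ + T B) (T B)
    have h8 := T.le_opNorm B
    have h9 := mul_le_mul_of_nonneg_right h4 (norm_nonneg Δ)
    linarith
  rw [norm_smul, Real.norm_of_nonneg hs]
  calc √(x.1 : ℝ) * ‖Δ + T B‖
      ≤ √(x.1 : ℝ) * (τ * (|a x| * (2 * τ * (‖B‖ + r x)) + r x)) := by
        refine mul_le_mul_of_nonneg_left (h6.trans ?_) hs
        gcongr
    _ = _ := by ring

end Linearization

end Design

end

theorem mainTheorem3 {X : Type*} [MeasurableSpace X] {p K q : ℕ} (S : Design X p K q)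
    -- the law of one unit, the parameter set and the true parameters
    (P : Measure (Datum X p K)) [IsProbabilityMeasure P] (Θ : Set (E q)) (θ₀ : E q)
    (lam : (t : Fin K) → E (S.L t + 1))
    (hmodel : S.DensityRatioModel P lam) (hmar : S.ReducedMAR P Θ) (hreg : S.Regular P Θ θ₀ lam)
    -- independent and identically distributed units
    {Ω : Type*} [MeasurableSpace Ω] (μ : Measure Ω) [IsProbabilityMeasure μ]
    (D : ℕ → Ω → Datum X p K) (hDmeas : ∀ i, Measurable (D i)) (hDlaw : ∀ i, μ.map (D i) = P)
    (hDindep : iIndepFun D μ) :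
    ∃ β : (t : Fin K) → E (S.L t + 1) →L[ℝ] E q,
      -- `β t` is the limit in probability of the solution of the weighted normal equations
      (∀ t : Fin K,
        WithProbTendingToOne μ (fun N ω =>
          ∃! B, S.IsRegressionCoeff (fun i => D i ω) N θ₀ t (lam t) B) ∧
        ∀ B : ℕ → Ω → E (S.L t + 1) →L[ℝ] E q,
          WithProbTendingToOne μ (fun N ω =>
            S.IsRegressionCoeff (fun i => D i ω) N θ₀ t (lam t) (B N ω)) →
          TendstoInMeasure μ B atTop (fun _ => β t)) ∧
      -- the asymptotically linear representation, for all solutions of the equations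
      ∀ (φ : ℕ → Ω → (t : Fin K) → E (S.L t + 1)) (θ : ℕ → Ω → E q),
        WithProbTendingToOne μ (fun N ω =>
          ∀ t, S.IsCalibrated (fun i => D i ω) N t (φ N ω t)) →
        WithProbTendingToOne μ (fun N ω =>
          θ N ω ∈ Θ ∧ S.USPS (fun i => D i ω) N (φ N ω) (θ N ω) = 0) →
        TendstoInMeasure μ
          (fun (N : ℕ) ω => √(N : ℝ) • (θ N ω - θ₀) -
            (√(N : ℝ))⁻¹ • ∑ i ∈ Finset.range N, S.influence (fun i => D i ω) N P θ₀ lam β i)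
          atTop (fun _ => 0) := by
  have hD : IsIIDSample P μ D := ⟨hDmeas, hDlaw, hDindep⟩
  obtain ⟨ρ, G, he⟩ := hreg.exists_envelope
  refine ⟨S.regCoeff P θ₀ lam, fun t => ⟨he.existsUnique_isRegressionCoeff hreg hD t,
    fun B hB => ?_⟩, fun φ θ hφ hθ => ?_⟩
  · exact tendstoInMeasure_const_iff.2
      (he.tendsto_of_isRegressionCoeff hreg hD t (B := fun x => B x.1 x.2) hB)
  · refine tendstoInMeasure_const_iff.2 ?_
    refine (he.tendsto_estimator_sub_linear hreg hmodel hmar hD (φ := fun x => φ x.1 x.2)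
      (θ := fun x => θ x.1 x.2) hφ hθ).congr fun x => ?_
    rw [smul_add, ← sub_neg_eq_add, ← Design.inv_sqrt_smul_sum_influence]
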